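/- Problem A: let $G=(V,E)$ be a connected network with $|V|=n\ge 1$ vertices, an edge length $c_e>0$ for every $e\in E$, and a weight $w_{\{u,v\}}\ge 0$ for every pair of vertices, with $w_{\{v,v\}}=0$; the relevant pairs are those of positive weight. The edges are constructed one after another, without interruption, starting at time $0$ and at unit speed (edge $e$ takes time $c_e$). A solution sequence is a sequence of distinct edges of $G$ that form a spanning tree of $G$; given a solution sequence, the connection time $t_{\{u,v\}}$ of a pair is the earliest time at which $u$ and $v$ are connected by the constructed edges. The task is to find a solution sequence that minimizes the total weighted connection time $\sum_{\{u,v\}:\,w_{\{u,v\}}>0} w_{\{u,v\}}\,t_{\{u,v\}}$. Statement: if $G$ is a path, Problem A can be solved in $O(n^4)$ time. That is, there are a program for the unit-cost random access machine with real arithmetic and a constant $C$ such that, for every $n\ge 1$ and every instance of Problem A on $n$ vertices whose network is a path (with arbitrarily labelled vertices, real edge lengths and real weights; the input consists of $n$, the adjacency matrix, the matrix of edge lengths and the matrix of weights), the program halts after at most $C\,n^4$ steps and outputs an optimal solution sequence. Here the machine has index storage for natural numbers (constants, addition, truncated subtraction, comparison, indirect addressing) and storage for real numbers (rational constants, $+,-,\times,/$,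 comparison), and each operation takes one step. -/

import Mathlib

/-! ## The network construction problem -/

namespace NetworkConstruction

/-- An instance of the problem on the vertices `0, …, n - 1`: a connected network with positive
edge lengths, and a nonnegative weight for every unordered pair of vertices, which is zero for
the pairs `{v, v}`. -/
structure Instance (n : ℕ) where
  graph : SimpleGraph (Fin n)
  connected : graph.Connected
  len : Sym2 (Fin n) → ℝ
  len_pos : ∀ e ∈ graph.edgeSet, 0 < len e
  weight : Sym2 (Fin n) → ℝ
  weight_nonneg : ∀ p, 0 ≤ weight p
  weight_diag : ∀ v, weight s(v, v) = 0

variable {n : ℕ}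

/-- The subnetwork that consists of all `n` vertices and the edges in the list `S`. -/
def built (S : List (Sym2 (Fin n))) : SimpleGraph (Fin n) :=
  SimpleGraph.fromEdgeSet {e | e ∈ S}

/-- The network is a path (with its vertices labelled arbitrarily). -/
def Instance.IsPath (I : Instance n) : Prop :=
  Nonempty (SimpleGraph.pathGraph n ≃g I.graph)

/-- A solution sequence: a sequence of pairwise distinct edges of the network that form a
spanning tree. -/
def Instance.IsSolution (I : Instance n) (S : List (Sym2 (Fin n))) : Prop :=
  S.Nodup ∧ (∀ e ∈ S, e ∈ I.graph.edgeSet) ∧ (built S).IsTree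

/-- The least number `k` such that the first `k` edges of `S` connect the two members of the
pair `p`. -/
noncomputable def connectionIndex (S : List (Sym2 (Fin n))) (p : Sym2 (Fin n)) : ℕ :=
  sInf {k : ℕ | ∀ u ∈ p, ∀ v ∈ p, (built (S.take k)).Reachable u v}

/-- The connection time of the pair `p` when the edges are constructed one after another in the
order `S`, at unit speed and starting at time 0. -/
noncomputable def Instance.connectionTime (I : Instance n) (S : List (Sym2 (Fin n)))
    (p : Sym2 (Fin n)) : ℝ :=
  ((S.take (connectionIndex S p)).map I.len).sum

open Classical in
/-- The relevant pairs: those of positive weight. -/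
noncomputable def Instance.relevantPairs (I : Instance n) : Finset (Sym2 (Fin n)) :=
  Finset.univ.filter fun p => 0 < I.weight p

/-- The total weighted connection time. -/
noncomputable def Instance.cost (I : Instance n) (S : List (Sym2 (Fin n))) : ℝ :=
  ∑ p ∈ I.relevantPairs, I.weight p * I.connectionTime S p

/-- `S` is an optimal solution sequence. -/
def Instance.IsOptimal (I : Instance n) (S : List (Sym2 (Fin n))) : Prop :=
  I.IsSolution S ∧ ∀ S', I.IsSolution S' → I.cost S ≤ I.cost S'

end NetworkConstruction

/-! ## Real random access machine programs with a step count

Unit-cost model with two sorts of storage, natural numbers (used as indices, with addition and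
truncated subtraction only) and real numbers (with the four field operations).  Only natural
numbers can be used as addresses, the two sorts interact in no other way, and the only constants
are natural and rational numbers. A program is a finite object that does not depend on the input. -/

namespace RealRAM

/-- Contents of the storage: scalar variables and one-dimensional arrays of each sort. -/
structure State where
  ivar : ℕ → ℕ
  iarr : ℕ → ℕ → ℕ
  rvar : ℕ → ℝ
  rarr : ℕ → ℕ → ℝ

/-- Index expressions. -/
inductive IExp : Type
  | const (k : ℕ)
  | var (x : ℕ)
  | get (a : ℕ) (i : IExp)
  | add (e f : IExp)
  | sub (e f : IExp)

/-- Real expressions. -/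
inductive RExp : Type
  | const (q : ℚ)
  | var (x : ℕ)
  | get (a : ℕ) (i : IExp)
  | add (e f : RExp)
  | sub (e f : RExp)
  | mul (e f : RExp)
  | div (e f : RExp)

/-- Tests. -/
inductive BExp : Type
  | ieq (e f : IExp)
  | ile (e f : IExp)
  | rle (e f : RExp)
  | not (b : BExp)
  | and (b c : BExp)

/-- Programs. -/
inductive Cmd : Type
  | skip
  | iset (x : ℕ) (e : IExp)
  | rset (x : ℕ) (e : RExp)
  | iput (a : ℕ) (i : IExp) (e : IExp)
  | rput (a : ℕ) (i : IExp) (e : RExp)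
  | seq (c d : Cmd)
  | ite (b : BExp) (c d : Cmd)
  | loop (b : BExp) (c : Cmd)

def IExp.eval (s : State) : IExp → ℕ
  | const k => k
  | var x => s.ivar x
  | get a i => s.iarr a (i.eval s)
  | add e f => e.eval s + f.eval s
  | sub e f => e.eval s - f.eval s

/-- The number of unit-cost operations of an evaluation. -/
def IExp.steps : IExp → ℕ
  | const _ => 1
  | var _ => 1
  | get _ i => i.steps + 1
  | add e f => e.steps + f.steps + 1
  | sub e f => e.steps + f.steps + 1

noncomputable def RExp.eval (s : State) : RExp → ℝ
  | const q => (q : ℝ)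
  | var x => s.rvar x
  | get a i => s.rarr a (i.eval s)
  | add e f => e.eval s + f.eval s
  | sub e f => e.eval s - f.eval s
  | mul e f => e.eval s * f.eval s
  | div e f => e.eval s / f.eval s

/-- The number of unit-cost operations of an evaluation. -/
def RExp.steps : RExp → ℕ
  | const _ => 1
  | var _ => 1
  | get _ i => i.steps + 1
  | add e f => e.steps + f.steps + 1
  | sub e f => e.steps + f.steps + 1
  | mul e f => e.steps + f.steps + 1
  | div e f => e.steps + f.steps + 1

def BExp.holds (s : State) : BExp → Prop
  | ieq e f => e.eval s = f.eval s
  | ile e f => e.eval s ≤ f.eval s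
  | rle e f => e.eval s ≤ f.eval s
  | not b => ¬ b.holds s
  | and b c => b.holds s ∧ c.holds s

/-- The number of unit-cost operations of a test. -/
def BExp.steps : BExp → ℕ
  | ieq e f => e.steps + f.steps + 1
  | ile e f => e.steps + f.steps + 1
  | rle e f => e.steps + f.steps + 1
  | not b => b.steps + 1
  | and b c => b.steps + c.steps + 1

def State.setIvar (s : State) (x v : ℕ) : State :=
  { s with ivar := Function.update s.ivar x v }

def State.setIarr (s : State) (a i v : ℕ) : State :=
  { s with iarr := Function.update s.iarr a (Function.update (s.iarr a) i v) }

noncomputable def State.setRvar (s : State) (x : ℕ) (v : ℝ) : State :=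
  { s with rvar := Function.update s.rvar x v }

noncomputable def State.setRarr (s : State) (a i : ℕ) (v : ℝ) : State :=
  { s with rarr := Function.update s.rarr a (Function.update (s.rarr a) i v) }

/-- `Exec c s t s'`: started in the state `s`, the program `c` halts after exactly `t` steps, in
the state `s'`. -/
inductive Exec : Cmd → State → ℕ → State → Prop
  | skip (s : State) : Exec .skip s 1 s
  | iset (s : State) (x : ℕ) (e : IExp) :
      Exec (.iset x e) s (e.steps + 1) (s.setIvar x (e.eval s))
  | rset (s : State) (x : ℕ) (e : RExp) :
      Exec (.rset x e) s (e.steps + 1) (s.setRvar x (e.eval s))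
  | iput (s : State) (a : ℕ) (i e : IExp) :
      Exec (.iput a i e) s (i.steps + e.steps + 1) (s.setIarr a (i.eval s) (e.eval s))
  | rput (s : State) (a : ℕ) (i : IExp) (e : RExp) :
      Exec (.rput a i e) s (i.steps + e.steps + 1) (s.setRarr a (i.eval s) (e.eval s))
  | seq {c d : Cmd} {s₀ s₁ s₂ : State} {t₁ t₂ : ℕ} :
      Exec c s₀ t₁ s₁ → Exec d s₁ t₂ s₂ → Exec (.seq c d) s₀ (t₁ + t₂) s₂
  | ite_true {b : BExp} {c d : Cmd} {s s' : State} {t : ℕ} :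
      b.holds s → Exec c s t s' → Exec (.ite b c d) s (b.steps + 1 + t) s'
  | ite_false {b : BExp} {c d : Cmd} {s s' : State} {t : ℕ} :
      ¬ b.holds s → Exec d s t s' → Exec (.ite b c d) s (b.steps + 1 + t) s'
  | loop_true {b : BExp} {c : Cmd} {s₀ s₁ s₂ : State} {t₁ t₂ : ℕ} :
      b.holds s₀ → Exec c s₀ t₁ s₁ → Exec (.loop b c) s₁ t₂ s₂ →
        Exec (.loop b c) s₀ (b.steps + 1 + t₁ + t₂) s₂
  | loop_false {b : BExp} {c : Cmd} {s : State} :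
      ¬ b.holds s → Exec (.loop b c) s (b.steps + 1) s

/-- Execution is deterministic: the final state and the number of steps are unique. -/
theorem Exec.deterministic {c : Cmd} {s s₁ s₂ : State} {t₁ t₂ : ℕ}
    (h₁ : Exec c s t₁ s₁) (h₂ : Exec c s t₂ s₂) : t₁ = t₂ ∧ s₁ = s₂ := by
  induction h₁ generalizing t₂ s₂ with
  | skip | iset | rset | iput | rput => cases h₂; exact ⟨rfl, rfl⟩
  | seq _ _ ih₁ ih₂ =>
    cases h₂ with
    | seq g₁ g₂ =>
      obtain ⟨rfl, rfl⟩ := ih₁ g₁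
      obtain ⟨rfl, rfl⟩ := ih₂ g₂
      exact ⟨rfl, rfl⟩
  | ite_true hb _ ih =>
    cases h₂ with
    | ite_true _ g => obtain ⟨rfl, rfl⟩ := ih g; exact ⟨rfl, rfl⟩
    | ite_false hb' _ => exact absurd hb hb'
  | ite_false hb _ ih =>
    cases h₂ with
    | ite_true hb' _ => exact absurd hb' hb
    | ite_false _ g => obtain ⟨rfl, rfl⟩ := ih g; exact ⟨rfl, rfl⟩
  | loop_true hb _ _ ih₁ ih₂ =>
    cases h₂ with
    | loop_true _ g₁ g₂ =>
      obtain ⟨rfl, rfl⟩ := ih₁ g₁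
      obtain ⟨rfl, rfl⟩ := ih₂ g₂
      exact ⟨rfl, rfl⟩
    | loop_false hb' => exact absurd hb hb'
  | loop_false hb =>
    cases h₂ with
    | loop_true hb' _ _ => exact absurd hb' hb
    | loop_false _ => exact ⟨rfl, rfl⟩

end RealRAM

/-! ## Input and output of the problem on the machine -/

namespace NetworkConstruction

open RealRAM

variable {n : ℕ}

/-- An `n × n` matrix stored row by row: the entry `(u, v)` is at position `u * n + v`, and all
other positions hold `0`. -/
def flatten {α : Type} [Zero α] (M : Fin n → Fin n → α) (i : ℕ) : α :=
  if h : i / n < n ∧ i % n < n then M ⟨i / n, h.1⟩ ⟨i % n, h.2⟩ else 0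

open Classical in
/-- The initial state: index variable 0 holds the number of vertices, index array 0 the adjacency
matrix, real array 0 the matrix of the edge lengths (0 where there is no edge), real array 1 the
matrix of the weights. Everything else is 0. -/
noncomputable def Instance.input (I : Instance n) : State where
  ivar x := if x = 0 then n else 0
  iarr a := if a = 0 then flatten fun u v => if I.graph.Adj u v then 1 else 0 else fun _ => 0
  rvar _ := 0
  rarr a :=
    if a = 0 then flatten fun u v => if I.graph.Adj u v then I.len s(u, v) else 0
    else if a = 1 then flatten fun u v => I.weight s(u, v)
    else fun _ => 0

/-- The sequence of edges `S` is the output in the state `s`: index variable 1 holds its length,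
and index arrays 1 and 2 hold the two endpoints of its edges, in order. -/
def IsOutput (s : State) (S : List (Sym2 (Fin n))) : Prop :=
  s.ivar 1 = S.length ∧
    ∀ (k : ℕ) (hk : k < S.length), ∃ u v : Fin n,
      S[k] = s(u, v) ∧ s.iarr 1 k = (u : ℕ) ∧ s.iarr 2 k = (v : ℕ)

end NetworkConstruction

/-! Only the order in which the edges `0, …, n - 2` of the path are built is to be chosen. Let
`f A` be the total weight of the pairs that the edges in `A` connect, and `c` the edge lengths. An
order costs `∑ e, c e * (f E - f (edges before e))`, and `f` is supermodular, since it counts the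
intervals contained in `A`. Scheduling jobs with a supermodular reward is hard in general. On a
path dynamic programming over intervals of edges works: once the last edge `k` of an interval is
fixed, nothing that crosses `k` is rewarded before the end, so the two sides of `k` interact only
by making each other wait, and it remains to interleave an optimal order of the left side with one
of the right side.

The interleaving is governed by a Sidney decomposition. `IsKey f c E κ` says that the measure `κ c`
dominates `f` and agrees with it on the sets of jobs of large key. It has three consequences.

* Whatever the interleaving, two jobs `i`, `j` from different sides make each other wait at a cost
  of at least `c i * c j * min (κ i) (κ j)` (`sum_min_le_crossCost`).
* Merging two orders sorted by decreasing keys attains this bound (`crossCost_eq_sum_min`), so that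
  merging, followed by `k`, is optimal among the orders that end with `k` (`IsJoin.orderCost_le`).
* If the merged order followed by `k` is an optimal order of the whole interval, then its keys are
  obtained by raising all keys to `μ`, the density of the last segment of the concave envelope of
  the curve that plots reward against time, and `k` gets the key `μ` (`IsKey.insert_last`). Here
  optimality is needed: by exchange, a minimal maximizer of `f - ν c` precedes all other jobs
  (`IsOptimalOrder.pos_lt_pos`), so that it avoids `k` or is everything.

Each of the `O(n ^ 2)` intervals has `O(n)` candidates for its last edge, and a candidate takes
`O(n)` steps: one merge, during which the cost and the density `μ` (the least density of a final
segment of the merged order) are computed. This gives `O(n ^ 4)`. To copy no list, every candidate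
is written into fresh storage, and a table keeps the address of the best candidate of every
interval; the keys of a candidate are not raised once its `μ` is known, but read as their maximum
with this `μ`, which is kept in a second table. The path itself is found in `O(n ^ 2)` steps, from
a vertex of degree at most one.

The program is verified by executing it on states. `Cmd.wp` is the weakest precondition of loop-free
code, `Runs.forVar` is the rule for counting loops, and `Frame` records that storage to which a
program does not assign is not changed.

The program uses its storage as follows.

* Index variables: 0 the number of vertices; 1 the length of the output; 10 to 14 the
  current interval, with the edges `a, …, b - 1` and the last edge `k`: 10 holds `b`, 11 holds
  `b - a - 1`, 12 holds `a`, 13 holds `k - a`, 14 holds `k`; 15 the position in the merged order, 16 and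
  17 the positions in the left and the right order; 18 and 19 the addresses of the two orders, 20
  the first free address; 21 the next edge. 2 to 8 serve to read the path, and 2 and 18 to write
  the result.
* Real variables: 0 weight from the new vertex, 1 the time of the interval, 2 its reward, 3 the
  cost of the candidate, 4 and 6 the remaining time and reward, 5 the least density, 7 the best
  cost, 8 and 9 the next keys on the two sides, 10 and 11 the values `μ` of the two sides, 12 the
  next key, 13 the reward collected.
* Index arrays: 0 the adjacency matrix, 1 and 2 the output, 3 the multiples of `n`, 4 the vertices
  in the order of the path, 5 the table of addresses, 6 the stored orders.
* Real arrays: 0 the lengths, 1 the weights, 3 the rewards of the intervals by left end, 4 the keys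
  and 5 the collected rewards of the stored orders, 6 the table of the values `μ`. -/

/-! ### Scheduling with a supermodular reward -/

namespace SupermodularScheduling

open Finset

/-- Supermodularity of the reward `f`: `f A` is what has been collected once exactly the jobs in `A`
are finished. -/
def Supermodular (f : Finset ℕ → ℝ) : Prop :=
  ∀ A B, f A + f B ≤ f (A ∪ B) + f (A ∩ B)

/-- The jobs of `E` that precede `e` in the order given by the positions `pos`; the job `e` need
not belong to `E`. -/
def before (pos : ℕ → ℕ) (E : Finset ℕ) (e : ℕ) : Finset ℕ :=
  E.filter fun x => pos x < pos e

/-- The total weighted completion time of an order, as a sum over the jobs: while the job `e` of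
length `c e` is processed, the reward that is still missing waits for `c e` units of time. -/
noncomputable def orderCost (f : Finset ℕ → ℝ) (c : ℕ → ℝ) (E : Finset ℕ) (pos : ℕ → ℕ) : ℝ :=
  ∑ e ∈ E, c e * (f E - f (before pos E e))

/-- The positions `pos` order the jobs of `E` with the least possible cost. -/
def IsOptimalOrder (f : Finset ℕ → ℝ) (c : ℕ → ℝ) (E : Finset ℕ) (pos : ℕ → ℕ) : Prop :=
  Set.InjOn pos E ∧ ∀ pos', Set.InjOn pos' E → orderCost f c E pos ≤ orderCost f c E pos'

theorem before_subset (pos : ℕ → ℕ) (E : Finset ℕ) (e : ℕ) : before pos E e ⊆ E :=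
  filter_subset _ _

theorem orderCost_congr {f : Finset ℕ → ℝ} {c : ℕ → ℝ} {E : Finset ℕ} {pos pos' : ℕ → ℕ}
    (h : ∀ x ∈ E, ∀ y ∈ E, pos x < pos y ↔ pos' x < pos' y) :
    orderCost f c E pos = orderCost f c E pos' := by
  unfold orderCost
  refine sum_congr rfl fun e he => ?_
  have : before pos E e = before pos' E e := filter_congr fun x hx => h x hx e he
  rw [this]

/-- Exchange argument: in an optimal order, an inclusion-minimal maximizer `M` of `f - μ c`
precedes all other jobs. Moving `M` to the front changes the cost by a sum over the inverted
pairs that is nonpositive by supermodularity, and negative if there is such a pair. -/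
theorem IsOptimalOrder.pos_lt_pos {f : Finset ℕ → ℝ} {c : ℕ → ℝ} {E M : Finset ℕ} {pos : ℕ → ℕ}
    {μ : ℝ} (hf : Supermodular f) (hc : ∀ e ∈ E, 0 < c e) (hopt : IsOptimalOrder f c E pos)
    (hME : M ⊆ E) (hmax : ∀ A ⊆ E, f A - μ * ∑ x ∈ A, c x ≤ f M - μ * ∑ x ∈ M, c x)
    (hmin : ∀ A ⊂ M, f A - μ * ∑ x ∈ A, c x < f M - μ * ∑ x ∈ M, c x)
    {a b : ℕ} (ha : a ∈ M) (hb : b ∈ E) (hbM : b ∉ M) : pos a < pos b := by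
  by_contra hab
  obtain ⟨hinj, hopt⟩ := hopt
  set N := E.sup pos + 1 with hN
  have hposN : ∀ x ∈ E, pos x < N := fun x hx => Nat.lt_succ_of_le (le_sup (f := pos) hx)
  set pos' : ℕ → ℕ := fun x => if x ∈ M then pos x else pos x + N with hpos'
  have hinj' : Set.InjOn pos' E := by
    intro x hx y hy hxy
    have hx' := hposN x hx
    have hy' := hposN y hy
    apply hinj hx hy
    simp only [hpos'] at hxy
    split_ifs at hxy <;> omega
  have hbM' : ∀ e ∈ M, before pos' E e = before pos E e ∩ M := by
    intro e he
    ext x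
    simp only [before, mem_filter, mem_inter, hpos', he, if_true]
    have := hposN e (hME he)
    constructor
    · rintro ⟨hx, h⟩
      split_ifs at h with hxM
      · exact ⟨⟨hx, h⟩, hxM⟩
      · omega
    · rintro ⟨⟨hx, h⟩, hxM⟩
      simp [hx, hxM, h]
  have hbE : ∀ e ∈ E \ M, before pos' E e = before pos E e ∪ M := by
    intro e he
    obtain ⟨heE, heM⟩ := mem_sdiff.1 he
    ext x
    simp only [before, mem_filter, mem_union, hpos', heM, if_false]
    constructor
    · rintro ⟨hx, h⟩
      split_ifs at h with hxM
      · exact Or.inr hxM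
      · exact Or.inl ⟨hx, by omega⟩
    · rintro (⟨hx, h⟩ | hxM)
      · refine ⟨hx, ?_⟩
        split_ifs <;> omega
      · have := hposN x (hME hxM)
        refine ⟨hME hxM, ?_⟩
        simp only [hxM, if_true]; omega
  have hsplit : ∀ g : ℕ → ℝ, ∑ e ∈ E, g e = ∑ e ∈ M, g e + ∑ e ∈ E \ M, g e := fun g => by
    rw [add_comm, sum_sdiff hME]
  have hsd : ∀ A, ∑ x ∈ A, c x - ∑ x ∈ A ∩ M, c x = ∑ x ∈ A \ M, c x := fun A => by
    have := sum_inter_add_sum_sdiff A M c; linarith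
  have hsd' : ∀ A, ∑ x ∈ M, c x - ∑ x ∈ A ∩ M, c x = ∑ x ∈ M \ A, c x := fun A => by
    have := sum_inter_add_sum_sdiff M A c
    rw [inter_comm] at this; linarith
  have h1 : ∀ e ∈ M, c e * (f E - f (before pos' E e)) ≤
      c e * (f E - f (before pos E e)) + c e * (μ * ∑ x ∈ before pos E e \ M, c x) := by
    intro e he
    rw [hbM' e he, ← mul_add]
    refine mul_le_mul_of_nonneg_left ?_ (hc e (hME he)).le
    have e1 := hf (before pos E e) M
    have e2 := hmax (before pos E e ∪ M) (union_subset (before_subset _ _ _) hME)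
    have e3 := sum_union_inter (s₁ := before pos E e) (s₂ := M) (f := c)
    have e4 := congrArg (μ * ·) e3
    simp only [mul_add] at e4
    rw [← hsd, mul_sub]
    linarith
  have h2 : ∀ e ∈ E \ M, c e * (f E - f (before pos' E e)) ≤
      c e * (f E - f (before pos E e)) - c e * (μ * ∑ x ∈ M \ before pos E e, c x) := by
    intro e he
    rw [hbE e he, ← mul_sub]
    refine mul_le_mul_of_nonneg_left ?_ (hc e (mem_sdiff.1 he).1).le
    have e1 := hf (before pos E e) M
    have e2 := hmax (before pos E e ∩ M) (inter_subset_right.trans hME)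
    rw [← hsd', mul_sub]
    linarith
  have h3 : c b * (f E - f (before pos' E b)) <
      c b * (f E - f (before pos E b)) - c b * (μ * ∑ x ∈ M \ before pos E b, c x) := by
    rw [hbE b (mem_sdiff.2 ⟨hb, hbM⟩), ← mul_sub]
    refine mul_lt_mul_of_pos_left ?_ (hc b hb)
    have e1 := hf (before pos E b) M
    have e2 := hmin (before pos E b ∩ M) ⟨inter_subset_right, fun h => hab <| by
      have := (mem_inter.1 (h ha)).1
      exact (mem_filter.1 this).2⟩
    rw [← hsd', mul_sub]
    linarith
  have hpair : ∑ e ∈ M, c e * (μ * ∑ x ∈ before pos E e \ M, c x) =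
      ∑ e ∈ E \ M, c e * (μ * ∑ x ∈ M \ before pos E e, c x) := by
    have a1 : ∀ e ∈ M, c e * (μ * ∑ x ∈ before pos E e \ M, c x) =
        ∑ x ∈ E \ M, if pos x < pos e then c e * (μ * c x) else 0 := by
      intro e _
      rw [← sum_filter, mul_sum, mul_sum]
      refine sum_congr ?_ fun _ _ => rfl
      ext x; simp [before]; tauto
    have a2 : ∀ e ∈ E \ M, c e * (μ * ∑ x ∈ M \ before pos E e, c x) =
        ∑ x ∈ M, if pos e < pos x then c x * (μ * c e) else 0 := by
      intro e he
      rw [← sum_filter, mul_sum, mul_sum]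
      refine sum_congr ?_ fun _ _ => by ring
      ext x
      simp only [before, mem_sdiff, mem_filter, not_and]
      refine and_congr_right fun hx => ?_
      have hne : pos x ≠ pos e := fun h => (mem_sdiff.1 he).2
        (hinj (hME hx) (mem_sdiff.1 he).1 h ▸ hx)
      have := hME hx
      constructor
      · intro h; have := h this; omega
      · intro h _; omega
    rw [sum_congr rfl a1, sum_congr rfl a2, sum_comm]
  have hle := hopt pos' hinj'
  have hlt : orderCost f c E pos' < orderCost f c E pos := by
    unfold orderCost
    rw [hsplit, hsplit fun e => c e * (f E - f (before pos E e))]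
    have s1 := sum_le_sum h1
    have s2 := sum_lt_sum h2 ⟨b, mem_sdiff.2 ⟨hb, hbM⟩, h3⟩
    rw [sum_add_distrib] at s1
    rw [sum_sub_distrib] at s2
    linarith
  linarith

/-- The keys `κ` are the densities of the blocks of a Sidney decomposition of `E`: the measure
`κ c` dominates the reward and agrees with it on the sets of jobs of large key. -/
structure IsKey (f : Finset ℕ → ℝ) (c : ℕ → ℝ) (E : Finset ℕ) (κ : ℕ → ℝ) : Prop where
  le : ∀ A ⊆ E, f A ≤ ∑ x ∈ A, c x * κ x
  eq_ge : ∀ μ, f (E.filter fun x => μ ≤ κ x) = ∑ x ∈ E with μ ≤ κ x, c x * κ x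
  eq_gt : ∀ μ, f (E.filter fun x => μ < κ x) = ∑ x ∈ E with μ < κ x, c x * κ x

theorem IsKey.congr {f : Finset ℕ → ℝ} {c : ℕ → ℝ} {E : Finset ℕ} {κ κ' : ℕ → ℝ}
    (h : IsKey f c E κ) (hκ : ∀ x ∈ E, κ x = κ' x) : IsKey f c E κ' := by
  have e1 : ∀ A ⊆ E, ∑ x ∈ A, c x * κ x = ∑ x ∈ A, c x * κ' x := fun A hA =>
    sum_congr rfl fun x hx => by rw [hκ x (hA hx)]
  have e2 : ∀ μ, (E.filter fun x => μ ≤ κ' x) = E.filter fun x => μ ≤ κ x := fun μ =>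
    filter_congr fun x hx => by rw [hκ x hx]
  have e3 : ∀ μ, (E.filter fun x => μ < κ' x) = E.filter fun x => μ < κ x := fun μ =>
    filter_congr fun x hx => by rw [hκ x hx]
  refine ⟨fun A hA => by rw [← e1 A hA]; exact h.le A hA, fun μ => ?_, fun μ => ?_⟩
  · rw [e2, ← e1 _ (filter_subset _ _)]; exact h.eq_ge μ
  · rw [e3, ← e1 _ (filter_subset _ _)]; exact h.eq_gt μ

theorem IsKey.eq_sum {f : Finset ℕ → ℝ} {c : ℕ → ℝ} {E : Finset ℕ} {κ : ℕ → ℝ}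
    (h : IsKey f c E κ) : f E = ∑ x ∈ E, c x * κ x := by
  rcases E.eq_empty_or_nonempty with rfl | hE
  · simpa using h.eq_ge 0
  obtain ⟨m, _, hm⟩ := exists_min_image E κ hE
  have := h.eq_ge (κ m)
  rwa [filter_true_of_mem hm] at this

/-- The reward is additive across `L` and `R`. -/
def Separates (f : Finset ℕ → ℝ) (L R : Finset ℕ) : Prop :=
  ∀ A ⊆ L, ∀ B ⊆ R, f (A ∪ B) = f A + f B

theorem IsKey.union {f : Finset ℕ → ℝ} {c : ℕ → ℝ} {L R : Finset ℕ} {κ : ℕ → ℝ}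
    (hLR : Disjoint L R) (hs : Separates f L R) (hL : IsKey f c L κ) (hR : IsKey f c R κ) :
    IsKey f c (L ∪ R) κ := by
  refine ⟨fun A hA => ?_, fun μ => ?_, fun μ => ?_⟩
  · have hd : Disjoint (A ∩ L) (A ∩ R) := hLR.mono inter_subset_right inter_subset_right
    have hu : A = A ∩ L ∪ A ∩ R := by rw [← inter_union_distrib_left, inter_eq_left.2 hA]
    rw [hu, hs _ inter_subset_right _ inter_subset_right, sum_union hd]
    exact add_le_add (hL.le _ inter_subset_right) (hR.le _ inter_subset_right)
  · rw [filter_union, hs _ (filter_subset _ _) _ (filter_subset _ _), hL.eq_ge, hR.eq_ge,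
      sum_union (hLR.mono (filter_subset _ _) (filter_subset _ _))]
  · rw [filter_union, hs _ (filter_subset _ _) _ (filter_subset _ _), hL.eq_gt, hR.eq_gt,
      sum_union (hLR.mono (filter_subset _ _) (filter_subset _ _))]

/-- The waiting costs that `L` and `R` cause each other when they are interleaved by `pos`. -/
noncomputable def crossCost (f : Finset ℕ → ℝ) (c : ℕ → ℝ) (L R : Finset ℕ) (pos : ℕ → ℕ) : ℝ :=
  ∑ e ∈ L, c e * (f R - f (before pos R e)) + ∑ e ∈ R, c e * (f L - f (before pos L e))

/-- Whichever of two jobs comes later, its share `κ c` of the reward waits for the length of the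
other one. Since `κ c` dominates the reward, the true cross cost can only be larger. -/
theorem sum_min_le_crossCost {f : Finset ℕ → ℝ} {c : ℕ → ℝ} {L R : Finset ℕ} {κ : ℕ → ℝ}
    {pos : ℕ → ℕ} (hLR : Disjoint L R) (hcL : ∀ e ∈ L, 0 < c e) (hcR : ∀ e ∈ R, 0 < c e)
    (hL : IsKey f c L κ) (hR : IsKey f c R κ) (hpos : Set.InjOn pos (L ∪ R : Finset ℕ)) :
    ∑ i ∈ L, ∑ j ∈ R, c i * c j * min (κ i) (κ j) ≤ crossCost f c L R pos := by
  have key : ∀ {P : Finset ℕ}, IsKey f c P κ → ∀ e,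
      ∑ x ∈ P, (if pos x < pos e then 0 else c x * κ x) ≤ f P - f (before pos P e) := by
    intro P hP e
    have h1 := hP.le _ (before_subset pos P e)
    have h2 := sum_filter_add_sum_filter_not P (fun x => pos x < pos e) fun x => c x * κ x
    rw [hP.eq_sum]
    have h3 : ∑ x ∈ P, (if pos x < pos e then 0 else c x * κ x) =
        ∑ x ∈ P with ¬ pos x < pos e, c x * κ x := by
      rw [sum_filter]; exact sum_congr rfl fun x _ => by split_ifs <;> simp_all
    unfold before at h1 ⊢
    linarith
  have h1 : ∑ e ∈ L, c e * ∑ x ∈ R, (if pos x < pos e then 0 else c x * κ x) ≤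
      ∑ e ∈ L, c e * (f R - f (before pos R e)) :=
    sum_le_sum fun e he => mul_le_mul_of_nonneg_left (key hR e) (hcL e he).le
  have h2 : ∑ e ∈ R, c e * ∑ x ∈ L, (if pos x < pos e then 0 else c x * κ x) ≤
      ∑ e ∈ R, c e * (f L - f (before pos L e)) :=
    sum_le_sum fun e he => mul_le_mul_of_nonneg_left (key hL e) (hcR e he).le
  refine le_trans ?_ (add_le_add h1 h2)
  simp only [mul_sum]
  rw [sum_comm (s := R) (t := L), ← sum_add_distrib]
  refine sum_le_sum fun i hi => ?_
  rw [← sum_add_distrib]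
  refine sum_le_sum fun j hj => ?_
  have hcc : 0 < c i * c j := mul_pos (hcL i hi) (hcR j hj)
  have hne : pos i ≠ pos j := fun h => disjoint_left.1 hLR hi
    (hpos (by simp [hi]) (by simp [hj]) h ▸ hj)
  rcases lt_or_gt_of_ne hne with h | h
  · rw [if_neg h.not_gt, if_pos h]
    nlinarith [min_le_right (κ i) (κ j)]
  · rw [if_pos h, if_neg h.not_gt]
    nlinarith [min_le_left (κ i) (κ j)]

/-- The orders that respect the keys attain the bound, because their initial segments are sets on
which the reward agrees with `κ c`. -/
theorem crossCost_eq_sum_min {f : Finset ℕ → ℝ} {c : ℕ → ℝ} {L R : Finset ℕ} {κ : ℕ → ℝ}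
    {pos : ℕ → ℕ} (hL : IsKey f c L κ) (hR : IsKey f c R κ)
    (h₁ : ∀ i ∈ L, ∀ j ∈ R, pos i < pos j ↔ κ j ≤ κ i)
    (h₂ : ∀ i ∈ L, ∀ j ∈ R, pos j < pos i ↔ κ i < κ j) :
    crossCost f c L R pos = ∑ i ∈ L, ∑ j ∈ R, c i * c j * min (κ i) (κ j) := by
  have k1 : ∀ e ∈ L, f R - f (before pos R e) =
      ∑ x ∈ R, (if κ e < κ x then 0 else c x * κ x) := by
    intro e he
    have e1 : before pos R e = R.filter fun x => κ e < κ x := filter_congr fun x hx => h₂ e he x hx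
    rw [e1, hR.eq_gt, hR.eq_sum, ← sum_filter_add_sum_filter_not R (fun x => κ e < κ x),
      add_sub_cancel_left, sum_filter]
    exact sum_congr rfl fun x _ => by split_ifs <;> simp_all
  have k2 : ∀ e ∈ R, f L - f (before pos L e) =
      ∑ x ∈ L, (if κ e ≤ κ x then 0 else c x * κ x) := by
    intro e he
    have e1 : before pos L e = L.filter fun x => κ e ≤ κ x := filter_congr fun x hx => h₁ x hx e he
    rw [e1, hL.eq_ge, hL.eq_sum, ← sum_filter_add_sum_filter_not L (fun x => κ e ≤ κ x),
      add_sub_cancel_left, sum_filter]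
    exact sum_congr rfl fun x _ => by split_ifs <;> simp_all
  unfold crossCost
  have k1' := sum_congr rfl fun e he => congrArg (c e * ·) (k1 e he)
  have k2' := sum_congr rfl fun e he => congrArg (c e * ·) (k2 e he)
  rw [k1', k2']
  simp only [mul_sum]
  rw [sum_comm (s := R) (t := L), ← sum_add_distrib]
  refine sum_congr rfl fun i hi => ?_
  rw [← sum_add_distrib]
  refine sum_congr rfl fun j hj => ?_
  rcases lt_or_ge (κ i) (κ j) with h | h
  · rw [if_pos h, if_neg h.not_ge, min_eq_left h.le]; ring
  · rw [if_neg h.not_gt, if_pos h, min_eq_right h]; ring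

/-- The cost of an order that ends with `k`: the two sides wait for themselves and for each other,
and the reward that needs `k` waits for all jobs. -/
theorem orderCost_insert_last {f : Finset ℕ → ℝ} {c : ℕ → ℝ} {L R : Finset ℕ} {k : ℕ}
    {pos : ℕ → ℕ} (hLR : Disjoint L R) (hk : k ∉ L ∪ R) (hs : Separates f L R)
    (hlast : ∀ x ∈ L ∪ R, pos x < pos k) :
    orderCost f c (insert k (L ∪ R)) pos = orderCost f c L pos + orderCost f c R pos +
      crossCost f c L R pos +
      (∑ x ∈ insert k (L ∪ R), c x) * (f (insert k (L ∪ R)) - f L - f R) := by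
  have hb : ∀ e ∈ L ∪ R, before pos (insert k (L ∪ R)) e = before pos L e ∪ before pos R e := by
    intro e he
    unfold before
    rw [← filter_union, filter_insert, if_neg (hlast e he).not_gt]
  have hbk : before pos (insert k (L ∪ R)) k = L ∪ R := by
    unfold before
    rw [filter_insert, if_neg (lt_irrefl _)]
    exact filter_true_of_mem hlast
  unfold orderCost crossCost
  set E := insert k (L ∪ R) with hE
  have hfb : ∀ e ∈ L ∪ R, f (before pos E e) = f (before pos L e) + f (before pos R e) := by
    intro e he
    rw [hb e he]
    exact hs _ (before_subset _ _ _) _ (before_subset _ _ _)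
  have hsum : ∀ g : ℕ → ℝ, ∑ e ∈ E, g e = g k + (∑ e ∈ L, g e + ∑ e ∈ R, g e) := fun g => by
    rw [hE, sum_insert hk, sum_union hLR]
  rw [hsum, hbk, hsum c, hs L subset_rfl R subset_rfl, add_mul, add_mul, sum_mul, sum_mul]
  have aL : ∑ e ∈ L, c e * (f E - f (before pos E e)) = ∑ e ∈ L, (c e * (f L - f (before pos L e)) +
      c e * (f R - f (before pos R e)) + c e * (f E - f L - f R)) :=
    sum_congr rfl fun e he => by rw [hfb e (mem_union_left _ he)]; ring
  have aR : ∑ e ∈ R, c e * (f E - f (before pos E e)) = ∑ e ∈ R, (c e * (f R - f (before pos R e)) +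
      c e * (f L - f (before pos L e)) + c e * (f E - f L - f R)) :=
    sum_congr rfl fun e he => by rw [hfb e (mem_union_right _ he)]; ring
  rw [aL, aR]
  simp only [sum_add_distrib]
  ring

/-- The order `pos` merges the orders `posL` of `L` and `posR` of `R` by decreasing keys, with
preference for `L` at equal keys, and then appends `k`. -/
structure IsJoin (κ : ℕ → ℝ) (L R : Finset ℕ) (k : ℕ) (posL posR pos : ℕ → ℕ) : Prop where
  left : ∀ x ∈ L, ∀ y ∈ L, pos x < pos y ↔ posL x < posL y
  right : ∀ x ∈ R, ∀ y ∈ R, pos x < pos y ↔ posR x < posR y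
  left_lt_right : ∀ i ∈ L, ∀ j ∈ R, pos i < pos j ↔ κ j ≤ κ i
  right_lt_left : ∀ i ∈ L, ∀ j ∈ R, pos j < pos i ↔ κ i < κ j
  last : ∀ x ∈ L ∪ R, pos x < pos k

/-- Joining optimal orders of `L` and `R` gives an optimal order among those that end with `k`. -/
theorem IsJoin.orderCost_le {f : Finset ℕ → ℝ} {c : ℕ → ℝ} {L R : Finset ℕ} {k : ℕ} {κ : ℕ → ℝ}
    {posL posR pos pos' : ℕ → ℕ} (hj : IsJoin κ L R k posL posR pos)
    (hLR : Disjoint L R) (hk : k ∉ L ∪ R) (hs : Separates f L R)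
    (hc : ∀ e ∈ insert k (L ∪ R), 0 < c e) (hL : IsKey f c L κ) (hR : IsKey f c R κ)
    (oL : IsOptimalOrder f c L posL) (oR : IsOptimalOrder f c R posR)
    (hinj : Set.InjOn pos' (insert k (L ∪ R) : Finset ℕ)) (hlast : ∀ x ∈ L ∪ R, pos' x < pos' k) :
    orderCost f c (insert k (L ∪ R)) pos ≤ orderCost f c (insert k (L ∪ R)) pos' := by
  rw [orderCost_insert_last hLR hk hs hj.last, orderCost_insert_last hLR hk hs hlast,
    crossCost_eq_sum_min hL hR hj.left_lt_right hj.right_lt_left, orderCost_congr hj.left,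
    orderCost_congr hj.right]
  have i1 : Set.InjOn pos' (L ∪ R : Finset ℕ) := hinj.mono (by intro x hx; simp_all)
  have h1 := oL.2 pos' (i1.mono (by intro x hx; simp_all))
  have h2 := oR.2 pos' (i1.mono (by intro x hx; simp_all))
  have h3 := sum_min_le_crossCost hLR (fun e he => hc e (by simp [he]))
    (fun e he => hc e (by simp [he])) hL hR i1
  linarith

/-- The keys of an optimal order that ends with `k`. With `μ` the density of the last segment of
the concave envelope of the curve that plots reward against time, the smaller keys are raised to
`μ`, and `k` gets the key `μ`. Optimality enters through the exchange argument: a minimal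
maximizer of `f - ν c` either avoids `k` or is everything. -/
theorem IsKey.insert_last {f : Finset ℕ → ℝ} {c : ℕ → ℝ} {D : Finset ℕ} {k : ℕ} {κ : ℕ → ℝ}
    {pos : ℕ → ℕ} {μ : ℝ} (hf : Supermodular f) (hf0 : f ∅ = 0) (hk : k ∉ D)
    (hc : ∀ e ∈ insert k D, 0 < c e) (hD : IsKey f c D κ)
    (hopt : IsOptimalOrder f c (insert k D) pos) (hlast : ∀ x ∈ D, pos x < pos k)
    (hμ₁ : μ * (∑ x ∈ insert k D, c x - ∑ x ∈ D with μ < κ x, c x) ≤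
      f (insert k D) - f (D.filter fun x => μ < κ x))
    (hμ₂ : ∃ A ⊆ D, μ * (∑ x ∈ insert k D, c x - ∑ x ∈ A, c x) = f (insert k D) - f A) :
    IsKey f c (insert k D) fun x => if x = k then μ else max (κ x) μ := by
  set E := insert k D with hE
  set κ' : ℕ → ℝ := fun x => if x = k then μ else max (κ x) μ with hκ'
  have hDE : D ⊆ E := subset_insert _ _
  have hne : ∀ x ∈ D, x ≠ k := fun x hx h => hk (h ▸ hx)
  have hκD : ∀ x ∈ D, κ' x = max (κ x) μ := fun x hx => by simp [hκ', hne x hx]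
  have hκk : κ' k = μ := by simp [hκ']
  have hμκ : ∀ x, μ ≤ κ' x := fun x => by
    simp only [hκ']; split_ifs <;> simp
  have hle : ∀ A ⊆ D, f A ≤ ∑ x ∈ A, c x * κ' x := fun A hA =>
    (hD.le A hA).trans <| sum_le_sum fun x hx => by
      rw [hκD x (hA hx)]
      exact mul_le_mul_of_nonneg_left (le_max_left _ _) (hc x (hDE (hA hx))).le
  have htot : f E = ∑ x ∈ E, c x * κ' x := by
    apply le_antisymm
    · obtain ⟨A, hA, h⟩ := hμ₂
      have h1 := hle A hA
      have h2 := sum_sdiff (f := c) (hA.trans hDE)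
      have h3 := sum_sdiff (f := fun x => c x * κ' x) (hA.trans hDE)
      have h4 : μ * ∑ x ∈ E \ A, c x ≤ ∑ x ∈ E \ A, c x * κ' x := by
        rw [mul_sum]
        refine sum_le_sum fun x hx => ?_
        rw [mul_comm]
        exact mul_le_mul_of_nonneg_left (hμκ x) (hc x (mem_sdiff.1 hx).1).le
      have h5 : ∑ x ∈ E, c x - ∑ x ∈ A, c x = ∑ x ∈ E \ A, c x := by linarith
      rw [h5] at h
      linarith
    · set B := D.filter fun x => μ < κ x with hB
      have hBE : B ⊆ E := (filter_subset _ _).trans hDE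
      have h2 := sum_sdiff (f := c) hBE
      have h3 := sum_sdiff (f := fun x => c x * κ' x) hBE
      have h4 : ∑ x ∈ E \ B, c x * κ' x = μ * ∑ x ∈ E \ B, c x := by
        rw [mul_sum]
        refine sum_congr rfl fun x hx => ?_
        obtain ⟨hx1, hx2⟩ := mem_sdiff.1 hx
        rcases mem_insert.1 hx1 with rfl | hxD
        · rw [hκk, mul_comm]
        · have : κ x ≤ μ := by
            by_contra h
            exact hx2 (mem_filter.2 ⟨hxD, not_le.1 h⟩)
          rw [hκD x hxD, max_eq_right this, mul_comm]
      have h5 : ∑ x ∈ B, c x * κ' x = f B := by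
        rw [hD.eq_gt]
        refine sum_congr rfl fun x hx => ?_
        rw [hκD x (mem_filter.1 hx).1, max_eq_left (mem_filter.1 hx).2.le]
      have h6 : ∑ x ∈ E, c x - ∑ x ∈ B, c x = ∑ x ∈ E \ B, c x := by linarith
      rw [h6] at hμ₁
      linarith
  have eq_ge : ∀ ν, f (E.filter fun x => ν ≤ κ' x) = ∑ x ∈ E with ν ≤ κ' x, c x * κ' x := by
    intro ν
    rcases le_or_gt ν μ with h | h
    · rw [filter_true_of_mem fun x _ => h.trans (hμκ x)]; exact htot
    · have : (E.filter fun x => ν ≤ κ' x) = D.filter fun x => ν ≤ κ x := by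
        rw [hE, filter_insert, hκk, if_neg h.not_ge]
        refine filter_congr fun x hx => ?_
        rw [hκD x hx, le_max_iff, or_iff_left h.not_ge]
      rw [this, hD.eq_ge]
      refine sum_congr rfl fun x hx => ?_
      rw [hκD x (mem_filter.1 hx).1, max_eq_left (h.le.trans (mem_filter.1 hx).2)]
  have eq_gt : ∀ ν, f (E.filter fun x => ν < κ' x) = ∑ x ∈ E with ν < κ' x, c x * κ' x := by
    intro ν
    rcases lt_or_ge ν μ with h | h
    · rw [filter_true_of_mem fun x _ => h.trans_le (hμκ x)]; exact htot
    · have : (E.filter fun x => ν < κ' x) = D.filter fun x => ν < κ x := by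
        rw [hE, filter_insert, hκk, if_neg h.not_gt]
        refine filter_congr fun x hx => ?_
        rw [hκD x hx, lt_max_iff, or_iff_left h.not_gt]
      rw [this, hD.eq_gt]
      refine sum_congr rfl fun x hx => ?_
      rw [hκD x (mem_filter.1 hx).1, max_eq_left (h.trans (mem_filter.1 hx).2.le)]
  -- the sets of jobs of large key maximize `f - ν c`
  have hmaxP : ∀ ν, ∀ A ⊆ E, f A - ν * ∑ x ∈ A, c x ≤
      f (E.filter fun x => ν < κ' x) - ν * ∑ x ∈ E with ν < κ' x, c x := by
    intro ν
    set g : Finset ℕ → ℝ := fun A => f A - ν * ∑ x ∈ A, c x with hg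
    obtain ⟨M₀, hM₀, hM₀max⟩ := exists_max_image E.powerset g ⟨∅, by simp⟩
    obtain ⟨M, hM, hMmin⟩ := exists_min_image (E.powerset.filter fun A => g M₀ ≤ g A) card
      ⟨M₀, by simp [mem_powerset.1 hM₀]⟩
    obtain ⟨hME, hMge⟩ := mem_filter.1 hM
    rw [mem_powerset] at hME
    have hmax : ∀ A ⊆ E, g A ≤ g M := fun A hA => (hM₀max A (mem_powerset.2 hA)).trans hMge
    have hmin : ∀ A ⊂ M, g A < g M := by
      intro A hA
      by_contra h
      have := hMmin A (mem_filter.2 ⟨mem_powerset.2 (hA.1.trans hME), hMge.trans (not_lt.1 h)⟩)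
      exact absurd (card_lt_card hA) this.not_gt
    have hMle : f M ≤ ∑ x ∈ M, c x * κ' x := by
      by_cases hkM : k ∈ M
      · have : M = E := by
          refine hME.antisymm fun x hx => ?_
          by_contra hxM
          have h1 := hopt.pos_lt_pos hf hc hME hmax hmin hkM hx hxM
          rcases mem_insert.1 hx with rfl | hxD
          · exact hxM hkM
          · exact absurd h1 (hlast x hxD).not_gt
        rw [this]; exact htot.le
      · refine hle M fun x hx => ?_
        rcases mem_insert.1 (hME hx) with rfl | hxD
        · exact absurd hx hkM
        · exact hxD
    have h1 : g M ≤ ∑ x ∈ M, c x * (κ' x - ν) := by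
      simp only [hg, mul_sub, sum_sub_distrib, mul_sum] at hMle ⊢
      simp only [mul_comm ν]
      linarith
    have h2 : ∑ x ∈ M, c x * (κ' x - ν) ≤ ∑ x ∈ E with ν < κ' x, c x * (κ' x - ν) := by
      rw [← sum_filter_add_sum_filter_not M (fun x => ν < κ' x)]
      have a1 : ∑ x ∈ M with ¬ ν < κ' x, c x * (κ' x - ν) ≤ 0 := sum_nonpos fun x hx => by
        have := hc x (hME (mem_filter.1 hx).1)
        have := (mem_filter.1 hx).2
        nlinarith
      have a2 : ∑ x ∈ M with ν < κ' x, c x * (κ' x - ν) ≤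
          ∑ x ∈ E with ν < κ' x, c x * (κ' x - ν) :=
        sum_le_sum_of_subset_of_nonneg (filter_subset_filter _ hME) fun x hx _ => by
          have := hc x (mem_filter.1 hx).1
          have := (mem_filter.1 hx).2
          nlinarith
      linarith
    intro A hA
    refine (hmax A hA).trans (h1.trans (h2.trans (le_of_eq ?_)))
    rw [eq_gt]
    simp only [mul_sub, sum_sub_distrib, ← sum_mul, mul_comm ν]
  refine ⟨?_, eq_ge, eq_gt⟩
  intro A
  induction A using Finset.strongInduction with
  | H A ih =>
    intro hA
    rcases A.eq_empty_or_nonempty with rfl | hne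
    · simp [hf0]
    -- peel off the jobs of least key
    obtain ⟨m, hm, hmin⟩ := exists_min_image A κ' hne
    set P := E.filter fun x => κ' m < κ' x with hP
    have h1 := hf A P
    have h2 := hmaxP (κ' m) (A ∪ P) (union_subset hA (filter_subset _ _))
    have h3 := ih (A ∩ P) ⟨inter_subset_left, fun h => by
      have := (mem_filter.1 (mem_inter.1 (h hm)).2).2
      exact lt_irrefl _ this⟩ (inter_subset_left.trans hA)
    have h4 := sum_union_inter (s₁ := A) (s₂ := P) (f := c)
    have h5 := sum_inter_add_sum_sdiff A P c
    have h6 := sum_inter_add_sum_sdiff A P fun x => c x * κ' x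
    have h7 : ∑ x ∈ A \ P, c x * κ' x = κ' m * ∑ x ∈ A \ P, c x := by
      rw [mul_sum]
      refine sum_congr rfl fun x hx => ?_
      obtain ⟨hxA, hxP⟩ := mem_sdiff.1 hx
      have : κ' x = κ' m := le_antisymm
        (by by_contra h; exact hxP (mem_filter.2 ⟨hA hxA, not_le.1 h⟩)) (hmin x hxA)
      rw [this, mul_comm]
    rw [← h6, h7]
    have h8 : ∑ x ∈ A \ P, c x = ∑ x ∈ A ∪ P, c x - ∑ x ∈ P, c x := by linarith
    rw [h8]
    linarith

end SupermodularScheduling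

/-! ### Verifying programs of the random access machine -/

namespace RealRAM

/-- `c` halts from `s` after at most `T` steps, in a state that satisfies `Q`. -/
def Runs (c : Cmd) (s : State) (T : ℕ) (Q : State → Prop) : Prop :=
  ∃ t s', Exec c s t s' ∧ t ≤ T ∧ Q s'

/-- The pieces of storage: scalar variables and whole arrays. -/
inductive Loc : Type
  | ivar (x : ℕ)
  | iarr (a : ℕ)
  | rvar (x : ℕ)
  | rarr (a : ℕ)

/-- Whether a program contains an assignment to a piece of storage. -/
def Cmd.writes : Cmd → Loc → Bool
  | .iset x _, .ivar y => x == y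
  | .rset x _, .rvar y => x == y
  | .iput a _ _, .iarr b => a == b
  | .rput a _ _, .rarr b => a == b
  | .seq c d, l => c.writes l || d.writes l
  | .ite _ c d, l => c.writes l || d.writes l
  | .loop _ c, l => c.writes l
  | _, _ => false

/-- The states agree outside the storage that `c` assigns to. -/
structure Frame (c : Cmd) (s s' : State) : Prop where
  ivar : ∀ x, c.writes (.ivar x) = false → s'.ivar x = s.ivar x
  iarr : ∀ a, c.writes (.iarr a) = false → s'.iarr a = s.iarr a
  rvar : ∀ x, c.writes (.rvar x) = false → s'.rvar x = s.rvar x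
  rarr : ∀ a, c.writes (.rarr a) = false → s'.rarr a = s.rarr a

section Updates

variable (s : State) (x y a b i j v : ℕ) (r : ℝ)

@[simp] theorem setIvar_ivar : (s.setIvar x v).ivar y = if y = x then v else s.ivar y := by
  simp [State.setIvar, Function.update_apply]
@[simp] theorem setIvar_iarr : (s.setIvar x v).iarr = s.iarr := rfl
@[simp] theorem setIvar_rvar : (s.setIvar x v).rvar = s.rvar := rfl
@[simp] theorem setIvar_rarr : (s.setIvar x v).rarr = s.rarr := rfl
@[simp] theorem setRvar_rvar : (s.setRvar x r).rvar y = if y = x then r else s.rvar y := by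
  simp [State.setRvar, Function.update_apply]
@[simp] theorem setRvar_ivar : (s.setRvar x r).ivar = s.ivar := rfl
@[simp] theorem setRvar_iarr : (s.setRvar x r).iarr = s.iarr := rfl
@[simp] theorem setRvar_rarr : (s.setRvar x r).rarr = s.rarr := rfl
@[simp] theorem setIarr_iarr :
    (s.setIarr a i v).iarr b j = if b = a ∧ j = i then v else s.iarr b j := by
  by_cases h : b = a <;> simp [State.setIarr, Function.update_apply, h]
@[simp] theorem setIarr_ivar : (s.setIarr a i v).ivar = s.ivar := rfl
@[simp] theorem setIarr_rvar : (s.setIarr a i v).rvar = s.rvar := rfl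
@[simp] theorem setIarr_rarr : (s.setIarr a i v).rarr = s.rarr := rfl
@[simp] theorem setRarr_rarr :
    (s.setRarr a i r).rarr b j = if b = a ∧ j = i then r else s.rarr b j := by
  by_cases h : b = a <;> simp [State.setRarr, Function.update_apply, h]
@[simp] theorem setRarr_ivar : (s.setRarr a i r).ivar = s.ivar := rfl
@[simp] theorem setRarr_iarr : (s.setRarr a i r).iarr = s.iarr := rfl
@[simp] theorem setRarr_rvar : (s.setRarr a i r).rvar = s.rvar := rfl

end Updates

theorem Frame.refl (c : Cmd) (s : State) : Frame c s s :=
  ⟨fun _ _ => rfl, fun _ _ => rfl, fun _ _ => rfl, fun _ _ => rfl⟩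

theorem Frame.trans {c : Cmd} {s₁ s₂ s₃ : State} (h : Frame c s₁ s₂) (h' : Frame c s₂ s₃) :
    Frame c s₁ s₃ :=
  ⟨fun x hx => (h'.ivar x hx).trans (h.ivar x hx), fun x hx => (h'.iarr x hx).trans (h.iarr x hx),
    fun x hx => (h'.rvar x hx).trans (h.rvar x hx), fun x hx => (h'.rarr x hx).trans (h.rarr x hx)⟩

theorem Frame.mono {c d : Cmd} {s s' : State} (h : Frame c s s')
    (hcd : ∀ l, d.writes l = false → c.writes l = false) : Frame d s s' :=
  ⟨fun x hx => h.ivar x (hcd _ hx), fun x hx => h.iarr x (hcd _ hx),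
    fun x hx => h.rvar x (hcd _ hx), fun x hx => h.rarr x (hcd _ hx)⟩

theorem Exec.frame {c : Cmd} {s s' : State} {t : ℕ} (h : Exec c s t s') : Frame c s s' := by
  induction h with
  | skip s => exact Frame.refl _ _
  | iset s x e =>
    refine ⟨fun y hy => ?_, fun _ _ => rfl, fun _ _ => rfl, fun _ _ => rfl⟩
    have : y ≠ x := fun h => by simp [Cmd.writes, h] at hy
    simp [this]
  | rset s x e =>
    refine ⟨fun _ _ => rfl, fun _ _ => rfl, fun y hy => ?_, fun _ _ => rfl⟩
    have : y ≠ x := fun h => by simp [Cmd.writes, h] at hy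
    simp [this]
  | iput s a i e =>
    refine ⟨fun _ _ => rfl, fun y hy => ?_, fun _ _ => rfl, fun _ _ => rfl⟩
    have : y ≠ a := fun h => by simp [Cmd.writes, h] at hy
    funext j
    simp [this]
  | rput s a i e =>
    refine ⟨fun _ _ => rfl, fun _ _ => rfl, fun _ _ => rfl, fun y hy => ?_⟩
    have : y ≠ a := fun h => by simp [Cmd.writes, h] at hy
    funext j
    simp [this]
  | seq _ _ h₁ h₂ =>
    exact (h₁.mono fun l hl => by simp_all [Cmd.writes]).trans
      (h₂.mono fun l hl => by simp_all [Cmd.writes])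
  | ite_true _ _ h => exact h.mono fun l hl => by simp_all [Cmd.writes]
  | ite_false _ _ h => exact h.mono fun l hl => by simp_all [Cmd.writes]
  | loop_true _ _ _ h₁ h₂ =>
    exact (h₁.mono fun l hl => by simp_all [Cmd.writes]).trans h₂
  | loop_false _ => exact Frame.refl _ _

theorem Runs.mono {c : Cmd} {s : State} {T T' : ℕ} {Q Q' : State → Prop} (h : Runs c s T Q)
    (hT : T ≤ T') (hQ : ∀ s', Frame c s s' → Q s' → Q' s') : Runs c s T' Q' := by
  obtain ⟨t, s', he, ht, hq⟩ := h
  exact ⟨t, s', he, ht.trans hT, hQ s' he.frame hq⟩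

theorem Runs.seq {c d : Cmd} {s : State} {T T' : ℕ} {Q Q' : State → Prop} (h : Runs c s T Q)
    (h' : ∀ s', Frame c s s' → Q s' → Runs d s' T' Q') : Runs (.seq c d) s (T + T') Q' := by
  obtain ⟨t, s', he, ht, hq⟩ := h
  obtain ⟨t', s'', he', ht', hq'⟩ := h' s' he.frame hq
  exact ⟨_, s'', .seq he he', by omega, hq'⟩

/-- Weakest preconditions of programs without loops. The values that are assigned are
universally quantified, so that they are shared instead of being substituted. -/
def Cmd.wp : Cmd → (State → Prop) → State → Prop
  | .skip, Q, s => Q s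
  | .iset x e, Q, s => ∀ v, v = e.eval s → Q (s.setIvar x v)
  | .rset x e, Q, s => ∀ v, v = e.eval s → Q (s.setRvar x v)
  | .iput a i e, Q, s => ∀ j v, j = i.eval s → v = e.eval s → Q (s.setIarr a j v)
  | .rput a i e, Q, s => ∀ j v, j = i.eval s → v = e.eval s → Q (s.setRarr a j v)
  | .seq c d, Q, s => c.wp (d.wp Q) s
  | .ite b c d, Q, s => (b.holds s → c.wp Q s) ∧ (¬ b.holds s → d.wp Q s)
  | .loop _ _, _, _ => False

/-- An upper bound for the number of steps of a program without loops. -/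
def Cmd.maxSteps : Cmd → ℕ
  | .skip => 1
  | .iset _ e => e.steps + 1
  | .rset _ e => e.steps + 1
  | .iput _ i e => i.steps + e.steps + 1
  | .rput _ i e => i.steps + e.steps + 1
  | .seq c d => c.maxSteps + d.maxSteps
  | .ite b c d => b.steps + 1 + (c.maxSteps + d.maxSteps)
  | .loop _ _ => 0

theorem Cmd.wp.runs {c : Cmd} {Q : State → Prop} {s : State} {T : ℕ} (h : c.wp Q s)
    (hT : c.maxSteps ≤ T) : Runs c s T Q := by
  suffices Runs c s c.maxSteps Q from this.mono hT fun _ _ h => h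
  clear hT
  induction c generalizing Q s with
  | skip => exact ⟨_, _, .skip s, le_rfl, h⟩
  | iset x e => exact ⟨_, _, .iset s x e, le_rfl, h _ rfl⟩
  | rset x e => exact ⟨_, _, .rset s x e, le_rfl, h _ rfl⟩
  | iput a i e => exact ⟨_, _, .iput s a i e, le_rfl, h _ _ rfl rfl⟩
  | rput a i e => exact ⟨_, _, .rput s a i e, le_rfl, h _ _ rfl rfl⟩
  | seq c d hc hd => exact (hc h).seq fun s' _ h' => hd h'
  | ite b c d hc hd =>
    by_cases hb : b.holds s
    · obtain ⟨t, s', he, ht, hq⟩ := hc (h.1 hb)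
      exact ⟨_, s', .ite_true hb he, by simp only [Cmd.maxSteps]; omega, hq⟩
    · obtain ⟨t, s', he, ht, hq⟩ := hd (h.2 hb)
      exact ⟨_, s', .ite_false hb he, by simp only [Cmd.maxSteps]; omega, hq⟩
  | loop b c => exact h.elim

/-- `for x = 0, …, e - 1 do c`, where `c` must assign neither to `x` nor change the value
of `e`. -/
def Cmd.for (x : ℕ) (e : IExp) (c : Cmd) : Cmd :=
  .seq (.iset x (.const 0))
    (.loop (.not (.ile e (.var x))) (.seq c (.iset x (.add (.var x) (.const 1)))))

theorem Runs.for {x : ℕ} {e : IExp} {c : Cmd} {s : State} {N T : ℕ} (I : ℕ → State → Prop)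
    (hx : c.writes (.ivar x) = false)
    (he : ∀ s', Frame (.for x e c) s s' → e.eval s' = N)
    (h0 : I 0 (s.setIvar x 0))
    (hstep : ∀ i < N, ∀ s', Frame (.for x e c) s s' → s'.ivar x = i → I i s' →
      Runs c s' T fun s'' => I (i + 1) (s''.setIvar x (i + 1))) :
    Runs (.for x e c) s ((N + 1) * (T + e.steps + 10)) (I N) := by
  have hw : ∀ v s', Frame (.for x e c) s s' → Frame (.for x e c) s (s'.setIvar x v) := by
    intro v s' h
    refine h.trans ⟨fun y hy => ?_, fun _ _ => rfl, fun _ _ => rfl, fun _ _ => rfl⟩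
    have : y ≠ x := fun h => by simp [Cmd.for, Cmd.writes, h] at hy
    simp [this]
  have main : ∀ k i s', i + k = N → Frame (.for x e c) s s' → s'.ivar x = i → I i s' →
      Runs (.loop (.not (.ile e (.var x))) (.seq c (.iset x (.add (.var x) (.const 1))))) s'
        ((k + 1) * (T + e.steps + 9)) (I N) := by
    intro k
    induction k with
    | zero =>
      intro i s' hi hf hs hI
      refine ⟨_, s', .loop_false ?_, ?_, ?_⟩
      · simp [BExp.holds, IExp.eval, he s' hf, hs]; omega
      · simp [BExp.steps, IExp.steps]; omega
      · rwa [← (by omega : i = N)]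
    | succ k ih =>
      intro i s' hi hf hs hI
      obtain ⟨t, s'', hex, ht, hI'⟩ := hstep i (by omega) s' hf hs hI
      have hf' := hf.trans (hex.frame.mono (d := .for x e c)
        fun l hl => by simp_all [Cmd.for, Cmd.writes])
      have hs' : s''.ivar x = i := (hex.frame.ivar x hx).trans hs
      obtain ⟨t', s₃, hex', ht', hI₃⟩ := ih (i + 1) (s''.setIvar x (i + 1)) (by omega)
        (hw _ _ hf') (by simp) hI'
      have hset : Exec (.iset x (.add (.var x) (.const 1))) s'' 4 (s''.setIvar x (i + 1)) := by
        have := Exec.iset s'' x (.add (.var x) (.const 1))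
        simpa [IExp.eval, hs', IExp.steps] using this
      refine ⟨_, s₃, .loop_true ?_ (.seq hex hset) hex', ?_, hI₃⟩
      · simp [BExp.holds, IExp.eval, he s' hf, hs]; omega
      · simp only [BExp.steps, IExp.steps]
        have : (k + 1 + 1) * (T + e.steps + 9) =
          (k + 1) * (T + e.steps + 9) + (T + e.steps + 9) := by ring
        omega
  obtain ⟨t, s', hex, ht, hI⟩ := main N 0 (s.setIvar x 0) (by omega)
    (hw _ _ (Frame.refl _ _)) (by simp) h0
  have hset : Exec (.iset x (.const 0)) s 2 (s.setIvar x 0) := Exec.iset s x (.const 0)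
  refine ⟨_, s', .seq hset hex, ?_, hI⟩
  have : (N + 1) * (T + e.steps + 10) = (N + 1) * (T + e.steps + 9) + (N + 1) := by ring
  rcases Nat.eq_zero_or_pos N with h | h
  · subst h
    obtain hx' : t ≤ T + e.steps + 9 := by simpa using ht
    -- an empty loop takes only its initialization and one test
    cases hex with
    | loop_true hb => exact absurd hb (by
        simp [BExp.holds, IExp.eval, he _ (hw 0 _ (Frame.refl _ _))])
    | loop_false => simp only [BExp.steps, IExp.steps]; omega
  · omega

/-- The rule for counting loops. The invariant `I i` is stated for the states in which the counter
has just been set to `i`. -/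
theorem Runs.forVar {x y : ℕ} {c : Cmd} {s : State} {N T : ℕ} (I : ℕ → State → Prop)
    (hx : c.writes (.ivar x) = false) (hy : (Cmd.for x (.var y) c).writes (.ivar y) = false)
    (hN : s.ivar y = N) (h0 : I 0 (s.setIvar x 0))
    (hstep : ∀ i < N, ∀ s', Frame (.for x (.var y) c) s s' → s'.ivar x = i → I i s' →
      Runs c s' T fun s'' => I (i + 1) (s''.setIvar x (i + 1))) :
    Runs (.for x (.var y) c) s ((N + 1) * (T + 11)) (I N) :=
  Runs.for I hx (fun _ F => (F.ivar y hy).trans hN) h0 hstep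

end RealRAM

/-! ### Orders given by lists, and their merging -/

namespace SupermodularScheduling

open Finset

theorem before_idxOf {σ : List ℕ} (hσ : σ.Nodup) {t : ℕ} (ht : t < σ.length) :
    before (σ.idxOf ·) σ.toFinset σ[t] = (σ.take t).toFinset := by
  ext x
  simp only [before, mem_filter, List.mem_toFinset, hσ.idxOf_getElem t ht]
  exact ⟨fun h => (List.mem_take_iff_idxOf_lt h.1).2 h.2,
    fun h => ⟨List.mem_of_mem_take h, (List.mem_take_iff_idxOf_lt (List.mem_of_mem_take h)).1 h⟩⟩

theorem orderCost_idxOf {f : Finset ℕ → ℝ} {c : ℕ → ℝ} {E : Finset ℕ} {σ : List ℕ}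
    (hσ : σ.Nodup) (hE : σ.toFinset = E) :
    orderCost f c E (σ.idxOf ·) =
      ∑ t ∈ range σ.length, c (σ.getD t 0) * (f E - f (σ.take t).toFinset) := by
  subst hE
  unfold orderCost
  symm
  refine sum_bij (fun t _ => σ.getD t 0) ?_ ?_ ?_ ?_
  · intro t ht
    have ht := mem_range.1 ht
    rw [List.getD_eq_getElem _ _ ht]
    exact List.mem_toFinset.2 (List.getElem_mem ht)
  · intro t ht u hu h
    have ht := mem_range.1 ht
    have hu := mem_range.1 hu
    rw [List.getD_eq_getElem _ _ ht, List.getD_eq_getElem _ _ hu] at h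
    exact (hσ.getElem_inj_iff).1 h
  · intro e he
    have he := List.idxOf_lt_length_of_mem (List.mem_toFinset.1 he)
    exact ⟨σ.idxOf e, mem_range.2 he, by rw [List.getD_eq_getElem _ _ he, List.getElem_idxOf]⟩
  · intro t ht
    have ht := mem_range.1 ht
    rw [List.getD_eq_getElem _ _ ht, before_idxOf hσ ht]

/-- Merge two lists by decreasing keys; at equal keys the first list goes first. -/
noncomputable def mergeByKey (κ : ℕ → ℝ) (l₁ l₂ : List ℕ) : List ℕ :=
  List.merge l₁ l₂ fun x y => decide (κ y ≤ κ x)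

theorem pairwise_mergeByKey {κ : ℕ → ℝ} {r : ℕ → ℕ → Prop} {l₁ l₂ : List ℕ}
    (h₁ : l₁.Pairwise r) (h₂ : l₂.Pairwise r) (s₁ : l₁.Pairwise fun x y => κ y ≤ κ x)
    (s₂ : l₂.Pairwise fun x y => κ y ≤ κ x) (h₁₂ : ∀ x ∈ l₁, ∀ y ∈ l₂, κ y ≤ κ x → r x y)
    (h₂₁ : ∀ x ∈ l₁, ∀ y ∈ l₂, κ x < κ y → r y x) : (mergeByKey κ l₁ l₂).Pairwise r := by
  unfold mergeByKey
  induction l₁ generalizing l₂ with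
  | nil => simpa using h₂
  | cons x xs ih₁ =>
    induction l₂ with
    | nil => simpa using h₁
    | cons y ys ih₂ =>
      rw [List.pairwise_cons] at h₁ h₂ s₁ s₂
      rw [List.cons_merge_cons]
      split_ifs with h
      · rw [decide_eq_true_eq] at h
        refine List.pairwise_cons.2 ⟨fun z hz => ?_, ih₁ h₁.2 (List.pairwise_cons.2 h₂) s₁.2
          (List.pairwise_cons.2 s₂) (fun a ha => h₁₂ a (by simp [ha]))
          (fun a ha => h₂₁ a (by simp [ha]))⟩
        rcases List.mem_merge.1 hz with hz | hz
        · exact h₁.1 z hz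
        · refine h₁₂ x (by simp) z hz ?_
          rcases List.mem_cons.1 hz with rfl | hz
          · exact h
          · exact (s₂.1 z hz).trans h
      · rw [decide_eq_true_eq, not_le] at h
        refine List.pairwise_cons.2 ⟨fun z hz => ?_, ih₂ h₂.2 s₂.2
          (fun a ha b hb => h₁₂ a ha b (by simp [hb]))
          (fun a ha b hb => h₂₁ a ha b (by simp [hb]))⟩
        rcases List.mem_merge.1 hz with hz | hz
        · refine h₂₁ z hz y (by simp) ?_
          rcases List.mem_cons.1 hz with rfl | hz
          · exact h
          · exact (s₁.1 z hz).trans_lt h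
        · exact h₂.1 z hz

theorem mem_mergeByKey {κ : ℕ → ℝ} {l₁ l₂ : List ℕ} {x : ℕ} :
    x ∈ mergeByKey κ l₁ l₂ ↔ x ∈ l₁ ∨ x ∈ l₂ := List.mem_merge

theorem length_mergeByKey (κ : ℕ → ℝ) (l₁ l₂ : List ℕ) :
    (mergeByKey κ l₁ l₂).length = l₁.length + l₂.length := List.length_merge ..

theorem mergeByKey_perm (κ : ℕ → ℝ) (l₁ l₂ : List ℕ) :
    (mergeByKey κ l₁ l₂).Perm (l₁ ++ l₂) := List.merge_perm_append _

theorem exists_take_eq_filter {κ : ℕ → ℝ} {σ : List ℕ} (hσ : σ.Pairwise fun x y => κ y ≤ κ x)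
    (μ : ℝ) : ∃ t ≤ σ.length, (σ.take t).toFinset = σ.toFinset.filter fun x => μ < κ x := by
  induction σ with
  | nil => exact ⟨0, by simp⟩
  | cons x xs ih =>
    rw [List.pairwise_cons] at hσ
    by_cases h : μ < κ x
    · obtain ⟨t, ht, he⟩ := ih hσ.2
      refine ⟨t + 1, by simpa using ht, ?_⟩
      rw [List.take_succ_cons, List.toFinset_cons, List.toFinset_cons, he, filter_insert, if_pos h]
    · refine ⟨0, by simp, ?_⟩
      symm
      rw [List.take_zero, List.toFinset_nil, filter_eq_empty_iff]
      intro y hy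
      rw [List.mem_toFinset, List.mem_cons] at hy
      rcases hy with rfl | hy
      · exact h
      · exact fun h' => h (h'.trans_le (hσ.1 y hy))

/-- The list `σ` is a schedule of the jobs `E`, ordered by the decreasing keys `κ`. -/
structure IsSchedule (E : Finset ℕ) (σ : List ℕ) (κ : ℕ → ℝ) : Prop where
  nodup : σ.Nodup
  toFinset_eq : σ.toFinset = E
  sorted : σ.Pairwise fun x y => κ y ≤ κ x

/-- The list `σ` is an optimal schedule of the jobs `E`, and `κ` are its keys. -/
structure IsSolved (f : Finset ℕ → ℝ) (c : ℕ → ℝ) (E : Finset ℕ) (σ : List ℕ) (κ : ℕ → ℝ) : Prop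
    extends IsSchedule E σ κ where
  optimal : IsOptimalOrder f c E (σ.idxOf ·)
  isKey : IsKey f c E κ

theorem IsSolved.congr {f : Finset ℕ → ℝ} {c : ℕ → ℝ} {E : Finset ℕ} {σ : List ℕ} {κ κ' : ℕ → ℝ}
    (h : IsSolved f c E σ κ) (hκ : ∀ x ∈ E, κ x = κ' x) : IsSolved f c E σ κ' where
  nodup := h.nodup
  toFinset_eq := h.toFinset_eq
  sorted := h.sorted.imp_of_mem fun {x y} hx hy hxy => by
    have e := h.toFinset_eq
    rw [← hκ x (e ▸ List.mem_toFinset.2 hx), ← hκ y (e ▸ List.mem_toFinset.2 hy)]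
    exact hxy
  optimal := h.optimal
  isKey := h.isKey.congr hκ

theorem IsSchedule.length_eq {E : Finset ℕ} {σ : List ℕ} {κ : ℕ → ℝ}
    (h : IsSchedule E σ κ) : σ.length = E.card := by
  rw [← h.toFinset_eq, List.toFinset_card_of_nodup h.nodup]

theorem IsSchedule.injOn {E : Finset ℕ} {σ : List ℕ} {κ : ℕ → ℝ} (h : IsSchedule E σ κ) :
    Set.InjOn (σ.idxOf ·) E := by
  intro x hx y _ hxy
  rw [mem_coe, ← h.toFinset_eq, List.mem_toFinset] at hx
  exact (List.idxOf_inj hx).1 hxy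

section Join

variable {f : Finset ℕ → ℝ} {c : ℕ → ℝ} {L R : Finset ℕ} {k : ℕ} {κ : ℕ → ℝ} {σL σR : List ℕ}

theorem IsSolved.isSchedule_merge (hLR : Disjoint L R) (hL : IsSolved f c L σL κ)
    (hR : IsSolved f c R σR κ) : IsSchedule (L ∪ R) (mergeByKey κ σL σR) κ where
  nodup := by
    refine (mergeByKey_perm κ σL σR).nodup_iff.2 ?_
    refine List.nodup_append'.2 ⟨hL.nodup, hR.nodup, ?_⟩
    rw [← List.disjoint_toFinset_iff_disjoint, hL.toFinset_eq, hR.toFinset_eq]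
    exact hLR
  toFinset_eq := by
    ext x
    rw [List.mem_toFinset, mem_mergeByKey, mem_union, ← hL.toFinset_eq, ← hR.toFinset_eq,
      List.mem_toFinset, List.mem_toFinset]
  sorted := pairwise_mergeByKey hL.sorted hR.sorted hL.sorted hR.sorted
    (fun _ _ _ _ h => h) (fun _ _ _ _ h => h.le)

theorem IsSolved.isJoin_merge (hLR : Disjoint L R) (hk : k ∉ L ∪ R) (hL : IsSolved f c L σL κ)
    (hR : IsSolved f c R σR κ) :
    IsJoin κ L R k (σL.idxOf ·) (σR.idxOf ·) ((mergeByKey κ σL σR ++ [k]).idxOf ·) := by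
  set ρ := mergeByKey κ σL σR with hρ
  have hS := hL.isSchedule_merge hLR hR
  have mL : ∀ {x}, x ∈ σL ↔ x ∈ L := fun {x} => by rw [← hL.toFinset_eq, List.mem_toFinset]
  have mR : ∀ {x}, x ∈ σR ↔ x ∈ R := fun {x} => by rw [← hR.toFinset_eq, List.mem_toFinset]
  have mρ : ∀ {x}, x ∈ ρ ↔ x ∈ L ∨ x ∈ R := fun {x} => by
    rw [← List.mem_toFinset, hS.toFinset_eq, mem_union]
  have hi : ∀ x ∈ ρ, (ρ ++ [k]).idxOf x = ρ.idxOf x := fun x hx => List.idxOf_append_of_mem hx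
  set r : ℕ → ℕ → Prop := fun x y =>
    (x ∈ L → y ∈ L → σL.idxOf x < σL.idxOf y) ∧ (x ∈ R → y ∈ R → σR.idxOf x < σR.idxOf y) ∧
    (x ∈ L → y ∈ R → κ y ≤ κ x) ∧ (x ∈ R → y ∈ L → κ y < κ x) with hr
  have hdis : ∀ x ∈ L, x ∉ R := fun x hx => disjoint_left.1 hLR hx
  have hdis' : ∀ x ∈ R, x ∉ L := fun x hx => disjoint_right.1 hLR hx
  have pw : ∀ {σ : List ℕ}, σ.Nodup → σ.Pairwise fun x y => σ.idxOf x < σ.idxOf y := by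
    intro σ hσ
    rw [List.pairwise_iff_getElem]
    intro i j hi hj hij
    rwa [hσ.idxOf_getElem, hσ.idxOf_getElem]
  have hpw : ρ.Pairwise r := by
    refine pairwise_mergeByKey ?_ ?_ hL.sorted hR.sorted ?_ ?_
    · refine (pw hL.nodup).imp_of_mem fun {x y} hx hy h => ?_
      have := hdis x (mL.1 hx)
      have := hdis y (mL.1 hy)
      exact ⟨fun _ _ => h, fun h => by contradiction, fun _ h => by contradiction,
        fun h => by contradiction⟩
    · refine (pw hR.nodup).imp_of_mem fun {x y} hx hy h => ?_
      have := hdis' x (mR.1 hx)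
      have := hdis' y (mR.1 hy)
      exact ⟨fun h => by contradiction, fun _ _ => h, fun h => by contradiction,
        fun _ h => by contradiction⟩
    · intro x hx y hy h
      have := hdis x (mL.1 hx)
      have := hdis' y (mR.1 hy)
      exact ⟨fun _ h => by contradiction, fun h => by contradiction, fun _ _ => h,
        fun h => by contradiction⟩
    · intro x hx y hy h
      have := hdis x (mL.1 hx)
      have := hdis' y (mR.1 hy)
      exact ⟨fun h => by contradiction, fun _ h => by contradiction, fun h => by contradiction,
        fun _ _ => h⟩
  have main : ∀ x ∈ ρ, ∀ y ∈ ρ, ρ.idxOf x < ρ.idxOf y → r x y := by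
    intro x hx y hy h
    have := List.pairwise_iff_getElem.1 hpw _ _ (List.idxOf_lt_length_of_mem hx)
      (List.idxOf_lt_length_of_mem hy) h
    simpa using this
  have tri : ∀ x ∈ ρ, ∀ y ∈ ρ, ρ.idxOf x < ρ.idxOf y ∨ x = y ∨ ρ.idxOf y < ρ.idxOf x := by
    intro x hx y _
    rcases lt_trichotomy (ρ.idxOf x) (ρ.idxOf y) with h | h | h
    · exact Or.inl h
    · exact Or.inr (Or.inl ((List.idxOf_inj hx).1 h))
    · exact Or.inr (Or.inr h)
  refine ⟨fun x hx y hy => ?_, fun x hx y hy => ?_, fun x hx y hy => ?_, fun x hx y hy => ?_,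
    fun x hx => ?_⟩
  · have hx' := mρ.2 (Or.inl hx)
    have hy' := mρ.2 (Or.inl hy)
    simp only [hi x hx', hi y hy']
    refine ⟨fun h => (main x hx' y hy' h).1 hx hy, fun h => ?_⟩
    rcases tri x hx' y hy' with h' | rfl | h'
    · exact h'
    · exact absurd h (lt_irrefl _)
    · exact absurd ((main y hy' x hx' h').1 hy hx) h.not_gt
  · have hx' := mρ.2 (Or.inr hx)
    have hy' := mρ.2 (Or.inr hy)
    simp only [hi x hx', hi y hy']
    refine ⟨fun h => (main x hx' y hy' h).2.1 hx hy, fun h => ?_⟩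
    rcases tri x hx' y hy' with h' | rfl | h'
    · exact h'
    · exact absurd h (lt_irrefl _)
    · exact absurd ((main y hy' x hx' h').2.1 hy hx) h.not_gt
  · have hx' := mρ.2 (Or.inl hx)
    have hy' := mρ.2 (Or.inr hy)
    simp only [hi x hx', hi y hy']
    refine ⟨fun h => (main x hx' y hy' h).2.2.1 hx hy, fun h => ?_⟩
    rcases tri x hx' y hy' with h' | rfl | h'
    · exact h'
    · exact absurd hy (hdis _ hx)
    · exact absurd ((main y hy' x hx' h').2.2.2 hy hx) h.not_gt
  · have hx' := mρ.2 (Or.inl hx)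
    have hy' := mρ.2 (Or.inr hy)
    simp only [hi x hx', hi y hy']
    refine ⟨fun h => (main y hy' x hx' h).2.2.2 hy hx, fun h => ?_⟩
    rcases tri x hx' y hy' with h' | rfl | h'
    · exact absurd ((main x hx' y hy' h').2.2.1 hx hy) h.not_ge
    · exact absurd hy (hdis _ hx)
    · exact h'
  · have hx' := mρ.2 (mem_union.1 hx)
    have hk' : k ∉ ρ := fun h => hk (mem_union.2 (mρ.1 h))
    simp only [hi x hx']
    rw [List.idxOf_append_of_notMem hk']
    have := List.idxOf_lt_length_of_mem hx'
    omega

/-- The keys of the merged list followed by `k`, where `μ` is the least density of a final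
segment. -/
noncomputable def joinKey (κ : ℕ → ℝ) (k : ℕ) (μ : ℝ) (x : ℕ) : ℝ :=
  if x = k then μ else max (κ x) μ

theorem IsSolved.isSchedule_join (hLR : Disjoint L R) (hk : k ∉ L ∪ R)
    (hL : IsSolved f c L σL κ) (hR : IsSolved f c R σR κ) (μ : ℝ) :
    IsSchedule (insert k (L ∪ R)) (mergeByKey κ σL σR ++ [k]) (joinKey κ k μ) := by
  have hS := hL.isSchedule_merge hLR hR
  have hk' : k ∉ mergeByKey κ σL σR := fun h => hk (hS.toFinset_eq ▸ List.mem_toFinset.2 h)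
  have hne : ∀ x ∈ mergeByKey κ σL σR, x ≠ k := fun x hx h => hk' (h ▸ hx)
  refine ⟨?_, ?_, ?_⟩
  · exact List.nodup_append'.2 ⟨hS.nodup, by simp, by simpa using hk'⟩
  · rw [List.toFinset_append, hS.toFinset_eq, List.toFinset_cons, List.toFinset_nil,
      insert_empty_eq, union_comm, ← insert_eq]
  · refine List.pairwise_append.2 ⟨hS.sorted.imp_of_mem fun {x y} hx hy h => ?_, by simp, ?_⟩
    · simp only [joinKey, hne x hx, hne y hy, if_false]
      exact max_le_max_right _ h
    · intro x hx y hy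
      rw [List.mem_singleton] at hy
      subst hy
      simp [joinKey, hne x hx]

/-- The joined schedule is optimal among the orders that end with `k`; if it is optimal
altogether, then it comes with its keys. -/
theorem IsSolved.join (hf : Supermodular f) (hf0 : f ∅ = 0) (hLR : Disjoint L R) (hk : k ∉ L ∪ R)
    (hs : Separates f L R) (hc : ∀ e ∈ insert k (L ∪ R), 0 < c e)
    (hL : IsSolved f c L σL κ) (hR : IsSolved f c R σR κ) {μ : ℝ}
    (hμ₁ : ∀ t ≤ (mergeByKey κ σL σR).length,
      μ * (∑ x ∈ insert k (L ∪ R), c x - ∑ x ∈ ((mergeByKey κ σL σR).take t).toFinset, c x) ≤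
        f (insert k (L ∪ R)) - f ((mergeByKey κ σL σR).take t).toFinset)
    (hμ₂ : ∃ t,
      μ * (∑ x ∈ insert k (L ∪ R), c x - ∑ x ∈ ((mergeByKey κ σL σR).take t).toFinset, c x) =
        f (insert k (L ∪ R)) - f ((mergeByKey κ σL σR).take t).toFinset) :
    (∀ pos', Set.InjOn pos' (insert k (L ∪ R) : Finset ℕ) → (∀ x ∈ L ∪ R, pos' x < pos' k) →
      orderCost f c (insert k (L ∪ R)) ((mergeByKey κ σL σR ++ [k]).idxOf ·) ≤
        orderCost f c (insert k (L ∪ R)) pos') ∧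
    (IsOptimalOrder f c (insert k (L ∪ R)) ((mergeByKey κ σL σR ++ [k]).idxOf ·) →
      IsSolved f c (insert k (L ∪ R)) (mergeByKey κ σL σR ++ [k]) (joinKey κ k μ)) := by
  have hj := hL.isJoin_merge hLR hk hR
  have hS := hL.isSchedule_merge hLR hR
  refine ⟨fun pos' hinj hlast =>
    hj.orderCost_le hLR hk hs hc hL.isKey hR.isKey hL.optimal hR.optimal hinj hlast,
    fun hopt => ⟨hL.isSchedule_join hLR hk hR μ, hopt, ?_⟩⟩
  refine IsKey.insert_last hf hf0 hk hc (hL.isKey.union hLR hs hR.isKey) hopt hj.last ?_ ?_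
  · obtain ⟨t, ht, he⟩ := exists_take_eq_filter hS.sorted μ
    rw [← hS.toFinset_eq, ← he, hS.toFinset_eq]
    exact hμ₁ t ht
  · obtain ⟨t, ht⟩ := hμ₂
    refine ⟨_, ?_, ht⟩
    intro x hx
    rw [← hS.toFinset_eq]
    exact List.mem_toFinset.2 (List.mem_of_mem_take (List.mem_toFinset.1 hx))

end Join

/-- After `i` jobs of `σL` and `j` jobs of `σR` have been taken, the list `ρ` is completed by
merging the rest. -/
structure IsMerging (κ : ℕ → ℝ) (σL σR ρ : List ℕ) (i j : ℕ) : Prop where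
  left_le : i ≤ σL.length
  right_le : j ≤ σR.length
  drop_eq : ρ.drop (i + j) = mergeByKey κ (σL.drop i) (σR.drop j)
  take_eq : (ρ.take (i + j)).toFinset = (σL.take i).toFinset ∪ (σR.take j).toFinset

theorem IsMerging.start (κ : ℕ → ℝ) (σL σR : List ℕ) :
    IsMerging κ σL σR (mergeByKey κ σL σR) 0 0 :=
  ⟨by simp, by simp, by simp, by simp⟩

theorem toFinset_take_succ {σ : List ℕ} {t : ℕ} (ht : t < σ.length) :
    (σ.take (t + 1)).toFinset = insert σ[t] (σ.take t).toFinset := by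
  rw [List.take_succ_eq_append_getElem ht, List.toFinset_append]
  ext x
  simp [or_comm]

theorem getElem_of_drop_eq_cons {ρ l : List ℕ} {t x : ℕ} (h : ρ.drop t = x :: l) :
    ∃ ht : t < ρ.length, ρ[t] = x ∧ ρ.drop (t + 1) = l := by
  have ht : t < ρ.length := by
    by_contra h'
    rw [List.drop_eq_nil_of_le (not_lt.1 h')] at h
    exact absurd h (by simp)
  rw [List.drop_eq_getElem_cons ht] at h
  exact ⟨ht, (List.cons.inj h).1, (List.cons.inj h).2⟩

theorem IsMerging.left {κ : ℕ → ℝ} {σL σR ρ : List ℕ} {i j : ℕ} (h : IsMerging κ σL σR ρ i j)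
    (hi : i < σL.length) (hij : ∀ hj : j < σR.length, κ σR[j] ≤ κ σL[i]) :
    ∃ ht : i + j < ρ.length, ρ[i + j] = σL[i] ∧ IsMerging κ σL σR ρ (i + 1) j := by
  have hd := h.drop_eq
  rw [List.drop_eq_getElem_cons hi] at hd
  have : mergeByKey κ (σL[i] :: σL.drop (i + 1)) (σR.drop j) =
      σL[i] :: mergeByKey κ (σL.drop (i + 1)) (σR.drop j) := by
    rcases h.right_le.lt_or_eq with hj | hj
    · rw [List.drop_eq_getElem_cons hj]
      exact List.cons_merge_cons_pos _ _ _ (by simpa using hij hj)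
    · simp [mergeByKey, hj]
  rw [this] at hd
  obtain ⟨ht, he, hd'⟩ := getElem_of_drop_eq_cons hd
  refine ⟨ht, he, hi, h.right_le, ?_, ?_⟩
  · rwa [show i + 1 + j = i + j + 1 by omega]
  · rw [show i + 1 + j = i + j + 1 by omega, toFinset_take_succ ht, h.take_eq, he,
      toFinset_take_succ hi, insert_union]

theorem IsMerging.right {κ : ℕ → ℝ} {σL σR ρ : List ℕ} {i j : ℕ} (h : IsMerging κ σL σR ρ i j)
    (hj : j < σR.length) (hij : ∀ hi : i < σL.length, κ σL[i] < κ σR[j]) :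
    ∃ ht : i + j < ρ.length, ρ[i + j] = σR[j] ∧ IsMerging κ σL σR ρ i (j + 1) := by
  have hd := h.drop_eq
  rw [List.drop_eq_getElem_cons hj] at hd
  have : mergeByKey κ (σL.drop i) (σR[j] :: σR.drop (j + 1)) =
      σR[j] :: mergeByKey κ (σL.drop i) (σR.drop (j + 1)) := by
    rcases h.left_le.lt_or_eq with hi | hi
    · rw [List.drop_eq_getElem_cons hi]
      exact List.cons_merge_cons_neg _ _ _ (by simpa using hij hi)
    · simp [mergeByKey, hi]
  rw [this] at hd
  obtain ⟨ht, he, hd'⟩ := getElem_of_drop_eq_cons hd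
  refine ⟨ht, he, h.left_le, hj, ?_, ?_⟩
  · rwa [show i + (j + 1) = i + j + 1 by omega]
  · rw [show i + (j + 1) = i + j + 1 by omega, toFinset_take_succ ht, h.take_eq, he,
      toFinset_take_succ hj, union_insert]

/-! ### Rewards on a path -/

/-- The total weight of the pairs `u < v` of vertices of a path such that all edges between them,
numbered `u, …, v - 1`, belong to `A`. -/
noncomputable def reward (n : ℕ) (w : ℕ → ℕ → ℝ) (A : Finset ℕ) : ℝ :=
  ∑ v ∈ range n, ∑ u ∈ range v, if Ico u v ⊆ A then w u v else 0

theorem supermodular_reward {n : ℕ} {w : ℕ → ℕ → ℝ} (hw : ∀ v < n, ∀ u < v, 0 ≤ w u v) :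
    Supermodular (reward n w) := by
  intro A B
  unfold reward
  simp only [← sum_add_distrib]
  refine sum_le_sum fun v hv => sum_le_sum fun u hu => ?_
  have h0 := hw v (mem_range.1 hv) u (mem_range.1 hu)
  have hA : Ico u v ⊆ A → Ico u v ⊆ A ∪ B := fun h => h.trans subset_union_left
  have hB : Ico u v ⊆ B → Ico u v ⊆ A ∪ B := fun h => h.trans subset_union_right
  simp only [subset_inter_iff]
  by_cases h1 : Ico u v ⊆ A <;> by_cases h2 : Ico u v ⊆ B <;>
    simp [h1, h2, hA, hB]
  split_ifs <;> simp [h0]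

theorem reward_empty (n : ℕ) (w : ℕ → ℕ → ℝ) : reward n w ∅ = 0 := by
  unfold reward
  refine sum_eq_zero fun v _ => sum_eq_zero fun u hu => if_neg fun h => ?_
  have := h (mem_Ico.2 ⟨le_rfl, mem_range.1 hu⟩)
  simp at this

theorem separates_reward (n : ℕ) (w : ℕ → ℕ → ℝ) (a k b : ℕ) :
    Separates (reward n w) (Ico a k) (Ico (k + 1) b) := by
  intro A hA B hB
  unfold reward
  simp only [← sum_add_distrib]
  refine sum_congr rfl fun v _ => sum_congr rfl fun u hu => ?_
  have huv := mem_range.1 hu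
  have key : Ico u v ⊆ A ∪ B ↔ Ico u v ⊆ A ∨ Ico u v ⊆ B := by
    constructor
    · intro h
      have hk : k ∉ Ico u v := fun hk => by
        rcases mem_union.1 (h hk) with h' | h'
        · have := mem_Ico.1 (hA h'); omega
        · have := mem_Ico.1 (hB h'); omega
      rw [mem_Ico] at hk
      by_cases hu : u < k
      · left
        intro x hx
        rcases mem_union.1 (h hx) with h' | h'
        · exact h'
        · have := mem_Ico.1 (hB h')
          have := mem_Ico.1 hx
          omega
      · right
        intro x hx
        rcases mem_union.1 (h hx) with h' | h'
        · have := mem_Ico.1 (hA h')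
          have := mem_Ico.1 hx
          omega
        · exact h'
    · rintro (h | h)
      · exact h.trans subset_union_left
      · exact h.trans subset_union_right
  have hnot : ¬ (Ico u v ⊆ A ∧ Ico u v ⊆ B) := fun ⟨h1, h2⟩ => by
    have hu : u ∈ Ico u v := mem_Ico.2 ⟨le_rfl, huv⟩
    have := mem_Ico.1 (hA (h1 hu))
    have := mem_Ico.1 (hB (h2 hu))
    omega
  by_cases h1 : Ico u v ⊆ A <;> by_cases h2 : Ico u v ⊆ B <;> simp_all

theorem reward_Ico_succ {n : ℕ} (w : ℕ → ℕ → ℝ) {a b : ℕ} (hb : b + 1 < n) :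
    reward n w (Ico a (b + 1)) = reward n w (Ico a b) + ∑ u ∈ Ico a (b + 1), w u (b + 1) := by
  have h1 : ∀ v, ∀ u ∈ range v, (Ico u v ⊆ Ico a (b + 1) ↔ a ≤ u ∧ v ≤ b + 1) := fun v u hu =>
    Ico_subset_Ico_iff (mem_range.1 hu)
  have h2 : ∀ v, ∀ u ∈ range v, (Ico u v ⊆ Ico a b ↔ a ≤ u ∧ v ≤ b) := fun v u hu =>
    Ico_subset_Ico_iff (mem_range.1 hu)
  have h3 : ∑ u ∈ Ico a (b + 1), w u (b + 1) =
      ∑ v ∈ range n, ∑ u ∈ range v, if a ≤ u ∧ v = b + 1 then w u v else 0 := by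
    rw [sum_eq_single_of_mem (b + 1) (mem_range.2 hb)]
    · rw [← sum_filter]
      refine sum_congr ?_ fun _ _ => rfl
      ext x; simp; omega
    · intro v _ hv
      exact sum_eq_zero fun u _ => by simp [hv]
  rw [h3]
  unfold reward
  simp only [← sum_add_distrib]
  refine sum_congr rfl fun v _ => sum_congr rfl fun u hu => ?_
  simp only [h1 v u hu, h2 v u hu]
  rw [mem_range] at hu
  by_cases ha : a ≤ u <;> rcases lt_trichotomy v (b + 1) with h | h | h
  · rw [if_pos (by omega), if_pos (by omega), if_neg (by omega), add_zero]
  · rw [if_pos (by omega), if_neg (by omega), if_pos (by omega), zero_add]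
  all_goals rw [if_neg (by omega), if_neg (by omega), if_neg (by omega), add_zero]

end SupermodularScheduling

/-! ### The program: merging two solved intervals -/

namespace PathProgram

open RealRAM SupermodularScheduling Finset

/-- `rvar x := max (rvar x) (rvar y)` -/
def maxCmd (x y : ℕ) : Cmd := .ite (.rle (.var x) (.var y)) (.rset x (.var y)) .skip

/-- `rvar x := min (rvar x) (rvar y)` -/
def minCmd (x y : ℕ) : Cmd := .ite (.rle (.var y) (.var x)) (.rset x (.var y)) .skip

/-- The length of the edge at position `e` of the path. -/
def lenExp (e : IExp) : RExp :=
  .get 0 (.add (.get 3 (.get 4 e)) (.get 4 (.add e (.const 1))))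

/-- The weight of the pair of vertices at positions `u` and `v` of the path. -/
def weightExp (u v : IExp) : RExp :=
  .get 1 (.add (.get 3 (.get 4 u)) (.get 4 v))

/-- The address of the entry `(a, b)` of a table. -/
def tableExp (a b : IExp) : IExp := .add (.get 3 a) b

/-- The storage describes a path with edge lengths `c` and weights `w`: index array 3 holds the
multiples of `n`, index array 4 the labels of the vertices along the path. -/
structure IsEnv (n : ℕ) (c : ℕ → ℝ) (w : ℕ → ℕ → ℝ) (s : State) : Prop where
  num : s.ivar 0 = n
  row : ∀ u < n, s.iarr 3 u = u * n
  len : ∀ e, e + 1 < n → s.rarr 0 (s.iarr 3 (s.iarr 4 e) + s.iarr 4 (e + 1)) = c e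
  weight : ∀ v < n, ∀ u < v, s.rarr 1 (s.iarr 3 (s.iarr 4 u) + s.iarr 4 v) = w u v

theorem IsEnv.frame {n : ℕ} {c : ℕ → ℝ} {w : ℕ → ℕ → ℝ} {s s' : State} {d : Cmd}
    (h : IsEnv n c w s) (hf : Frame d s s') (h0 : d.writes (.ivar 0) = false)
    (h3 : d.writes (.iarr 3) = false) (h4 : d.writes (.iarr 4) = false)
    (h5 : d.writes (.rarr 0) = false) (h6 : d.writes (.rarr 1) = false) : IsEnv n c w s' := by
  have e0 := hf.ivar 0 h0
  have e3 := hf.iarr 3 h3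
  have e4 := hf.iarr 4 h4
  have e5 := hf.rarr 0 h5
  have e6 := hf.rarr 1 h6
  exact ⟨e0.trans h.num, fun u hu => by rw [e3]; exact h.row u hu,
    fun e he => by rw [e3, e4, e5]; exact h.len e he,
    fun v hv u hu => by rw [e3, e4, e6]; exact h.weight v hv u hu⟩

/-- The storage from `p` on holds the schedule `σ`: index array 6 the edges, real array 4 their
keys, where `lam` stands for all smaller keys, and real array 5 the rewards of the initial
segments. -/
structure IsStored (f : Finset ℕ → ℝ) (s : State) (p : ℕ) (lam : ℝ) (σ : List ℕ) (κ : ℕ → ℝ) :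
    Prop where
  edge : ∀ i (h : i < σ.length), s.iarr 6 (p + i) = σ[i]
  key : ∀ i (h : i < σ.length), max (s.rarr 4 (p + i)) lam = κ σ[i]
  reward : ∀ i ≤ σ.length, s.rarr 5 (p + i) = f (σ.take i).toFinset

theorem IsStored.mono {f : Finset ℕ → ℝ} {s s' : State} {p q : ℕ} {lam : ℝ} {σ : List ℕ}
    {κ : ℕ → ℝ} (h : IsStored f s p lam σ κ) (hq : p + σ.length < q)
    (h6 : ∀ x < q, s'.iarr 6 x = s.iarr 6 x) (h4 : ∀ x < q, s'.rarr 4 x = s.rarr 4 x)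
    (h5 : ∀ x < q, s'.rarr 5 x = s.rarr 5 x) : IsStored f s' p lam σ κ :=
  ⟨fun i hi => by rw [h6 _ (by omega)]; exact h.edge i hi,
    fun i hi => by rw [h4 _ (by omega)]; exact h.key i hi,
    fun i hi => by rw [h5 _ (by omega)]; exact h.reward i hi⟩

theorem IsStored.congr {f : Finset ℕ → ℝ} {s : State} {p : ℕ} {lam : ℝ} {σ : List ℕ}
    {κ κ' : ℕ → ℝ} (h : IsStored f s p lam σ κ) (hκ : ∀ x ∈ σ, κ x = κ' x) :
    IsStored f s p lam σ κ' :=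
  ⟨h.edge, fun i hi => by rw [← hκ _ (List.getElem_mem hi)]; exact h.key i hi, h.reward⟩

/-- Put the reward so far into real variable 13 and the missing reward into real variable 6, and
update the least density of a final segment in real variable 5. -/
def densityCmd : Cmd :=
  .seq (.rset 13 (.add (.get 5 (.add (.var 18) (.var 16))) (.get 5 (.add (.var 19) (.var 17))))) <|
  .seq (.rset 6 (.sub (.var 2) (.var 13))) <|
  .seq (.rset 14 (.div (.var 6) (.var 4)))
    (minCmd 5 14)

theorem runs_densityCmd (s : State) :
    Runs densityCmd s 40 fun s' =>
      s'.rvar 13 = s.rarr 5 (s.ivar 18 + s.ivar 16) + s.rarr 5 (s.ivar 19 + s.ivar 17) ∧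
      s'.rvar 6 = s.rvar 2 - s'.rvar 13 ∧
      s'.rvar 5 = min (s.rvar 5) (s'.rvar 6 / s.rvar 4) := by
  refine Cmd.wp.runs ?_ (by decide)
  simp only [densityCmd, minCmd, Cmd.wp, RExp.eval, IExp.eval, BExp.holds]
  intro g hg v hv q hq
  refine ⟨fun h r hr => ?_, fun h => ?_⟩
  · simp at h hg hv hq hr ⊢
    subst hg hv hq hr
    simp [h]
  · simp at h hg hv hq ⊢
    subst hg hv hq
    simp [h.le]

/-- The effective keys of the first remaining jobs of both lists. -/
def keysCmd : Cmd :=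
  .seq (.rset 8 (.get 4 (.add (.var 18) (.var 16)))) <|
  .seq (maxCmd 8 10) <|
  .seq (.rset 9 (.get 4 (.add (.var 19) (.var 17)))) (maxCmd 9 11)

theorem runs_keysCmd (s : State) :
    Runs keysCmd s 40 fun s' =>
      s'.rvar 8 = max (s.rarr 4 (s.ivar 18 + s.ivar 16)) (s.rvar 10) ∧
      s'.rvar 9 = max (s.rarr 4 (s.ivar 19 + s.ivar 17)) (s.rvar 11) := by
  refine Cmd.wp.runs ?_ (by decide)
  simp only [keysCmd, maxCmd, Cmd.wp, RExp.eval, IExp.eval, BExp.holds]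
  intro g hg
  subst hg
  refine ⟨fun h r hr v hv => ?_, fun h v hv => ?_⟩
  all_goals
    simp at h hv
    try simp at hr
    refine ⟨fun h' r' hr' => ?_, fun h' => ?_⟩
    · simp at h' hr' ⊢
      simp_all [le_of_lt]
    · simp at h' ⊢
      simp_all [le_of_lt]

/-- Take the first remaining job of one of the lists. -/
def pickCmd : Cmd :=
  .ite (.and (.not (.ile (.var 13) (.var 16)))
      (.not (.and (.not (.ile (.sub (.var 11) (.var 13)) (.var 17)))
        (.not (.rle (.var 9) (.var 8))))))
    (.seq (.iset 21 (.get 6 (.add (.var 18) (.var 16)))) <|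
      .seq (.rset 12 (.var 8)) (.iset 16 (.add (.var 16) (.const 1))))
    (.seq (.iset 21 (.get 6 (.add (.var 19) (.var 17)))) <|
      .seq (.rset 12 (.var 9)) (.iset 17 (.add (.var 17) (.const 1))))

theorem runs_pickCmd (s : State) :
    Runs pickCmd s 60 fun s' =>
      (s.ivar 16 < s.ivar 13 →
        (s.ivar 17 < s.ivar 11 - s.ivar 13 → s.rvar 9 ≤ s.rvar 8) →
        s'.ivar 21 = s.iarr 6 (s.ivar 18 + s.ivar 16) ∧ s'.rvar 12 = s.rvar 8 ∧
        s'.ivar 16 = s.ivar 16 + 1 ∧ s'.ivar 17 = s.ivar 17) ∧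
      (¬ (s.ivar 16 < s.ivar 13 ∧
        (s.ivar 17 < s.ivar 11 - s.ivar 13 → s.rvar 9 ≤ s.rvar 8)) →
        s'.ivar 21 = s.iarr 6 (s.ivar 19 + s.ivar 17) ∧ s'.rvar 12 = s.rvar 9 ∧
        s'.ivar 16 = s.ivar 16 ∧ s'.ivar 17 = s.ivar 17 + 1) := by
  refine Cmd.wp.runs ?_ (by decide)
  simp only [pickCmd, Cmd.wp, RExp.eval, IExp.eval, BExp.holds, not_and, not_le]
  refine ⟨fun h v hv r hr u hu => ?_, fun h v hv r hr u hu => ?_⟩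
  · simp at hv hr hu ⊢
    subst hv hr hu
    simp
    grind
  · simp at hv hr hu ⊢
    subst hv hr hu
    simp
    grind

/-- Append the job to the new schedule. -/
def emitCmd : Cmd :=
  .seq (.iput 6 (.add (.var 20) (.var 15)) (.var 21)) <|
  .seq (.rput 4 (.add (.var 20) (.var 15)) (.var 12)) <|
  .seq (.rput 5 (.add (.var 20) (.var 15)) (.var 13)) <|
  .seq (.rset 3 (.add (.var 3) (.mul (lenExp (.var 21)) (.var 6))))
    (.rset 4 (.sub (.var 4) (lenExp (.var 21))))

/-- The assignments to the arrays for the entry `p` of a new schedule. -/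
structure IsEmitted (s s' : State) (p e : ℕ) (κ g : ℝ) : Prop where
  edge : ∀ x, s'.iarr 6 x = if x = p then e else s.iarr 6 x
  key : ∀ x, s'.rarr 4 x = if x = p then κ else s.rarr 4 x
  reward : ∀ x, s'.rarr 5 x = if x = p then g else s.rarr 5 x

theorem runs_emitCmd {n : ℕ} {c : ℕ → ℝ} {w : ℕ → ℕ → ℝ} {s : State} (hs : IsEnv n c w s)
    (he : s.ivar 21 + 1 < n) :
    Runs emitCmd s 80 fun s' =>
      IsEmitted s s' (s.ivar 20 + s.ivar 15) (s.ivar 21) (s.rvar 12) (s.rvar 13) ∧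
      s'.rvar 3 = s.rvar 3 + c (s.ivar 21) * s.rvar 6 ∧
      s'.rvar 4 = s.rvar 4 - c (s.ivar 21) := by
  refine Cmd.wp.runs ?_ (by decide)
  simp only [emitCmd, lenExp, Cmd.wp, RExp.eval, IExp.eval]
  intro p e hp hpe p' k hp' hk p'' g hp'' hg x hx y hy
  simp at hp hpe hp' hk hp'' hg hx hy
  rw [hs.len _ he] at hx hy
  subst hp hpe hp' hk hp'' hg hx hy
  refine ⟨⟨fun z => ?_, fun z => ?_, fun z => ?_⟩, ?_, ?_⟩ <;> simp

/-- One step of the merging loop. -/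
def mergeStepCmd : Cmd := .seq densityCmd <| .seq keysCmd <| .seq pickCmd emitCmd

/-- The setting of the merging loop in the state `s`: the schedules `σL` and `σR` are stored, `E`
consists of their edges and one more, and the new schedule goes to free storage. -/
structure IsMergeInput (n : ℕ) (c : ℕ → ℝ) (w : ℕ → ℕ → ℝ) (f : Finset ℕ → ℝ) (E : Finset ℕ)
    (κ : ℕ → ℝ) (σL σR : List ℕ) (s : State) : Prop where
  env : IsEnv n c w s
  length_left : σL.length = s.ivar 13
  length_right : σR.length = s.ivar 11 - s.ivar 13
  left_le : s.ivar 13 ≤ s.ivar 11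
  left : IsStored f s (s.ivar 18) (s.rvar 10) σL κ
  right : IsStored f s (s.ivar 19) (s.rvar 11) σR κ
  left_lt : s.ivar 18 + σL.length < s.ivar 20
  right_lt : s.ivar 19 + σR.length < s.ivar 20
  total : s.rvar 2 = f E
  edge_lt : ∀ e ∈ mergeByKey κ σL σR, e + 1 < n
  separates : Separates f σL.toFinset σR.toFinset
  nodup : (mergeByKey κ σL σR).Nodup
  pos : ∀ t, 0 < ∑ x ∈ E, c x - ∑ x ∈ ((mergeByKey κ σL σR).take t).toFinset, c x

/-- The first `t` entries of the schedule `ρ` of `E` have been written from `p` on, nothing has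
changed below `p`, and real variables 3 and 4 hold the cost so far and the remaining time. -/
structure IsWritten (c : ℕ → ℝ) (f : Finset ℕ → ℝ) (E : Finset ℕ) (κ : ℕ → ℝ) (ρ : List ℕ)
    (s₀ : State) (p t : ℕ) (s : State) : Prop where
  cost : s.rvar 3 = ∑ u ∈ range t, c (ρ.getD u 0) * (f E - f (ρ.take u).toFinset)
  rem : s.rvar 4 = ∑ x ∈ E, c x - ∑ x ∈ (ρ.take t).toFinset, c x
  edge : ∀ u < t, s.iarr 6 (p + u) = ρ.getD u 0
  key : ∀ u < t, s.rarr 4 (p + u) = κ (ρ.getD u 0)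
  reward : ∀ u < t, s.rarr 5 (p + u) = f (ρ.take u).toFinset
  edge_old : ∀ x < p, s.iarr 6 x = s₀.iarr 6 x
  key_old : ∀ x < p, s.rarr 4 x = s₀.rarr 4 x
  reward_old : ∀ x < p, s.rarr 5 x = s₀.rarr 5 x

/-- Consider the final segments of a schedule of `E` that begins with `ρ`, and their densities, that
is, reward divided by time. One of them is `μ`, and those of the segments that start at one of the
first `t` entries are at least `μ`. -/
structure IsLeastDensity (c : ℕ → ℝ) (f : Finset ℕ → ℝ) (E : Finset ℕ) (ρ : List ℕ) (t : ℕ)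
    (μ : ℝ) : Prop where
  le : ∀ u < t, μ * (∑ x ∈ E, c x - ∑ x ∈ (ρ.take u).toFinset, c x) ≤
    f E - f (ρ.take u).toFinset
  eq : ∃ u, μ * (∑ x ∈ E, c x - ∑ x ∈ (ρ.take u).toFinset, c x) = f E - f (ρ.take u).toFinset

/-- The invariant of the merging loop after `t` steps. -/
structure IsMergeState (c : ℕ → ℝ) (f : Finset ℕ → ℝ) (E : Finset ℕ) (κ : ℕ → ℝ) (σL σR : List ℕ)
    (s₀ : State) (t : ℕ) (s : State) : Prop
    extends IsWritten c f E κ (mergeByKey κ σL σR) s₀ (s₀.ivar 20) t s where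
  density : IsLeastDensity c f E (mergeByKey κ σL σR) t (s.rvar 5)
  merging : IsMerging κ σL σR (mergeByKey κ σL σR) (s.ivar 16) (s.ivar 17)
  add_eq : s.ivar 16 + s.ivar 17 = t

variable {n : ℕ} {c : ℕ → ℝ} {w : ℕ → ℕ → ℝ} {f : Finset ℕ → ℝ} {E : Finset ℕ} {κ : ℕ → ℝ}
  {σL σR : List ℕ} {s₀ s : State} {t : ℕ}

theorem IsMergeInput.runs_densityCmd (h₀ : IsMergeInput n c w f E κ σL σR s₀)
    (h : IsMergeState c f E κ σL σR s₀ t s) (h18 : s.ivar 18 = s₀.ivar 18)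
    (h19 : s.ivar 19 = s₀.ivar 19) (h2 : s.rvar 2 = s₀.rvar 2) :
    Runs densityCmd s 40 fun s' =>
      s'.rvar 13 = f ((mergeByKey κ σL σR).take t).toFinset ∧
      s'.rvar 6 = f E - f ((mergeByKey κ σL σR).take t).toFinset ∧
      IsLeastDensity c f E (mergeByKey κ σL σR) (t + 1) (s'.rvar 5) := by
  refine (PathProgram.runs_densityCmd s).mono le_rfl fun s' F ⟨q13, q6, q5⟩ => ?_
  set ρ := mergeByKey κ σL σR with hρ
  have hm := h.merging
  have e1 : s.rarr 5 (s.ivar 18 + s.ivar 16) = f (σL.take (s.ivar 16)).toFinset := by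
    have := hm.left_le
    have := h₀.left_lt
    rw [h18, h.reward_old _ (by omega)]
    exact h₀.left.reward _ hm.left_le
  have e2 : s.rarr 5 (s.ivar 19 + s.ivar 17) = f (σR.take (s.ivar 17)).toFinset := by
    have := hm.right_le
    have := h₀.right_lt
    rw [h19, h.reward_old _ (by omega)]
    exact h₀.right.reward _ hm.right_le
  have g13 : s'.rvar 13 = f (ρ.take t).toFinset := by
    rw [q13, e1, e2, ← h.add_eq, hm.take_eq]
    refine (h₀.separates _ (fun x hx => ?_) _ (fun x hx => ?_)).symm
    · exact List.mem_toFinset.2 (List.mem_of_mem_take (List.mem_toFinset.1 hx))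
    · exact List.mem_toFinset.2 (List.mem_of_mem_take (List.mem_toFinset.1 hx))
  have g6 : s'.rvar 6 = f E - f (ρ.take t).toFinset := by rw [q6, h2, h₀.total, g13]
  rw [h.rem, g6] at q5
  have hpos := h₀.pos
  refine ⟨g13, g6, fun u hu => ?_, ?_⟩
  · rcases Nat.lt_succ_iff_lt_or_eq.1 hu with hu | rfl
    · refine le_trans ?_ (h.density.le u hu)
      rw [q5]
      exact mul_le_mul_of_nonneg_right (min_le_left _ _) (hpos u).le
    · rw [← le_div_iff₀ (hpos u), q5]
      exact min_le_right _ _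
  · rcases min_choice (s.rvar 5)
      ((f E - f (ρ.take t).toFinset) / (∑ x ∈ E, c x - ∑ x ∈ (ρ.take t).toFinset, c x)) with h' | h'
    · obtain ⟨u, hu⟩ := h.density.eq
      exact ⟨u, by rw [q5, h']; exact hu⟩
    · exact ⟨t, by rw [q5, h', div_mul_cancel₀ _ (hpos t).ne']⟩

theorem sum_toFinset_take_succ {ρ : List ℕ} (hρ : ρ.Nodup) {t : ℕ} (ht : t < ρ.length)
    (c : ℕ → ℝ) : ∑ x ∈ (ρ.take (t + 1)).toFinset, c x =
      ∑ x ∈ (ρ.take t).toFinset, c x + c ρ[t] := by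
  rw [toFinset_take_succ ht, sum_insert, add_comm]
  intro h
  have := (List.mem_take_iff_idxOf_lt (List.getElem_mem ht)).1 (List.mem_toFinset.1 h)
  rw [hρ.idxOf_getElem] at this
  exact lt_irrefl _ this

/-- The next entry of the schedule is emitted. -/
theorem IsWritten.emit {ρ : List ℕ} {s₁ s' : State} {p : ℕ} (h : IsWritten c f E κ ρ s₀ p t s)
    (hρ : ρ.Nodup) (ht : t < ρ.length) {e : ℕ} {x : ℝ}
    (he : e = ρ[t]) (hx : x = κ ρ[t])
    (h6 : s₁.iarr 6 = s.iarr 6) (h4 : s₁.rarr 4 = s.rarr 4) (h5 : s₁.rarr 5 = s.rarr 5)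
    (hemit : IsEmitted s₁ s' (p + t) e x (f (ρ.take t).toFinset))
    (hcost : s'.rvar 3 = s.rvar 3 + c e * (f E - f (ρ.take t).toFinset))
    (hrem : s'.rvar 4 = s.rvar 4 - c e) : IsWritten c f E κ ρ s₀ p (t + 1) s' := by
  have hg : ρ.getD t 0 = ρ[t] := List.getD_eq_getElem _ _ ht
  refine ⟨?_, ?_, fun u hu => ?_, fun u hu => ?_, fun u hu => ?_, fun y hy => ?_,
    fun y hy => ?_, fun y hy => ?_⟩
  · rw [hcost, h.cost, sum_range_succ, hg, he]
  · rw [hrem, h.rem, sum_toFinset_take_succ hρ ht, he]; ring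
  · rw [hemit.edge, h6]
    rcases Nat.lt_succ_iff_lt_or_eq.1 hu with hu | rfl
    · rw [if_neg (by omega), h.edge u hu]
    · rw [if_pos rfl, he, hg]
  · rw [hemit.key, h4]
    rcases Nat.lt_succ_iff_lt_or_eq.1 hu with hu | rfl
    · rw [if_neg (by omega), h.key u hu]
    · rw [if_pos rfl, hx, hg]
  · rw [hemit.reward, h5]
    rcases Nat.lt_succ_iff_lt_or_eq.1 hu with hu | rfl
    · rw [if_neg (by omega), h.reward u hu]
    · rw [if_pos rfl]
  · rw [hemit.edge, h6, if_neg (by omega), h.edge_old y hy]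
  · rw [hemit.key, h4, if_neg (by omega), h.key_old y hy]
  · rw [hemit.reward, h5, if_neg (by omega), h.reward_old y hy]

theorem IsMergeInput.runs_mergeStepCmd (h₀ : IsMergeInput n c w f E κ σL σR s₀)
    (h : IsMergeState c f E κ σL σR s₀ t s) (ht : t < s₀.ivar 11) (h15 : s.ivar 15 = t)
    (hF : Frame (.for 15 (.var 11) mergeStepCmd) s₀ s) :
    Runs mergeStepCmd s 220 fun s' =>
      IsMergeState c f E κ σL σR s₀ (t + 1) (s'.setIvar 15 (t + 1)) := by
  set ρ := mergeByKey κ σL σR with hρ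
  have f18 := hF.ivar 18 rfl
  have f19 := hF.ivar 19 rfl
  have f20 := hF.ivar 20 rfl
  have f13 := hF.ivar 13 rfl
  have f11 := hF.ivar 11 rfl
  have hlen : ρ.length = s₀.ivar 11 := by
    have := h₀.left_le
    rw [hρ, length_mergeByKey, h₀.length_left, h₀.length_right]
    omega
  have hm := h.merging
  have hadd := h.add_eq
  refine ((h₀.runs_densityCmd h f18 f19 (hF.rvar 2 rfl)).seq (T' := 180) fun s₁ F₁ q₁ => ?_)
  refine ((runs_keysCmd s₁).seq (T' := 140) fun s₂ F₂ q₂ => ?_)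
  have key_left : ∀ hi : s.ivar 16 < σL.length, s₂.rvar 8 = κ σL[s.ivar 16] := by
    intro hi
    have := h₀.left_lt
    rw [q₂.1, F₁.rarr 4 rfl, F₁.ivar 18 rfl, F₁.ivar 16 rfl, f18, h.key_old _ (by omega),
      F₁.rvar 10 rfl, hF.rvar 10 rfl]
    exact h₀.left.key _ hi
  have key_right : ∀ hj : s.ivar 17 < σR.length, s₂.rvar 9 = κ σR[s.ivar 17] := by
    intro hj
    have := h₀.right_lt
    rw [q₂.2, F₁.rarr 4 rfl, F₁.ivar 19 rfl, F₁.ivar 17 rfl, f19, h.key_old _ (by omega),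
      F₁.rvar 11 rfl, hF.rvar 11 rfl]
    exact h₀.right.key _ hj
  have g16 : s₂.ivar 16 = s.ivar 16 := (F₂.ivar 16 rfl).trans (F₁.ivar 16 rfl)
  have g17 : s₂.ivar 17 = s.ivar 17 := (F₂.ivar 17 rfl).trans (F₁.ivar 17 rfl)
  have g13 : s₂.ivar 13 = σL.length :=
    (F₂.ivar 13 rfl).trans ((F₁.ivar 13 rfl).trans (f13.trans h₀.length_left.symm))
  have g11 : s₂.ivar 11 - s₂.ivar 13 = σR.length := by
    rw [h₀.length_right, ← f11, ← f13, F₂.ivar 11 rfl, F₁.ivar 11 rfl, F₂.ivar 13 rfl,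
      F₁.ivar 13 rfl]
  have harr : ∀ x < s₀.ivar 20, s₂.iarr 6 x = s₀.iarr 6 x := fun x hx => by
    rw [F₂.iarr 6 rfl, F₁.iarr 6 rfl, h.edge_old x hx]
  -- the job that is taken is the next one of the merged list
  have hpick : Runs pickCmd s₂ 60 fun s₃ => ∃ ht : t < ρ.length,
      s₃.ivar 21 = ρ[t] ∧ s₃.rvar 12 = κ ρ[t] ∧
      IsMerging κ σL σR ρ (s₃.ivar 16) (s₃.ivar 17) ∧ s₃.ivar 16 + s₃.ivar 17 = t + 1 := by
    refine (runs_pickCmd s₂).mono le_rfl fun s₃ F₃ q₃ => ?_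
    rw [g16, g17, g11, g13] at q₃
    subst hadd
    by_cases hcase : s.ivar 16 < σL.length ∧
        (s.ivar 17 < σR.length → s₂.rvar 9 ≤ s₂.rvar 8)
    · obtain ⟨r21, r12, r16, r17⟩ := q₃.1 hcase.1 hcase.2
      obtain ⟨ht, he, hm'⟩ := hm.left hcase.1 fun hj => by
        rw [← key_left hcase.1, ← key_right hj]; exact hcase.2 hj
      refine ⟨ht, ?_, ?_, by rwa [r16, r17], by omega⟩
      · have := h₀.left_lt
        rw [he, r21, F₂.ivar 18 rfl, F₁.ivar 18 rfl, f18, harr _ (by omega)]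
        exact h₀.left.edge _ hcase.1
      · rw [r12, key_left hcase.1, he]
    · obtain ⟨r21, r12, r16, r17⟩ := q₃.2 hcase
      have hj : s.ivar 17 < σR.length := by
        have := h₀.left_le
        rw [h₀.length_left, h₀.length_right] at *
        by_contra hj
        exact hcase ⟨by omega, fun h => absurd h hj⟩
      obtain ⟨ht, he, hm'⟩ := hm.right hj fun hi => by
        rw [← key_left hi, ← key_right hj]
        by_contra hlt
        exact hcase ⟨hi, fun _ => not_lt.1 hlt⟩
      refine ⟨ht, ?_, ?_, by rwa [r16, r17], by omega⟩
      · have := h₀.right_lt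
        rw [he, r21, F₂.ivar 19 rfl, F₁.ivar 19 rfl, f19, harr _ (by omega)]
        exact h₀.right.edge _ hj
      · rw [r12, key_right hj, he]
  refine hpick.seq (T' := 80) fun s₃ F₃ ⟨htρ, r21, r12, hm', hadd'⟩ => ?_
  have env₃ : IsEnv n c w s₃ :=
    (((h₀.env.frame hF rfl rfl rfl rfl rfl).frame F₁ rfl rfl rfl rfl rfl).frame F₂ rfl rfl rfl rfl
      rfl).frame F₃ rfl rfl rfl rfl rfl
  have hlt : s₃.ivar 21 + 1 < n := by
    rw [r21]
    exact h₀.edge_lt _ (List.getElem_mem htρ)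
  refine (runs_emitCmd env₃ hlt).mono le_rfl fun s₄ F₄ ⟨q, qc, qr⟩ => ?_
  have p20 : s₃.ivar 20 + s₃.ivar 15 = s₀.ivar 20 + t := by
    rw [F₃.ivar 20 rfl, F₂.ivar 20 rfl, F₁.ivar 20 rfl, f20, F₃.ivar 15 rfl, F₂.ivar 15 rfl,
      F₁.ivar 15 rfl, h15]
  have p13 : s₃.rvar 13 = f (ρ.take t).toFinset := by
    rw [F₃.rvar 13 rfl, F₂.rvar 13 rfl, q₁.1]
  have p6 : s₃.rvar 6 = f E - f (ρ.take t).toFinset := by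
    rw [F₃.rvar 6 rfl, F₂.rvar 6 rfl, q₁.2.1]
  have p5 : s₄.rvar 5 = s₁.rvar 5 := by rw [F₄.rvar 5 rfl, F₃.rvar 5 rfl, F₂.rvar 5 rfl]
  rw [p20, p13] at q
  rw [p6, F₃.rvar 3 rfl, F₂.rvar 3 rfl, F₁.rvar 3 rfl] at qc
  rw [F₃.rvar 4 rfl, F₂.rvar 4 rfl, F₁.rvar 4 rfl] at qr
  have hw : IsWritten c f E κ ρ s₀ (s₀.ivar 20) (t + 1) s₄ :=
    h.toIsWritten.emit h₀.nodup htρ r21 r12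
      (by rw [F₃.iarr 6 rfl, F₂.iarr 6 rfl, F₁.iarr 6 rfl])
      (by rw [F₃.rarr 4 rfl, F₂.rarr 4 rfl, F₁.rarr 4 rfl])
      (by rw [F₃.rarr 5 rfl, F₂.rarr 5 rfl, F₁.rarr 5 rfl]) q qc qr
  refine ⟨⟨hw.cost, hw.rem, hw.edge, hw.key, hw.reward,
    hw.edge_old, hw.key_old, hw.reward_old⟩, ?_, ?_, ?_⟩
  · show IsLeastDensity c f E ρ (t + 1) (s₄.rvar 5)
    rw [p5]; exact q₁.2.2
  · simpa [F₄.ivar 16 rfl, F₄.ivar 17 rfl] using hm'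
  · simpa [F₄.ivar 16 rfl, F₄.ivar 17 rfl] using hadd'

end PathProgram

/-! ### The program: one choice of the last edge -/

namespace PathProgram

open RealRAM SupermodularScheduling Finset

theorem IsMergeInput.runs_loop {n : ℕ} {c : ℕ → ℝ} {w : ℕ → ℕ → ℝ} {f : Finset ℕ → ℝ}
    {E : Finset ℕ} {κ : ℕ → ℝ} {σL σR : List ℕ} {s : State}
    (h : IsMergeInput n c w f E κ σL σR s) (hf : f ∅ = 0) (h16 : s.ivar 16 = 0)
    (h17 : s.ivar 17 = 0) (h3 : s.rvar 3 = 0) (h4 : s.rvar 4 = ∑ x ∈ E, c x)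
    (h5 : s.rvar 5 = f E / ∑ x ∈ E, c x) :
    Runs (.for 15 (.var 11) mergeStepCmd) s ((s.ivar 11 + 1) * 231)
      (IsMergeState c f E κ σL σR s (s.ivar 11)) := by
  refine (Runs.forVar (T := 220) (IsMergeState c f E κ σL σR s) rfl rfl rfl ?_
    fun t ht s' F h15 hs => ?_)
  · have hpos : 0 < ∑ x ∈ E, c x := by simpa using h.pos 0
    refine ⟨⟨by simpa using h3, by simpa using h4, by simp, by simp, by simp, by simp, by simp,
      by simp⟩, ⟨by simp, 0, ?_⟩, ?_, by simp [h16, h17]⟩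
    · simp [hf, h5, hpos.ne']
    · simpa [h16, h17] using IsMerging.start κ σL σR
  · exact h.runs_mergeStepCmd hs ht h15 F

/-- An optimal schedule of the edges `a, …, b - 1` is stored with its keys, at the address given by
index array 5; the keys below the entry of real array 6 are raised to it. -/
def HasSlot (n : ℕ) (c : ℕ → ℝ) (w : ℕ → ℕ → ℝ) (s : State) (a b : ℕ) : Prop :=
  ∃ σ κ, IsSolved (reward n w) c (Ico a b) σ κ ∧
    IsStored (reward n w) s (s.iarr 5 (a * n + b)) (s.rarr 6 (a * n + b)) σ κ ∧
    s.iarr 5 (a * n + b) + σ.length < s.ivar 20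

/-- Compared to `s`, only storage that was free has been used for schedules in `s'`. -/
structure IsExtension (s s' : State) : Prop where
  free_le : s.ivar 20 ≤ s'.ivar 20
  edge : ∀ x < s.ivar 20, s'.iarr 6 x = s.iarr 6 x
  key : ∀ x < s.ivar 20, s'.rarr 4 x = s.rarr 4 x
  reward : ∀ x < s.ivar 20, s'.rarr 5 x = s.rarr 5 x

theorem IsExtension.trans {s₁ s₂ s₃ : State} (h : IsExtension s₁ s₂) (h' : IsExtension s₂ s₃) :
    IsExtension s₁ s₃ := by
  have := h.free_le
  exact ⟨h.free_le.trans h'.free_le,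
    fun x hx => (h'.edge x (by omega)).trans (h.edge x hx),
    fun x hx => (h'.key x (by omega)).trans (h.key x hx),
    fun x hx => (h'.reward x (by omega)).trans (h.reward x hx)⟩

theorem HasSlot.extend {n : ℕ} {c : ℕ → ℝ} {w : ℕ → ℕ → ℝ} {s s' : State} {a b : ℕ}
    (h : HasSlot n c w s a b) (he : IsExtension s s')
    (h5 : s'.iarr 5 (a * n + b) = s.iarr 5 (a * n + b))
    (h6 : s'.rarr 6 (a * n + b) = s.rarr 6 (a * n + b)) : HasSlot n c w s' a b := by
  obtain ⟨σ, κ, hσ, hst, hlt⟩ := h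
  refine ⟨σ, κ, hσ, ?_, ?_⟩
  · rw [h5, h6]
    exact hst.mono hlt he.edge he.key he.reward
  · rw [h5]
    exact hlt.trans_le he.free_le

/-- Prepare the merging for the interval `(a, b)` with the last edge `k = a + h`. -/
def setupCmd : Cmd :=
  .seq (.iset 14 (.add (.var 12) (.var 13))) <|
  .seq (.iset 18 (.get 5 (tableExp (.var 12) (.var 14)))) <|
  .seq (.rset 10 (.get 6 (tableExp (.var 12) (.var 14)))) <|
  .seq (.iset 19 (.get 5 (tableExp (.add (.var 14) (.const 1)) (.var 10)))) <|
  .seq (.rset 11 (.get 6 (tableExp (.add (.var 14) (.const 1)) (.var 10)))) <|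
  .seq (.iset 16 (.const 0)) <|
  .seq (.iset 17 (.const 0)) <|
  .seq (.rset 3 (.const 0)) <|
  .seq (.rset 4 (.var 1))
    (.rset 5 (.div (.var 2) (.var 1)))

/-- Append the last edge. -/
def finishCmd : Cmd :=
  .seq (.iset 21 (.var 14)) <|
  .seq (.rset 12 (.var 5)) <|
  .seq (.iset 15 (.var 11)) <|
  .seq emitCmd
    (.rput 5 (.add (.add (.var 20) (.var 11)) (.const 1)) (.var 2))

/-- Write the best schedule of the interval `(a, b)` that ends with the edge `a + h`. -/
def candidateCmd : Cmd :=
  .seq setupCmd <| .seq (.for 15 (.var 11) mergeStepCmd) <| .seq densityCmd finishCmd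

/-- The schedule `σ` of the edges `a, …, b - 1` is stored from `p` on, and it comes with keys if
it is optimal. -/
structure IsCandidate (n : ℕ) (c : ℕ → ℝ) (w : ℕ → ℕ → ℝ) (a b : ℕ) (s : State) (p : ℕ) (lam : ℝ)
    (σ : List ℕ) (κ : ℕ → ℝ) : Prop where
  schedule : IsSchedule (Ico a b) σ κ
  solved : IsOptimalOrder (reward n w) c (Ico a b) (σ.idxOf ·) →
    IsSolved (reward n w) c (Ico a b) σ κ
  stored : IsStored (reward n w) s p lam σ κ

/-- The state in which the last edge `k` of the interval `(a, b)` is to be chosen. -/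
structure IsIntervalState (n : ℕ) (c : ℕ → ℝ) (w : ℕ → ℕ → ℝ) (a b : ℕ) (s : State) : Prop where
  env : IsEnv n c w s
  lt : a < b
  lt_num : b < n
  right_end : s.ivar 10 = b
  left_end : s.ivar 12 = a
  width : s.ivar 11 = b - a - 1
  time : s.rvar 1 = ∑ x ∈ Ico a b, c x
  total : s.rvar 2 = reward n w (Ico a b)
  slot_left : ∀ k, a ≤ k → k < b → HasSlot n c w s a k
  slot_right : ∀ k, a ≤ k → k < b → HasSlot n c w s (k + 1) b

theorem insert_Ico_union {a k b : ℕ} (hak : a ≤ k) (hkb : k < b) :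
    insert k (Ico a k ∪ Ico (k + 1) b) = Ico a b := by
  ext x; simp; omega

theorem runs_setupCmd (s : State) :
    Runs setupCmd s 80 fun s' =>
      s'.ivar 14 = s.ivar 12 + s.ivar 13 ∧
      s'.ivar 18 = s.iarr 5 (s.iarr 3 (s.ivar 12) + s'.ivar 14) ∧
      s'.rvar 10 = s.rarr 6 (s.iarr 3 (s.ivar 12) + s'.ivar 14) ∧
      s'.ivar 19 = s.iarr 5 (s.iarr 3 (s'.ivar 14 + 1) + s.ivar 10) ∧
      s'.rvar 11 = s.rarr 6 (s.iarr 3 (s'.ivar 14 + 1) + s.ivar 10) ∧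
      s'.ivar 16 = 0 ∧ s'.ivar 17 = 0 ∧ s'.rvar 3 = 0 ∧ s'.rvar 4 = s.rvar 1 ∧
      s'.rvar 5 = s.rvar 2 / s.rvar 1 := by
  refine Cmd.wp.runs ?_ (by decide)
  simp only [setupCmd, tableExp, Cmd.wp, RExp.eval, IExp.eval]
  intro v1 h1 v2 h2 v3 h3 v4 h4 v5 h5 v6 h6 v7 h7 v8 h8 v9 h9 v10 h10
  simp at h1 h2 h3 h4 h5 h6 h7 h8 h9 h10 ⊢
  simp_all

theorem runs_finishCmd {n : ℕ} {c : ℕ → ℝ} {w : ℕ → ℕ → ℝ} {s : State} (hs : IsEnv n c w s)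
    (he : s.ivar 14 + 1 < n) :
    Runs finishCmd s 120 fun s' =>
      (∀ x, s'.iarr 6 x = if x = s.ivar 20 + s.ivar 11 then s.ivar 14 else s.iarr 6 x) ∧
      (∀ x, s'.rarr 4 x = if x = s.ivar 20 + s.ivar 11 then s.rvar 5 else s.rarr 4 x) ∧
      (∀ x, s'.rarr 5 x = if x = s.ivar 20 + s.ivar 11 + 1 then s.rvar 2 else
        if x = s.ivar 20 + s.ivar 11 then s.rvar 13 else s.rarr 5 x) ∧
      s'.rvar 3 = s.rvar 3 + c (s.ivar 14) * s.rvar 6 := by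
  refine Cmd.wp.runs ?_ (by decide)
  simp only [finishCmd, emitCmd, lenExp, Cmd.wp, RExp.eval, IExp.eval]
  intro v1 h1 v2 h2 v3 h3 p e hp hpe p' k hp' hk p'' g hp'' hg x hx y hy z u hz hu
  simp at h1 h2 h3
  subst h1 h2 h3
  simp at hp hpe hp' hk hp'' hg hx hy hz hu
  rw [hs.len _ he] at hx hy
  subst hp hpe hp' hk hp'' hg hx hy hz hu
  refine ⟨fun z => ?_, fun z => ?_, fun z => ?_, ?_⟩ <;> simp

/-- The candidate is a schedule with its keys, it is the best one with its last edge, and real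
variable 3 holds its cost. -/
theorem IsIntervalState.runs_candidateCmd {n : ℕ} {c : ℕ → ℝ} {w : ℕ → ℕ → ℝ} {a b : ℕ} {s : State}
    (hw : ∀ v < n, ∀ u < v, 0 ≤ w u v) (hc : ∀ e, e + 1 < n → 0 < c e)
    (h : IsIntervalState n c w a b s) (hk : s.ivar 13 ≤ s.ivar 11) :
    Runs candidateCmd s (240 + (s.ivar 11 + 1) * 231) fun s' => ∃ σ κ,
      IsCandidate n c w a b s' (s.ivar 20) (s'.rvar 5) σ κ ∧
      (∀ pos, Set.InjOn pos (Ico a b) →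
        (∀ x ∈ Ico a b, x ≠ a + s.ivar 13 → pos x < pos (a + s.ivar 13)) →
        s'.rvar 3 ≤ orderCost (reward n w) c (Ico a b) pos) ∧
      s'.rvar 3 = orderCost (reward n w) c (Ico a b) (σ.idxOf ·) ∧
      σ.length = s.ivar 11 + 1 ∧ IsExtension s s' := by
  have hab := h.lt
  have hbn := h.lt_num
  have hwidth := h.width
  obtain ⟨k, hkdef⟩ : ∃ k, k = a + s.ivar 13 := ⟨_, rfl⟩
  have hak : a ≤ k := by omega
  have hkb : k < b := by omega
  obtain ⟨σL, κL, solL, stL, ltL⟩ := h.slot_left k hak hkb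
  obtain ⟨σR, κR, solR, stR, ltR⟩ := h.slot_right k hak hkb
  set f := reward n w with hf
  -- one function holds the keys of both sides
  set κ : ℕ → ℝ := fun x => if x < k then κL x else κR x with hκ
  have hκL : ∀ x ∈ Ico a k, κL x = κ x := fun x hx => by simp [hκ, (mem_Ico.1 hx).2]
  have hκR : ∀ x ∈ Ico (k + 1) b, κR x = κ x := fun x hx => by
    have := (mem_Ico.1 hx).1
    simp only [hκ]; rw [if_neg (by omega)]
  have mL : ∀ {x}, x ∈ σL → x ∈ Ico a k := fun {x} hx => by
    rw [← solL.toFinset_eq]; exact List.mem_toFinset.2 hx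
  have mR : ∀ {x}, x ∈ σR → x ∈ Ico (k + 1) b := fun {x} hx => by
    rw [← solR.toFinset_eq]; exact List.mem_toFinset.2 hx
  have stL' := stL.congr fun x hx => hκL x (mL hx)
  have stR' := stR.congr fun x hx => hκR x (mR hx)
  have solL' := solL.congr hκL
  have solR' := solR.congr hκR
  have lenL : σL.length = k - a := by
    rw [solL.length_eq, Nat.card_Ico]
  have lenR : σR.length = b - (k + 1) := by
    rw [solR.length_eq, Nat.card_Ico]
  have hLR : Disjoint (Ico a k) (Ico (k + 1) b) := by
    rw [disjoint_left]; intro x hx hx'; rw [mem_Ico] at hx hx'; omega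
  have hkLR : k ∉ Ico a k ∪ Ico (k + 1) b := by simp
  have hE := insert_Ico_union hak hkb
  set ρ := mergeByKey κ σL σR with hρ
  have hS := solL'.isSchedule_merge hLR solR'
  have lenρ : ρ.length = s.ivar 11 := by rw [hρ, length_mergeByKey, lenL, lenR]; omega
  have hsep : Separates f (Ico a k) (Ico (k + 1) b) := separates_reward n w a k b
  have hf0 : f ∅ = 0 := reward_empty n w
  have hcE : ∀ e ∈ Ico a b, 0 < c e := fun e he => hc e (by have := (mem_Ico.1 he).2; omega)
  have hkE : k ∈ Ico a b := mem_Ico.2 ⟨hak, hkb⟩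
  have htake : ∀ t, (ρ.take t).toFinset ⊆ Ico a k ∪ Ico (k + 1) b := fun t x hx => by
    rw [← hS.toFinset_eq]
    exact List.mem_toFinset.2 (List.mem_of_mem_take (List.mem_toFinset.1 hx))
  have hsubE : Ico a k ∪ Ico (k + 1) b ⊆ Ico a b := by
    rw [← hE]; exact subset_insert _ _
  have hpos : ∀ t, 0 < ∑ x ∈ Ico a b, c x - ∑ x ∈ (ρ.take t).toFinset, c x := fun t => by
    rw [← sum_sdiff ((htake t).trans hsubE), add_sub_cancel_right]
    exact sum_pos (fun x hx => hcE x (mem_sdiff.1 hx).1)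
      ⟨k, mem_sdiff.2 ⟨hkE, fun hx => hkLR (htake t hx)⟩⟩
  have hbound : 240 + (s.ivar 11 + 1) * 231 = 80 + ((s.ivar 11 + 1) * 231 + (40 + 120)) := by ring
  rw [hbound]
  refine (runs_setupCmd s).seq fun s₁ F₁ ⟨q14, q18, q10, q19, q11, q16, q17, q3, q4, q5⟩ => ?_
  have r14 : s₁.ivar 14 = k := by rw [q14, h.left_end, hkdef]
  rw [r14, h.left_end, h.env.row a (by omega)] at q18 q10
  rw [r14, h.right_end, h.env.row (k + 1) (by omega)] at q19 q11
  have i11 : s₁.ivar 11 = s.ivar 11 := F₁.ivar 11 rfl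
  have i13 : s₁.ivar 13 = s.ivar 13 := F₁.ivar 13 rfl
  have i20 : s₁.ivar 20 = s.ivar 20 := F₁.ivar 20 rfl
  have input : IsMergeInput n c w f (Ico a b) κ σL σR s₁ := by
    refine ⟨h.env.frame F₁ rfl rfl rfl rfl rfl, by omega, by omega, by omega, ?_, ?_, ?_, ?_, ?_,
      fun e he => ?_, ?_, hS.nodup, hpos⟩
    · rw [q18, q10]
      exact stL'.mono ltL (fun x _ => by rw [F₁.iarr 6 rfl]) (fun x _ => by rw [F₁.rarr 4 rfl])
        (fun x _ => by rw [F₁.rarr 5 rfl])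
    · rw [q19, q11]
      exact stR'.mono ltR (fun x _ => by rw [F₁.iarr 6 rfl]) (fun x _ => by rw [F₁.rarr 4 rfl])
        (fun x _ => by rw [F₁.rarr 5 rfl])
    · rw [q18, i20]; exact ltL
    · rw [q19, i20]; exact ltR
    · rw [F₁.rvar 2 rfl, h.total]
    · have := hsubE (hS.toFinset_eq ▸ List.mem_toFinset.2 he)
      rw [mem_Ico] at this
      omega
    · rw [solL.toFinset_eq, solR.toFinset_eq]; exact hsep
  rw [h.time] at q4 q5
  rw [h.total] at q5
  have hloop := input.runs_loop hf0 q16 q17 q3 q4 q5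
  rw [i11] at hloop
  refine hloop.seq fun s₂ F₂ m => ?_
  refine (input.runs_densityCmd m (F₂.ivar 18 rfl) (F₂.ivar 19 rfl) (F₂.rvar 2 rfl)).seq
    fun s₃ F₃ ⟨d13, d6, dens⟩ => ?_
  have m := m.toIsWritten
  rw [← hρ] at m d13 d6 dens
  have j14 : s₃.ivar 14 = k := by rw [F₃.ivar 14 rfl, F₂.ivar 14 rfl, r14]
  have j20 : s₃.ivar 20 = s.ivar 20 := by rw [F₃.ivar 20 rfl, F₂.ivar 20 rfl, i20]
  have j11 : s₃.ivar 11 = s.ivar 11 := by rw [F₃.ivar 11 rfl, F₂.ivar 11 rfl, i11]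
  have j2 : s₃.rvar 2 = f (Ico a b) := by
    rw [F₃.rvar 2 rfl, F₂.rvar 2 rfl, F₁.rvar 2 rfl, h.total]
  have env₃ := ((h.env.frame F₁ rfl rfl rfl rfl rfl).frame F₂ rfl rfl rfl rfl rfl).frame F₃
    rfl rfl rfl rfl rfl
  refine (runs_finishCmd env₃ (by omega)).mono le_rfl fun s₄ F₄ ⟨g6, g4, g5, g3⟩ => ?_
  rw [j20, j11, F₃.iarr 6 rfl, j14] at g6
  rw [j20, j11, F₃.rarr 4 rfl] at g4
  rw [j20, j11, F₃.rarr 5 rfl, d13, j2] at g5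
  rw [F₃.rvar 3 rfl, d6, j14] at g3
  have g5' : s₄.rvar 5 = s₃.rvar 5 := F₄.rvar 5 rfl
  set μ := s₃.rvar 5 with hμ
  have hkρ : k ∉ ρ := fun hx => hkLR (hS.toFinset_eq ▸ List.mem_toFinset.2 hx)
  have hjoin := solL'.join (f := f) (supermodular_reward hw) hf0 hLR hkLR hsep
    (by rw [hE]; exact hcE) solR' (μ := μ)
    (fun t ht => by rw [hE]; exact dens.le t (Nat.lt_succ_of_le (ht.trans lenρ.le)))
    (by rw [hE]; exact dens.eq)
  have hsch := solL'.isSchedule_join hLR hkLR solR' μ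
  rw [hE, ← hρ] at hjoin hsch
  have hcost : s₄.rvar 3 = orderCost f c (Ico a b) ((ρ ++ [k]).idxOf ·) := by
    rw [orderCost_idxOf hsch.nodup hsch.toFinset_eq, List.length_append, List.length_singleton,
      sum_range_succ, g3, m.cost, lenρ]
    congr 1
    · refine sum_congr rfl fun u hu => ?_
      have hu := mem_range.1 hu
      rw [List.getD_append _ _ _ _ (by omega), List.take_append_of_le_length (by omega)]
    · rw [List.getD_append_right _ _ _ _ lenρ.le, lenρ, List.take_append_of_le_length lenρ.ge]
      simp
  have m6 := m.edge
  have m4 := m.key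
  have m5 := m.reward
  rw [i20] at m6 m4 m5
  refine ⟨ρ ++ [k], joinKey κ k μ, ⟨hsch, hjoin.2, ⟨fun i hi => ?_, fun i hi => ?_,
    fun i hi => ?_⟩⟩, fun pos hinj hlast => ?_, hcost, by simp [lenρ], ⟨?_, ?_, ?_, ?_⟩⟩
  · rw [List.length_append, List.length_singleton, lenρ] at hi
    rw [g6]
    rcases Nat.lt_succ_iff_lt_or_eq.1 hi with hi | rfl
    · rw [if_neg (by omega), m6 i hi, List.getElem_append_left (by omega),
        List.getD_eq_getElem _ _ (by omega)]
    · rw [if_pos rfl, List.getElem_append_right lenρ.le]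
      simp
  · rw [List.length_append, List.length_singleton, lenρ] at hi
    rw [g4, g5']
    rcases Nat.lt_succ_iff_lt_or_eq.1 hi with hi | rfl
    · have hne : ρ[i] ≠ k := fun hx => hkρ (hx ▸ List.getElem_mem _)
      rw [if_neg (by omega), m4 i hi, List.getElem_append_left (by omega),
        List.getD_eq_getElem _ _ (by omega), joinKey, if_neg hne]
    · rw [if_pos rfl, List.getElem_append_right lenρ.le]
      simp [joinKey]
  · rw [List.length_append, List.length_singleton, lenρ] at hi
    rw [g5]
    rcases Nat.lt_succ_iff_lt_or_eq.1 (Nat.lt_succ_of_le hi) with hi | rfl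
    · rw [if_neg (by omega), List.take_append_of_le_length (by omega)]
      rcases Nat.lt_succ_iff_lt_or_eq.1 hi with hi | rfl
      · rw [if_neg (by omega), m5 i hi]
      · rw [if_pos rfl]
    · rw [if_pos (by omega), List.take_of_length_le (by simp [lenρ]), hsch.toFinset_eq]
  · rw [hcost]
    refine hjoin.1 pos (by simpa using hinj) fun x hx => ?_
    rw [hkdef]
    refine hlast x (hsubE hx) fun hxk => hkLR ?_
    exact (hxk.trans hkdef.symm) ▸ hx
  · rw [F₄.ivar 20 rfl, j20]
  · intro x hx
    rw [g6, if_neg (by omega), m.edge_old x (by omega), F₁.iarr 6 rfl]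
  · intro x hx
    rw [g4, if_neg (by omega), m.key_old x (by omega), F₁.rarr 4 rfl]
  · intro x hx
    rw [g5, if_neg (by omega), if_neg (by omega), m.reward_old x (by omega), F₁.rarr 5 rfl]

end PathProgram

/-! ### The program: dynamic programming over the intervals -/

namespace PathProgram

open RealRAM SupermodularScheduling Finset

/-- Keep the new candidate if it is the first or the best one so far, and allocate its storage. -/
def compareCmd : Cmd :=
  .seq (.ite (.not (.and (.not (.ieq (.var 13) (.const 0))) (.not (.rle (.var 3) (.var 7)))))
    (.seq (.rset 7 (.var 3)) <| .seq (.iput 5 (tableExp (.var 12) (.var 10)) (.var 20))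
      (.rput 6 (tableExp (.var 12) (.var 10)) (.var 5))) .skip)
    (.iset 20 (.add (.add (.var 20) (.var 11)) (.const 2)))

theorem runs_compareCmd (s : State) :
    Runs compareCmd s 60 fun s' =>
      s'.ivar 20 = s.ivar 20 + s.ivar 11 + 2 ∧
      ((s.ivar 13 = 0 ∨ s.rvar 3 ≤ s.rvar 7) → s'.rvar 7 = s.rvar 3 ∧
        (∀ x, s'.iarr 5 x = if x = s.iarr 3 (s.ivar 12) + s.ivar 10 then s.ivar 20
          else s.iarr 5 x) ∧
        (∀ x, s'.rarr 6 x = if x = s.iarr 3 (s.ivar 12) + s.ivar 10 then s.rvar 5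
          else s.rarr 6 x)) ∧
      (¬ (s.ivar 13 = 0 ∨ s.rvar 3 ≤ s.rvar 7) → s'.rvar 7 = s.rvar 7 ∧
        s'.iarr 5 = s.iarr 5 ∧ s'.rarr 6 = s.rarr 6) := by
  refine Cmd.wp.runs ?_ (by decide)
  simp only [compareCmd, tableExp, Cmd.wp, RExp.eval, IExp.eval, BExp.holds]
  have hiff : (¬ (¬ s.ivar 13 = 0 ∧ ¬ s.rvar 3 ≤ s.rvar 7)) ↔
      (s.ivar 13 = 0 ∨ s.rvar 3 ≤ s.rvar 7) := by tauto
  rw [hiff]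
  refine ⟨fun h v1 h1 p v2 hp h2 q v3 hq h3 v4 h4 => ?_, fun h v4 h4 => ?_⟩
  · simp at h1 h2 h3 h4 hp hq
    subst h1 h2 h3 h4 hp hq
    refine ⟨by simp, fun _ => ⟨by simp, fun x => by simp, fun x => by simp⟩,
      fun h' => absurd h h'⟩
  · subst h4
    exact ⟨by simp, fun h' => absurd h' h, fun _ => ⟨by simp, by simp, by simp⟩⟩

/-- Choose the last edge of the interval `(a, b)`. -/
def chooseCmd : Cmd := .for 13 (.add (.var 11) (.const 1)) (.seq candidateCmd compareCmd)

/-- After `h` choices of the last edge, the best schedule so far is stored for `(a, b)`. -/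
structure IsChoiceState (n : ℕ) (c : ℕ → ℝ) (w : ℕ → ℕ → ℝ) (a b : ℕ) (s₀ : State) (h : ℕ)
    (s : State) : Prop where
  extend : IsExtension s₀ s
  address_old : ∀ x, x ≠ a * n + b → s.iarr 5 x = s₀.iarr 5 x
  key_old : ∀ x, x ≠ a * n + b → s.rarr 6 x = s₀.rarr 6 x
  best : 0 < h → ∃ σ κ,
    IsCandidate n c w a b s (s.iarr 5 (a * n + b)) (s.rarr 6 (a * n + b)) σ κ ∧
    s.iarr 5 (a * n + b) + σ.length < s.ivar 20 ∧
    s.rvar 7 = orderCost (reward n w) c (Ico a b) (σ.idxOf ·) ∧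
    ∀ k, a ≤ k → k < a + h → ∀ pos, Set.InjOn pos (Ico a b) →
      (∀ x ∈ Ico a b, x ≠ k → pos x < pos k) →
        s.rvar 7 ≤ orderCost (reward n w) c (Ico a b) pos

theorem address_inj {n a b a' b' : ℕ} (hb : b < n) (hb' : b' < n)
    (h : a * n + b = a' * n + b') : a = a' ∧ b = b' := by
  have h1 : (a * n + b) % n = b := by
    rw [mul_comm, Nat.mul_add_mod, Nat.mod_eq_of_lt hb]
  have h2 : (a' * n + b') % n = b' := by
    rw [mul_comm, Nat.mul_add_mod, Nat.mod_eq_of_lt hb']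
  have hbb : b = b' := by rw [← h1, ← h2, h]
  subst hbb
  exact ⟨Nat.eq_of_mul_eq_mul_right (by omega) (Nat.add_right_cancel h), rfl⟩

theorem IsCandidate.mono {n : ℕ} {c : ℕ → ℝ} {w : ℕ → ℕ → ℝ} {a b : ℕ} {s s' : State} {p : ℕ}
    {lam : ℝ} {σ : List ℕ} {κ : ℕ → ℝ} (h : IsCandidate n c w a b s p lam σ κ)
    (hp : p + σ.length < s.ivar 20) (he : IsExtension s s') :
    IsCandidate n c w a b s' p lam σ κ :=
  ⟨h.schedule, h.solved, h.stored.mono hp he.edge he.key he.reward⟩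

theorem IsIntervalState.runs_chooseCmd {n : ℕ} {c : ℕ → ℝ} {w : ℕ → ℕ → ℝ} {a b : ℕ} {s₀ : State}
    (hw : ∀ v < n, ∀ u < v, 0 ≤ w u v) (hc : ∀ e, e + 1 < n → 0 < c e)
    (h₀ : IsIntervalState n c w a b s₀) :
    Runs chooseCmd s₀ ((s₀.ivar 11 + 1 + 1) * (300 + (s₀.ivar 11 + 1) * 231 + 3 + 10)) fun s =>
      HasSlot n c w s a b ∧ IsExtension s₀ s ∧
      (∀ x, x ≠ a * n + b → s.iarr 5 x = s₀.iarr 5 x) ∧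
      ∀ x, x ≠ a * n + b → s.rarr 6 x = s₀.rarr 6 x := by
  have hab := h₀.lt
  have hbn := h₀.lt_num
  have hwidth := h₀.width
  refine (Runs.for (N := s₀.ivar 11 + 1) (T := 300 + (s₀.ivar 11 + 1) * 231)
    (IsChoiceState n c w a b s₀) rfl (fun s F => ?_) ?_ fun i hi s F h13 hs => ?_).mono le_rfl
    fun s F hs => ?_
  · simp only [IExp.eval, F.ivar 11 rfl]
  · exact ⟨⟨by simp, by simp, by simp, by simp⟩, by simp, by simp, by simp⟩
  · have e11 : s.ivar 11 = s₀.ivar 11 := F.ivar 11 rfl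
    have hold : ∀ a' b', (a', b') ≠ (a, b) → b' < n → HasSlot n c w s₀ a' b' →
        HasSlot n c w s a' b' := by
      intro a' b' hne hb' hslot
      have hadd : a' * n + b' ≠ a * n + b := fun h => hne (by
        obtain ⟨rfl, rfl⟩ := address_inj hb' hbn h; rfl)
      exact hslot.extend hs.extend (hs.address_old _ hadd) (hs.key_old _ hadd)
    have hint : IsIntervalState n c w a b s :=
      ⟨h₀.env.frame F rfl rfl rfl rfl rfl, hab, hbn, (F.ivar 10 rfl).trans h₀.right_end,
        (F.ivar 12 rfl).trans h₀.left_end, e11.trans hwidth, (F.rvar 1 rfl).trans h₀.time,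
        (F.rvar 2 rfl).trans h₀.total,
        fun k hk hk' => hold a k (fun h => by simp at h; omega) (by omega) (h₀.slot_left k hk hk'),
        fun k hk hk' => hold (k + 1) b (fun h => by simp at h; omega) hbn
          (h₀.slot_right k hk hk')⟩
    have hbound : 300 + (s₀.ivar 11 + 1) * 231 = 240 + (s.ivar 11 + 1) * 231 + 60 := by
      rw [e11]; ring
    rw [hbound]
    refine (hint.runs_candidateCmd hw hc (by omega)).seq
      fun s₁ F₁ ⟨σ, κ, cand, lower, hcost, hlen, ext⟩ => ?_
    refine (runs_compareCmd s₁).mono le_rfl fun s₂ F₂ ⟨q20, qyes, qno⟩ => ?_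
    rw [h13] at lower
    have e20 : s₁.ivar 20 = s.ivar 20 := F₁.ivar 20 rfl
    have e13 : s₁.ivar 13 = i := (F₁.ivar 13 rfl).trans h13
    have e11' : s₁.ivar 11 = s.ivar 11 := F₁.ivar 11 rfl
    have e7 : s₁.rvar 7 = s.rvar 7 := F₁.rvar 7 rfl
    have eaddr : s₁.iarr 3 (s₁.ivar 12) + s₁.ivar 10 = a * n + b := by
      rw [F₁.iarr 3 rfl, F₁.ivar 12 rfl, F₁.ivar 10 rfl, hint.left_end, hint.right_end,
        hint.env.row a (by omega)]
    rw [eaddr, e13, e7] at qyes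
    rw [e13, e7] at qno
    have ext₂ : IsExtension s₁ s₂ :=
      ⟨by omega, fun x _ => by rw [F₂.iarr 6 rfl], fun x _ => by rw [F₂.rarr 4 rfl],
        fun x _ => by rw [F₂.rarr 5 rfl]⟩
    have ext' : IsExtension s₀ s₂ := (hs.extend.trans ext).trans ext₂
    have ext'' : IsExtension s s₂ := ext.trans ext₂
    by_cases hcase : i = 0 ∨ s₁.rvar 3 ≤ s.rvar 7
    · obtain ⟨r7, r5, r6⟩ := qyes hcase
      refine ⟨⟨ext'.1, ext'.2, ext'.3, ext'.4⟩, fun x hx => ?_, fun x hx => ?_,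
        fun _ => ⟨σ, κ, ?_, ?_, ?_, fun k hk hk' pos hpos hlast => ?_⟩⟩
      · simp only [setIvar_iarr]
        rw [r5, if_neg hx, F₁.iarr 5 rfl, hs.address_old x hx]
      · simp only [setIvar_rarr]
        rw [r6, if_neg hx, F₁.rarr 6 rfl, hs.key_old x hx]
      · simp only [setIvar_iarr, setIvar_rarr]
        rw [r5, r6, if_pos rfl, if_pos rfl, e20]
        refine ⟨cand.schedule, cand.solved, ?_⟩
        refine cand.stored.mono (q := s₂.ivar 20) (by omega) (fun x _ => ?_) (fun x _ => ?_)
          (fun x _ => ?_)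
        · simp [F₂.iarr 6 rfl]
        · simp [F₂.rarr 4 rfl]
        · simp [F₂.rarr 5 rfl]
      · simp only [setIvar_iarr, setIvar_ivar]
        rw [r5, if_pos rfl]
        simp
        omega
      · simp only [setIvar_rvar]
        rw [r7, hcost]
      · simp only [setIvar_rvar]
        rw [r7]
        rcases Nat.lt_succ_iff_lt_or_eq.1 (show k < (a + i) + 1 by omega) with hk' | rfl
        · rcases hcase with rfl | hle
          · omega
          · obtain ⟨_, _, _, _, _, hbest⟩ := hs.best (by omega)
            exact hle.trans (hbest k hk hk' pos hpos hlast)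
        · exact lower pos hpos hlast
    · obtain ⟨r7, r5, r6⟩ := qno hcase
      rw [not_or, not_le] at hcase
      obtain ⟨σ', κ', cand', hlt', hcost', hbest⟩ := hs.best (by omega)
      have a5 : s₂.iarr 5 = s.iarr 5 := r5.trans (F₁.iarr 5 rfl)
      have a6 : s₂.rarr 6 = s.rarr 6 := r6.trans (F₁.rarr 6 rfl)
      refine ⟨⟨ext'.1, ext'.2, ext'.3, ext'.4⟩, fun x hx => ?_, fun x hx => ?_,
        fun _ => ⟨σ', κ', ?_, ?_, ?_, fun k hk hk' pos hpos hlast => ?_⟩⟩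
      · simp only [setIvar_iarr]
        rw [a5, hs.address_old x hx]
      · simp only [setIvar_rarr]
        rw [a6, hs.key_old x hx]
      · simp only [setIvar_iarr, setIvar_rarr]
        rw [a5, a6]
        exact cand'.mono hlt' ⟨ext''.1, ext''.2, ext''.3, ext''.4⟩
      · simp only [setIvar_iarr, setIvar_ivar]
        rw [a5]
        have := ext''.free_le
        simp
        omega
      · simp only [setIvar_rvar]
        rw [r7, hcost']
      · simp only [setIvar_rvar]
        rw [r7]
        rcases Nat.lt_succ_iff_lt_or_eq.1 (show k < (a + i) + 1 by omega) with hk' | rfl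
        · exact hbest k hk hk' pos hpos hlast
        · exact hcase.2.le.trans (lower pos hpos hlast)
  · obtain ⟨σ, κ, cand, hlt, hcost, hbest⟩ := hs.best (by omega)
    refine ⟨⟨σ, κ, cand.solved ⟨cand.schedule.injOn, fun pos hpos => ?_⟩, cand.stored, hlt⟩,
      hs.extend, hs.address_old, hs.key_old⟩
    rw [← hcost]
    -- every order has a last edge
    obtain ⟨k, hk, hmax⟩ := exists_max_image (Ico a b) pos ⟨a, mem_Ico.2 ⟨le_rfl, hab⟩⟩
    have hk' := mem_Ico.1 hk
    exact hbest k hk'.1 (by omega) pos hpos fun x hx hxk =>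
      lt_of_le_of_ne (hmax x hx) fun h => hxk (hpos hx hk h)

/-- Extend the interval `(a + 1, b)` to `(a, b)`, where `a = b - (l + 1)`, and solve it. Real
variables 0 and 1 hold the weight between `b` and the other vertices of the interval, and the
length of the interval; real array 3 holds the total weight within it. -/
def intervalCmd : Cmd :=
  .seq (.iset 12 (.sub (.var 10) (.add (.var 11) (.const 1)))) <|
  .seq (.rset 0 (.add (.var 0) (weightExp (.var 12) (.var 10)))) <|
  .seq (.rset 1 (.add (.var 1) (lenExp (.var 12)))) <|
  .seq (.rput 3 (.var 12) (.add (.get 3 (.var 12)) (.var 0))) <|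
  .seq (.rset 2 (.get 3 (.var 12))) chooseCmd

/-- Solve all intervals with the right end `b`. -/
def rowCmd : Cmd :=
  .seq (.rset 0 (.const 0)) <| .seq (.rset 1 (.const 0)) (.for 11 (.var 10) intervalCmd)

/-- Solve all intervals. The first free address is 1: the empty intervals share the address 0,
which all entries of index array 5 contain initially. -/
def intervalsCmd : Cmd := .seq (.iset 20 (.const 1)) (.for 10 (.var 0) rowCmd)

/-- All intervals with a right end less than `b`, and those with the right end `b` and length at
most `l`, have been solved. -/
structure IsRowState (n : ℕ) (c : ℕ → ℝ) (w : ℕ → ℕ → ℝ) (b l : ℕ) (s : State) : Prop where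
  env : IsEnv n c w s
  slot : ∀ a' b', a' ≤ b' → b' < n → (b' < b ∨ a' = b' ∨ b' = b ∧ b - l ≤ a') →
    HasSlot n c w s a' b'
  weight : s.rvar 0 = ∑ u ∈ Ico (b - l) b, w u b
  time : s.rvar 1 = ∑ u ∈ Ico (b - l) b, c u
  total : ∀ a', s.rarr 3 a' =
    if b - l ≤ a' then reward n w (Ico a' b) else reward n w (Ico a' (b - 1))

theorem HasSlot.setIvar {n : ℕ} {c : ℕ → ℝ} {w : ℕ → ℕ → ℝ} {s : State} {a b x v : ℕ}
    (h : HasSlot n c w s a b) (hx : x ≠ 20) : HasSlot n c w (s.setIvar x v) a b :=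
  h.extend ⟨by simp [hx.symm], by simp, by simp, by simp⟩ (by simp) (by simp)

theorem IsEnv.setIvar {n : ℕ} {c : ℕ → ℝ} {w : ℕ → ℕ → ℝ} {s : State} {x v : ℕ}
    (h : IsEnv n c w s) (hx : x ≠ 0) : IsEnv n c w (s.setIvar x v) :=
  ⟨by simpa [hx.symm] using h.num, by simpa using h.row, by simpa using h.len,
    by simpa using h.weight⟩

theorem IsRowState.setIvar {n : ℕ} {c : ℕ → ℝ} {w : ℕ → ℕ → ℝ} {b l : ℕ} {s : State} {x v : ℕ}
    (h : IsRowState n c w b l s) (hx : x ≠ 0) (hx' : x ≠ 20) :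
    IsRowState n c w b l (s.setIvar x v) :=
  ⟨h.env.setIvar hx, fun a' b' h1 h2 h3 => (h.slot a' b' h1 h2 h3).setIvar hx', h.weight, h.time,
    h.total⟩

theorem IsRowState.runs_intervalCmd {n : ℕ} {c : ℕ → ℝ} {w : ℕ → ℕ → ℝ} {b l : ℕ} {s : State}
    (hw : ∀ v < n, ∀ u < v, 0 ≤ w u v) (hc : ∀ e, e + 1 < n → 0 < c e)
    (h : IsRowState n c w b l s) (hl : l < b) (hb : b < n) (h10 : s.ivar 10 = b)
    (h11 : s.ivar 11 = l) :
    Runs intervalCmd s (1200 * n ^ 2) (IsRowState n c w b (l + 1)) := by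
  obtain ⟨a, ha⟩ : ∃ a, a = b - (l + 1) := ⟨_, rfl⟩
  have hab : a < b := by omega
  have hba : b - l = a + 1 := by omega
  have hprep : ∀ T Q, (∀ s₁ : State, s₁.ivar 12 = a → s₁.rvar 0 = ∑ u ∈ Ico a b, w u b →
      s₁.rvar 1 = ∑ u ∈ Ico a b, c u → s₁.rvar 2 = reward n w (Ico a b) →
      (∀ x, s₁.rarr 3 x = if x = a then reward n w (Ico a b) else s.rarr 3 x) →
      (∀ x ≠ 12, s₁.ivar x = s.ivar x) → s₁.iarr = s.iarr → (∀ x ≠ 3, s₁.rarr x = s.rarr x) →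
      Runs chooseCmd s₁ T Q) → Runs intervalCmd s (80 + T) Q := by
    intro T Q hQ
    have hwt : s.rvar 0 + w a b = ∑ u ∈ Ico a b, w u b := by
      rw [h.weight, hba, sum_eq_sum_Ico_succ_bot hab, add_comm]
    have htm : s.rvar 1 + c a = ∑ u ∈ Ico a b, c u := by
      rw [h.time, hba, sum_eq_sum_Ico_succ_bot hab, add_comm]
    have htt : s.rarr 3 a + ∑ u ∈ Ico a b, w u b = reward n w (Ico a b) := by
      rw [h.total, if_neg (by omega)]
      obtain ⟨b', rfl⟩ : ∃ b', b = b' + 1 := ⟨b - 1, by omega⟩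
      exact (reward_Ico_succ w hb).symm
    have hpre : Runs (.seq (.iset 12 (.sub (.var 10) (.add (.var 11) (.const 1)))) <|
        .seq (.rset 0 (.add (.var 0) (weightExp (.var 12) (.var 10)))) <|
        .seq (.rset 1 (.add (.var 1) (lenExp (.var 12)))) <|
        .seq (.rput 3 (.var 12) (.add (.get 3 (.var 12)) (.var 0)))
          (.rset 2 (.get 3 (.var 12)))) s 80 fun s₁ =>
        s₁.ivar 12 = a ∧ s₁.rvar 0 = ∑ u ∈ Ico a b, w u b ∧
        s₁.rvar 1 = ∑ u ∈ Ico a b, c u ∧ s₁.rvar 2 = reward n w (Ico a b) ∧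
        (∀ x, s₁.rarr 3 x = if x = a then reward n w (Ico a b) else s.rarr 3 x) ∧
        (∀ x ≠ 12, s₁.ivar x = s.ivar x) ∧ s₁.iarr = s.iarr ∧
        (∀ x ≠ 3, s₁.rarr x = s.rarr x) := by
      refine Cmd.wp.runs ?_ (by decide)
      simp only [weightExp, lenExp, Cmd.wp, RExp.eval, IExp.eval]
      intro v1 h1 v2 h2 v3 h3 p v4 hp h4 v5 h5
      simp only [h10, h11, ← ha] at h1
      subst h1
      simp at h2 h3 hp h4 h5
      rw [h10, h.env.weight b hb v1 hab, hwt] at h2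
      rw [h.env.len v1 (by omega), htm] at h3
      rw [h2, htt] at h4
      rw [hp, if_pos rfl, h4] at h5
      subst h2 h3 hp h4 h5
      refine ⟨by simp, by simp, by simp, by simp, fun x => by simp, fun x hx => by simp [hx],
        by simp, fun x hx => ?_⟩
      funext j
      simp [hx]
    obtain ⟨t, s₁, hex, ht, q1, q2, q3, q4, q5, q6, q7, q8⟩ := hpre
    obtain ⟨t', s₂, hex', ht', hq⟩ := hQ s₁ q1 q2 q3 q4 q5 q6 q7 q8
    -- the program brackets this sequence differently
    rcases hex with _ | _ | _ | _ | _ | ⟨e1, e2⟩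
    rcases e2 with _ | _ | _ | _ | _ | ⟨e2, e3⟩
    rcases e3 with _ | _ | _ | _ | _ | ⟨e3, e4⟩
    rcases e4 with _ | _ | _ | _ | _ | ⟨e4, e5⟩
    exact ⟨_, s₂, .seq e1 (.seq e2 (.seq e3 (.seq e4 (.seq e5 hex')))), by omega, hq⟩
  have hbound : 80 + (l + 1 + 1) * (300 + (l + 1) * 231 + 3 + 10) ≤ 1200 * n ^ 2 := by
    have : l + 2 ≤ n := by omega
    nlinarith
  refine (hprep _ _ fun s₁ q12 q0 q1 q2 q3 qi qia qra => ?_).mono hbound fun _ _ h => h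
  have env₁ : IsEnv n c w s₁ := by
    refine ⟨by rw [qi 0 (by decide), h.env.num], ?_, ?_, ?_⟩
    · rw [qia]; exact h.env.row
    · rw [qia, qra 0 (by decide)]; exact h.env.len
    · rw [qia, qra 1 (by decide)]; exact h.env.weight
  have hslot : ∀ a' b', HasSlot n c w s a' b' → HasSlot n c w s₁ a' b' := fun a' b' hs =>
    hs.extend ⟨by rw [qi 20 (by decide)], fun x _ => by rw [qia],
      fun x _ => by rw [qra 4 (by decide)], fun x _ => by rw [qra 5 (by decide)]⟩
      (by rw [qia]) (by rw [qra 6 (by decide)])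
  have e11 : s₁.ivar 11 = l := by rw [qi 11 (by decide), h11]
  have hint : IsIntervalState n c w a b s₁ :=
    ⟨env₁, hab, hb, by rw [qi 10 (by decide), h10], q12, by omega, q1, q2,
      fun k hk hk' => hslot _ _ (h.slot a k hk (by omega) (by omega)),
      fun k hk hk' => hslot _ _ (h.slot (k + 1) b hk' hb (by omega))⟩
  have hch := hint.runs_chooseCmd hw hc
  rw [e11] at hch
  refine hch.mono le_rfl fun s₂ F ⟨hnew, hext, h5, h6⟩ => ?_
  refine ⟨env₁.frame F rfl rfl rfl rfl rfl, fun a' b' hab' hb' hcond => ?_, ?_, ?_, fun a' => ?_⟩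
  · by_cases hne : a' = a ∧ b' = b
    · obtain ⟨rfl, rfl⟩ := hne
      exact hnew
    · have hadd : a' * n + b' ≠ a * n + b := fun he => hne (address_inj hb' hb he)
      exact (hslot a' b' (h.slot a' b' hab' hb' (by omega))).extend hext (h5 _ hadd) (h6 _ hadd)
  · rw [F.rvar 0 rfl, q0, ha]
  · rw [F.rvar 1 rfl, q1, ha]
  · rw [F.rarr 3 rfl, q3, h.total]
    by_cases haa : a' = a
    · rw [if_pos haa, if_pos (by omega), haa]
    · rw [if_neg haa]
      by_cases hle : b - l ≤ a'
      · rw [if_pos hle, if_pos (by omega)]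
      · rw [if_neg hle, if_neg (by omega)]

/-- The initial contents of the storage that the dynamic program uses. -/
structure IsBlank (s : State) : Prop where
  address : ∀ x, s.iarr 5 x = 0
  reward : s.rarr 5 0 = 0
  total : ∀ x, s.rarr 3 x = 0

theorem isSolved_empty {f : Finset ℕ → ℝ} (hf : f ∅ = 0) (c : ℕ → ℝ) (κ : ℕ → ℝ) :
    IsSolved f c ∅ [] κ where
  nodup := by simp
  toFinset_eq := by simp
  sorted := by simp
  optimal := ⟨by simp, fun _ _ => by simp [orderCost]⟩
  isKey := ⟨fun A hA => by rw [subset_empty.1 hA]; simp [hf], by simp [hf], by simp [hf]⟩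

theorem runs_intervalsCmd {n : ℕ} {c : ℕ → ℝ} {w : ℕ → ℕ → ℝ} {s : State}
    (hw : ∀ v < n, ∀ u < v, 0 ≤ w u v) (hc : ∀ e, e + 1 < n → 0 < c e) (hn : 0 < n)
    (hs : IsEnv n c w s) (hblank : IsBlank s) :
    Runs intervalsCmd s (2700 * n ^ 4) fun s' => HasSlot n c w s' 0 (n - 1) := by
  have hbound : 2 + (n + 1) * (1300 * n ^ 3 + 11) ≤ 2700 * n ^ 4 := by
    have h3 : 1 ≤ n ^ 3 := Nat.one_le_pow _ _ hn
    have h4 : n ^ 4 = n * n ^ 3 := by ring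
    rw [h4]
    nlinarith
  have hset : Runs (.iset 20 (.const 1)) s 2 fun s' => s' = s.setIvar 20 1 :=
    Cmd.wp.runs (fun v hv => by rw [hv]; rfl) (by decide)
  refine (hset.seq fun s₁ F₁ hs₁ => ?_).mono hbound fun _ _ h => h
  have env₁ : IsEnv n c w s₁ := hs.frame F₁ rfl rfl rfl rfl rfl
  have hf0 : reward n w ∅ = 0 := reward_empty n w
  -- a right end `b` corresponds to the row state in which no interval ending at `b` is solved
  refine (Runs.forVar (T := 1300 * n ^ 3)
    (fun b s' => IsEnv n c w s' ∧
      (∀ a' b', a' ≤ b' → b' < n → (b' < b ∨ a' = b') → HasSlot n c w s' a' b') ∧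
      ∀ a', s'.rarr 3 a' = reward n w (Ico a' (b - 1)))
    rfl rfl env₁.num ?_
    fun b hb s' F h10 ⟨henv, hslot, htot⟩ => ?_).mono le_rfl fun s' F ⟨_, hslot, _⟩ => ?_
  · refine ⟨env₁.setIvar (by decide), fun a' b' _ hb' hcond => ?_, fun a' => ?_⟩
    · obtain rfl : a' = b' := by omega
      refine HasSlot.setIvar ⟨[], fun _ => 0, ?_, ⟨by simp, by simp, ?_⟩, ?_⟩ (by decide)
      · rw [Ico_self]; exact isSolved_empty hf0 c _
      · intro i hi
        obtain rfl : i = 0 := by simpa using hi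
        simp [hs₁, hblank.address, hblank.reward, hf0]
      · simp [hs₁, hblank.address]
    · simp [hs₁, hblank.total, hf0]
  · have hinit : Runs (.seq (.rset 0 (.const 0)) (.rset 1 (.const 0))) s' 4 fun s₂ =>
        s₂ = (s'.setRvar 0 0).setRvar 1 0 := by
      refine Cmd.wp.runs ?_ (by decide)
      intro v hv u hu
      rw [hv, hu]
      simp [RExp.eval]
    have hrow : ∀ s₂ : State, s₂ = (s'.setRvar 0 0).setRvar 1 0 →
        Runs (.for 11 (.var 10) intervalCmd) s₂ ((b + 1) * (1200 * n ^ 2 + 11))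
          (IsRowState n c w b b) := by
      intro s₂ hs₂
      have hst : IsRowState n c w b 0 s₂ := by
        subst hs₂
        refine ⟨⟨by simpa using henv.num, by simpa using henv.row, by simpa using henv.len,
          by simpa using henv.weight⟩, fun a' b' h1 h2 h3 => ?_, by simp, by simp, fun a' => ?_⟩
        · exact (hslot a' b' h1 h2 (by omega)).extend
            ⟨by simp, by simp, by simp, by simp⟩ (by simp) (by simp)
        · simp only [setRvar_rarr, htot, Nat.sub_zero]
          split_ifs with h
          · rw [Ico_eq_empty (by omega), Ico_eq_empty (by omega)]
          · rfl
      have e10 : s₂.ivar 10 = b := by rw [hs₂]; simpa using h10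
      refine Runs.forVar (IsRowState n c w b) rfl rfl e10
        (hst.setIvar (by decide) (by decide)) fun l hl s₃ F₃ h11 hst₃ => ?_
      exact (hst₃.runs_intervalCmd hw hc hl hb ((F₃.ivar 10 rfl).trans e10) h11).mono le_rfl
        fun s₄ F₄ h => h.setIvar (by decide) (by decide)
    obtain ⟨t, s₂, hex, ht, hq⟩ := hinit
    obtain ⟨t', s₃, hex', ht', hq'⟩ := hrow s₂ hq
    rcases hex with _ | _ | _ | _ | _ | ⟨e1, e2⟩
    have hle : (b + 1) * (1200 * n ^ 2 + 11) + 4 ≤ 1300 * n ^ 3 := by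
      have h1 : (b + 1) * (1200 * n ^ 2 + 11) ≤ n * (1200 * n ^ 2 + 11) :=
        Nat.mul_le_mul_right _ hb
      have h2 : n ≤ n ^ 3 := Nat.le_self_pow (by decide) n
      have h3 : n * (1200 * n ^ 2 + 11) = 1200 * n ^ 3 + 11 * n := by ring
      omega
    refine ⟨_, s₃, .seq e1 (.seq e2 hex'), by omega, hq'.env.setIvar (by decide),
      fun a' b' h1 h2 h3 => ?_, fun a' => ?_⟩
    · exact (hq'.slot a' b' h1 h2 (by omega)).setIvar (by decide)
    · simp [hq'.total]
  · exact hslot 0 (n - 1) (by omega) (by omega) (by omega)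

end PathProgram

/-! ### The program: reading the path and writing the result -/

namespace PathProgram

open RealRAM SupermodularScheduling Finset

/-- Put the multiples of `n` into index array 3. -/
def multiplesCmd : Cmd :=
  .for 2 (.var 0) (.seq (.iput 3 (.var 2) (.var 3)) (.iset 3 (.add (.var 3) (.var 0))))

/-- Put a vertex of degree at most one into index variable 6. -/
def endpointCmd : Cmd :=
  .for 2 (.var 0) <| .seq (.iset 5 (.const 0)) <|
    .seq (.for 4 (.var 0) (.iset 5 (.add (.var 5) (.get 0 (.add (.get 3 (.var 2)) (.var 4))))))
      (.ite (.ile (.var 5) (.const 1)) (.iset 6 (.var 2)) .skip)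

/-- Put the neighbour of the vertex in index variable 6 that differs from the vertex in index
variable 7 into index variable 8. -/
def neighbourCmd : Cmd :=
  .for 4 (.var 0) (.ite (.and (.ieq (.get 0 (.add (.get 3 (.var 6)) (.var 4))) (.const 1))
    (.not (.ieq (.var 4) (.var 7)))) (.iset 8 (.var 4)) .skip)

/-- Follow the path from the vertex in index variable 6, and put its vertices into index array 4.
Index variable 7 holds the previous vertex, and at the beginning `n`, which is no vertex. -/
def walkCmd : Cmd :=
  .seq (.iset 7 (.var 0)) <| .for 2 (.var 0) <|
    .seq (.seq (.iput 4 (.var 2) (.var 6)) (.iset 8 (.var 6))) <|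
      .seq neighbourCmd (.seq (.iset 7 (.var 6)) (.iset 6 (.var 8)))

/-- Read the path. -/
def readCmd : Cmd := .seq multiplesCmd <| .seq endpointCmd walkCmd

/-- The numbers `φ 0, …, φ (n - 1)` are the vertices `0, …, n - 1` of a path with the adjacency
relation `A`, in the order along the path. -/
structure IsPathLabel (n : ℕ) (A : ℕ → ℕ → Prop) (φ : ℕ → ℕ) : Prop where
  lt : ∀ i < n, φ i < n
  inj : ∀ i < n, ∀ j < n, φ i = φ j → i = j
  surj : ∀ v < n, ∃ i < n, φ i = v
  adj : ∀ i < n, ∀ j < n, A (φ i) (φ j) ↔ i + 1 = j ∨ j + 1 = i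

theorem IsPathLabel.reverse {n : ℕ} {A : ℕ → ℕ → Prop} {φ : ℕ → ℕ} (h : IsPathLabel n A φ) :
    IsPathLabel n A fun i => φ (n - 1 - i) where
  lt i hi := h.lt _ (by omega)
  inj i hi j hj hij := by
    have := h.inj _ (by omega) _ (by omega) hij
    omega
  surj v hv := by
    obtain ⟨i, hi, rfl⟩ := h.surj v hv
    exact ⟨n - 1 - i, by omega, by congr 1; omega⟩
  adj i hi j hj := by
    rw [h.adj _ (by omega) _ (by omega)]
    omega

open Classical in
/-- The number of neighbours of `u` among `0, …, i - 1`. -/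
noncomputable def degreeBelow (A : ℕ → ℕ → Prop) (u i : ℕ) : ℕ :=
  ∑ v ∈ range i, if A u v then 1 else 0

theorem IsPathLabel.degree_first_le {n : ℕ} {A : ℕ → ℕ → Prop} {φ : ℕ → ℕ}
    (h : IsPathLabel n A φ) (hn : 0 < n) : degreeBelow A (φ 0) n ≤ 1 := by
  classical
  unfold degreeBelow
  rw [sum_boole, Nat.cast_id, card_le_one]
  intro u hu v hv
  simp only [mem_filter, mem_range] at hu hv
  obtain ⟨i, hi, rfl⟩ := h.surj u hu.1
  obtain ⟨j, hj, rfl⟩ := h.surj v hv.1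
  have h1 := (h.adj 0 hn i hi).1 hu.2
  have h2 := (h.adj 0 hn j hj).1 hv.2
  congr 1
  omega

theorem IsPathLabel.exists_first {n : ℕ} {A : ℕ → ℕ → Prop} {φ : ℕ → ℕ} {u : ℕ}
    (h : IsPathLabel n A φ) (hu : u < n) (hdeg : degreeBelow A u n ≤ 1) :
    ∃ ψ, IsPathLabel n A ψ ∧ ψ 0 = u := by
  classical
  obtain ⟨i, hi, rfl⟩ := h.surj u hu
  by_cases h0 : i = 0
  · exact ⟨φ, h, by rw [h0]⟩
  by_cases h1 : i = n - 1
  · exact ⟨_, h.reverse, by simp [h1]⟩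
  exfalso
  unfold degreeBelow at hdeg
  rw [sum_boole, Nat.cast_id, card_le_one] at hdeg
  have := hdeg (φ (i - 1)) (by simp [h.lt (i - 1) (by omega), h.adj i hi (i - 1) (by omega)]; omega)
    (φ (i + 1)) (by simp [h.lt (i + 1) (by omega), h.adj i hi (i + 1) (by omega)])
  have := h.inj _ (by omega) _ (by omega) this
  omega

theorem runs_multiplesCmd {n : ℕ} {s : State} (h0 : s.ivar 0 = n) (h3 : s.ivar 3 = 0) :
    Runs multiplesCmd s ((n + 1) * 20) fun s' => ∀ u < n, s'.iarr 3 u = u * n := by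
  refine (Runs.forVar (T := 9)
    (fun i s' => s'.ivar 3 = i * n ∧ ∀ u < i, s'.iarr 3 u = u * n) rfl rfl h0
    ⟨by simp [h3], by simp⟩
    fun i hi s' F h2 ⟨hacc, hrow⟩ => ?_).mono le_rfl fun s' F h => h.2
  have e0 : s'.ivar 0 = n := (F.ivar 0 rfl).trans h0
  refine Cmd.wp.runs ?_ (by decide)
  simp only [Cmd.wp, IExp.eval]
  intro p v hp hv u hu
  simp only [setIarr_ivar, hacc, e0] at hp hv hu
  rw [h2] at hp
  subst hp hv hu
  refine ⟨by simp; ring, fun x hx => ?_⟩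
  simp only [setIvar_iarr, setIarr_iarr, true_and]
  split_ifs with hxp
  · rw [hxp]
  · exact hrow x (by omega)

open Classical in
theorem runs_endpointCmd {n : ℕ} {A : ℕ → ℕ → Prop} {s : State} (h0 : s.ivar 0 = n)
    (hrow : ∀ u < n, s.iarr 3 u = u * n)
    (hadj : ∀ u < n, ∀ v < n, s.iarr 0 (u * n + v) = if A u v then 1 else 0) :
    Runs endpointCmd s ((n + 1) * ((n + 1) * 30 + 30)) fun s' =>
      (∃ u < n, degreeBelow A u n ≤ 1) →
        s'.ivar 6 < n ∧ degreeBelow A (s'.ivar 6) n ≤ 1 := by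
  refine (Runs.forVar (T := 2 + ((n + 1) * 19 + 10))
    (fun i s' => (∃ u < i, degreeBelow A u n ≤ 1) →
      s'.ivar 6 < n ∧ degreeBelow A (s'.ivar 6) n ≤ 1) rfl rfl h0 (by simp)
    fun i hi s' F h2 hI => ?_).mono (Nat.mul_le_mul_left _ (by omega)) fun s' F h => h
  have e0 : s'.ivar 0 = n := (F.ivar 0 rfl).trans h0
  have hset : Runs (.iset 5 (.const 0)) s' 2 fun s₁ => s₁.ivar 5 = 0 :=
    Cmd.wp.runs (fun v hv => by rw [hv]; simp [IExp.eval]) (by decide)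
  refine hset.seq fun s₁ F₁ q₁ => ?_
  have e1 : s₁.ivar 0 = n := (F₁.ivar 0 rfl).trans e0
  refine (Runs.forVar (T := 8)
    (fun j s₂ => s₂.ivar 5 = degreeBelow A i j) rfl rfl e1 (by simp [degreeBelow, q₁])
    fun j hj s₂ F₂ h4 hJ => ?_).seq fun s₂ F₂ q₂ => ?_
  · refine Cmd.wp.runs ?_ (by decide)
    simp only [Cmd.wp, IExp.eval]
    intro v hv
    rw [hJ, h4, F₂.ivar 2 rfl, F₁.ivar 2 rfl, h2, F₂.iarr 3 rfl, F₁.iarr 3 rfl, F.iarr 3 rfl,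
      hrow i hi, F₂.iarr 0 rfl, F₁.iarr 0 rfl, F.iarr 0 rfl, hadj i hi j hj] at hv
    simp only [degreeBelow, sum_range_succ] at hv ⊢
    simp only [setIvar_ivar, hv]
    rw [if_neg (by decide), if_pos trivial]
  · have e2 : s₂.ivar 2 = i := by rw [F₂.ivar 2 rfl, F₁.ivar 2 rfl, h2]
    have e6 : s₂.ivar 6 = s'.ivar 6 := by rw [F₂.ivar 6 rfl, F₁.ivar 6 rfl]
    refine Cmd.wp.runs ?_ (by decide)
    simp only [Cmd.wp, IExp.eval, BExp.holds, q₂, e2]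
    refine ⟨fun hdeg v hv => ?_, fun hdeg => ?_⟩
    · subst hv
      simp [hi, hdeg]
    · simp only [setIvar_ivar, e6]
      rintro ⟨u, hu, hdu⟩
      rcases Nat.lt_succ_iff_lt_or_eq.1 hu with hu | rfl
      · simpa using hI ⟨u, hu, hdu⟩
      · exact absurd hdu hdeg

open Classical in
theorem runs_walkCmd {n : ℕ} {A : ℕ → ℕ → Prop} {φ : ℕ → ℕ} {s : State} (h : IsPathLabel n A φ)
    (h0 : s.ivar 0 = n) (hrow : ∀ u < n, s.iarr 3 u = u * n)
    (hadj : ∀ u < n, ∀ v < n, s.iarr 0 (u * n + v) = if A u v then 1 else 0)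
    (hfirst : s.ivar 6 = φ 0) :
    Runs walkCmd s (2 + (n + 1) * ((n + 1) * 40 + 30)) fun s' => ∀ k < n, s'.iarr 4 k = φ k := by
  have hset : Runs (.iset 7 (.var 0)) s 2 fun s₁ => s₁.ivar 7 = n :=
    Cmd.wp.runs (fun v hv => by rw [hv]; simp [IExp.eval, h0]) (by decide)
  refine hset.seq fun s₁ F₁ q₁ => ?_
  have e1 : s₁.ivar 0 = n := (F₁.ivar 0 rfl).trans h0
  refine (Runs.forVar (T := 5 + ((n + 1) * (17 + 11) + 4))
    (fun k s' => (∀ j < k, s'.iarr 4 j = φ j) ∧ (k < n → s'.ivar 6 = φ k) ∧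
      s'.ivar 7 = if k = 0 then n else φ (k - 1)) rfl rfl e1
    ⟨by simp, fun _ => by simp [F₁.ivar 6 rfl, hfirst], by simp [q₁]⟩
    fun k hk s' F h2 ⟨hord, hcur, hprev⟩ => ?_).mono
    (Nat.mul_le_mul_left _ (by omega)) fun s' F h => h.1
  have e0 : s'.ivar 0 = n := (F.ivar 0 rfl).trans e1
  have hinit : Runs (.seq (.iput 4 (.var 2) (.var 6)) (.iset 8 (.var 6))) s' 5 fun s₂ =>
      ∀ x, s₂.iarr 4 x = if x = k then φ k else s'.iarr 4 x := by
    refine Cmd.wp.runs ?_ (by decide)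
    simp only [Cmd.wp, IExp.eval, h2, hcur hk]
    intro p v hp hv u hu x
    subst hp hv hu
    simp
  refine hinit.seq fun s₂ F₂ q₂ => ?_
  have e2 : s₂.ivar 0 = n := (F₂.ivar 0 rfl).trans e0
  refine (Runs.forVar (T := 17)
    (fun i s₃ => k + 1 < n → φ (k + 1) < i → s₃.ivar 8 = φ (k + 1)) rfl rfl e2 (by simp)
    fun i hi s₃ F₃ h4 hI => ?_).seq fun s₃ F₃ q₃ => ?_
  · have e6 : s₃.ivar 6 = φ k := by rw [F₃.ivar 6 rfl, F₂.ivar 6 rfl, hcur hk]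
    have e7 : s₃.ivar 7 = if k = 0 then n else φ (k - 1) := by
      rw [F₃.ivar 7 rfl, F₂.ivar 7 rfl, hprev]
    have er : s₃.iarr 3 (φ k) = φ k * n := by
      rw [F₃.iarr 3 rfl, F₂.iarr 3 rfl, F.iarr 3 rfl, F₁.iarr 3 rfl, hrow _ (h.lt k hk)]
    have ea : s₃.iarr 0 (φ k * n + i) = if A (φ k) i then 1 else 0 := by
      rw [F₃.iarr 0 rfl, F₂.iarr 0 rfl, F.iarr 0 rfl, F₁.iarr 0 rfl, hadj _ (h.lt k hk) i hi]
    refine Cmd.wp.runs ?_ (by decide)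
    simp only [Cmd.wp, IExp.eval, BExp.holds, e6, er, h4, ea, e7]
    obtain ⟨m, hm, rfl⟩ := h.surj i hi
    rw [h.adj k hk m hm]
    -- the test succeeds exactly at the next vertex of the path
    refine ⟨fun ⟨hA, hne⟩ v hv hk1 hlt => ?_, fun hnot hk1 hlt => ?_⟩
    · have hm' : k + 1 = m := by
        by_contra hcon
        have hA : k + 1 = m ∨ m + 1 = k := by
          by_contra h'; simp [h'] at hA
        apply hne
        rw [if_neg (by omega)]
        congr 1; omega
      subst hv hm'
      simp
    · simp only [setIvar_ivar]
      rw [if_neg (by decide)]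
      apply hI hk1
      refine lt_of_le_of_ne (Nat.lt_succ_iff.1 hlt) fun heq => hnot ?_
      have hm' := h.inj _ hk1 _ hm heq
      subst hm'
      refine ⟨by simp, ?_⟩
      split_ifs
      · exact (h.lt _ hk1).ne
      · intro h'
        have := h.inj _ hk1 _ (by omega) h'
        omega
  · have e6 : s₃.ivar 6 = φ k := by rw [F₃.ivar 6 rfl, F₂.ivar 6 rfl, hcur hk]
    refine Cmd.wp.runs ?_ (by decide)
    simp only [Cmd.wp, IExp.eval, e6]
    intro v hv u hu
    subst hv hu
    refine ⟨fun j hj => ?_, fun hk1 => ?_, by simp⟩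
    · simp only [setIvar_iarr]
      rw [F₃.iarr 4 rfl, q₂]
      split_ifs with hjk
      · rw [hjk]
      · exact hord j (by omega)
    · simpa using q₃ hk1 (h.lt _ hk1)

open Classical in
theorem runs_readCmd {n : ℕ} {A : ℕ → ℕ → Prop} {s : State} (hA : ∃ φ, IsPathLabel n A φ)
    (hn : 0 < n) (h0 : s.ivar 0 = n) (h3 : s.ivar 3 = 0)
    (hadj : ∀ u < n, ∀ v < n, s.iarr 0 (u * n + v) = if A u v then 1 else 0) :
    Runs readCmd s (500 * n ^ 2) fun s' => ∃ φ, IsPathLabel n A φ ∧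
      (∀ u < n, s'.iarr 3 u = u * n) ∧ ∀ k < n, s'.iarr 4 k = φ k := by
  obtain ⟨φ, hφ⟩ := hA
  have hbound : (n + 1) * 20 + ((n + 1) * ((n + 1) * 30 + 30) +
      (2 + (n + 1) * ((n + 1) * 40 + 30))) ≤ 500 * n ^ 2 := by
    nlinarith
  refine ((runs_multiplesCmd h0 h3).seq fun s₁ F₁ q₁ => ?_).mono hbound fun _ _ h => h
  have h0₁ : s₁.ivar 0 = n := (F₁.ivar 0 rfl).trans h0
  have hadj₁ : ∀ u < n, ∀ v < n, s₁.iarr 0 (u * n + v) = if A u v then 1 else 0 := by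
    rw [F₁.iarr 0 rfl]; exact hadj
  refine (runs_endpointCmd h0₁ q₁ hadj₁).seq fun s₂ F₂ q₂ => ?_
  obtain ⟨h6, hdeg⟩ := q₂ ⟨φ 0, hφ.lt 0 hn, hφ.degree_first_le hn⟩
  obtain ⟨ψ, hψ, hψ0⟩ := hφ.exists_first h6 hdeg
  have q₁' : ∀ u < n, s₂.iarr 3 u = u * n := by rw [F₂.iarr 3 rfl]; exact q₁
  refine (runs_walkCmd hψ ((F₂.ivar 0 rfl).trans h0₁) q₁'
    (by rw [F₂.iarr 0 rfl]; exact hadj₁) hψ0.symm).mono le_rfl fun s₃ F₃ q₃ => ?_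
  exact ⟨ψ, hψ, by rw [F₃.iarr 3 rfl]; exact q₁', q₃⟩

/-- Write the endpoints of the edges of the schedule of the whole path. -/
def writeCmd : Cmd :=
  .seq (.seq (.iset 1 (.sub (.var 0) (.const 1)))
    (.iset 18 (.get 5 (tableExp (.const 0) (.var 1))))) <|
  .for 2 (.var 1) <| .seq (.iset 21 (.get 6 (.add (.var 18) (.var 2)))) <|
    .seq (.iput 1 (.var 2) (.get 4 (.var 21)))
      (.iput 2 (.var 2) (.get 4 (.add (.var 21) (.const 1))))

theorem runs_writeCmd {n : ℕ} {s : State} (hn : 0 < n) (h0 : s.ivar 0 = n)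
    (hrow : s.iarr 3 0 = 0) :
    Runs writeCmd s (60 * n) fun s' => s'.ivar 1 = n - 1 ∧ ∀ k < n - 1,
      s'.iarr 1 k = s.iarr 4 (s.iarr 6 (s.iarr 5 (n - 1) + k)) ∧
      s'.iarr 2 k = s.iarr 4 (s.iarr 6 (s.iarr 5 (n - 1) + k) + 1) := by
  have hinit : Runs (.seq (.iset 1 (.sub (.var 0) (.const 1)))
      (.iset 18 (.get 5 (tableExp (.const 0) (.var 1))))) s 12 fun s₁ =>
      s₁.ivar 1 = n - 1 ∧ s₁.ivar 18 = s.iarr 5 (n - 1) := by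
    refine Cmd.wp.runs ?_ (by decide)
    simp only [Cmd.wp, IExp.eval, tableExp, h0]
    intro v hv u hu
    subst hv
    simp [hrow] at hu
    subst hu
    simp
  refine (hinit.seq (T' := (n - 1 + 1) * (18 + 11)) fun s₁ F₁ ⟨q1, q18⟩ => ?_).mono
    (by omega) fun _ _ h => h
  refine (Runs.forVar (T := 18)
    (fun i s' => ∀ k < i, s'.iarr 1 k = s.iarr 4 (s.iarr 6 (s.iarr 5 (n - 1) + k)) ∧
      s'.iarr 2 k = s.iarr 4 (s.iarr 6 (s.iarr 5 (n - 1) + k) + 1)) rfl rfl q1 (by simp)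
    fun i hi s' F h2 hI => ?_).mono le_rfl fun s' F h => ⟨(F.ivar 1 rfl).trans q1, h⟩
  refine Cmd.wp.runs ?_ (by decide)
  simp only [Cmd.wp, IExp.eval]
  intro e he p v hp hv p' v' hp' hv'
  simp at hp hv hp' hv'
  rw [h2, F.ivar 18 rfl, q18, F.iarr 6 rfl, F₁.iarr 6 rfl] at he
  rw [F.iarr 4 rfl, F₁.iarr 4 rfl] at hv hv'
  rw [h2] at hp hp'
  subst he hp hv hp' hv'
  intro k hk
  simp only [setIvar_iarr, setIarr_iarr]
  by_cases hki : k = p'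
  · subst hki; simp
  · simpa [hki] using hI k (by omega)

/-- The whole program. -/
def pathCmd : Cmd := .seq readCmd <| .seq intervalsCmd writeCmd

end PathProgram

/-! ### The network construction problem on a path -/

namespace NetworkConstruction

open SupermodularScheduling Finset

/-- The sequence `p 0, …, p (n - 1)` enumerates the vertices of the path `G` in their order. -/
structure IsPathEnum {n : ℕ} (G : SimpleGraph (Fin n)) (p : ℕ → Fin n) : Prop where
  inj : ∀ i < n, ∀ j < n, p i = p j → i = j
  surj : ∀ v, ∃ i < n, p i = v
  adj : ∀ i < n, ∀ j < n, G.Adj (p i) (p j) ↔ i + 1 = j ∨ j + 1 = i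

/-- The `i`-th edge of the path. -/
def pathEdge {n : ℕ} (p : ℕ → Fin n) (i : ℕ) : Sym2 (Fin n) := s(p i, p (i + 1))

variable {n : ℕ} {G : SimpleGraph (Fin n)} {p : ℕ → Fin n}

theorem IsPathEnum.pathEdge_mem (h : IsPathEnum G p) {i : ℕ} (hi : i + 1 < n) :
    pathEdge p i ∈ G.edgeSet :=
  (h.adj i (by omega) (i + 1) hi).2 (Or.inl rfl)

theorem IsPathEnum.pathEdge_inj (h : IsPathEnum G p) {i j : ℕ} (hi : i + 1 < n) (hj : j + 1 < n)
    (hij : pathEdge p i = pathEdge p j) : i = j := by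
  rcases Sym2.eq_iff.1 hij with ⟨h1, _⟩ | ⟨h1, h2⟩
  · exact h.inj _ (by omega) _ (by omega) h1
  · have := h.inj _ (by omega) _ (by omega) h1
    have := h.inj _ (by omega) _ (by omega) h2
    omega

theorem IsPathEnum.exists_pathEdge (h : IsPathEnum G p) {e : Sym2 (Fin n)} (he : e ∈ G.edgeSet) :
    ∃ i, i + 1 < n ∧ e = pathEdge p i := by
  induction e using Sym2.ind with
  | _ u v =>
    obtain ⟨i, hi, rfl⟩ := h.surj u
    obtain ⟨j, hj, rfl⟩ := h.surj v
    rcases (h.adj i hi j hj).1 he with rfl | rfl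
    · exact ⟨i, hj, rfl⟩
    · exact ⟨j, hi, Sym2.eq_swap⟩

/-- A pair of vertices is connected exactly when all edges between them are built. -/
theorem IsPathEnum.reachable_iff (h : IsPathEnum G p) {S : List (Sym2 (Fin n))}
    (hS : ∀ e ∈ S, e ∈ G.edgeSet) {a b : ℕ} (hab : a ≤ b) (hb : b < n) :
    (built S).Reachable (p a) (p b) ↔ ∀ i ∈ Ico a b, pathEdge p i ∈ S := by
  constructor
  · intro hr i hi
    by_contra hiS
    rw [mem_Ico] at hi
    -- without the edge `i`, the vertices up to `i` are closed under adjacency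
    have hcl : ∀ v, (built S).Reachable (p a) v → ∃ j ≤ i, p j = v := by
      intro v hv
      rw [SimpleGraph.reachable_iff_reflTransGen] at hv
      induction hv with
      | refl => exact ⟨a, hi.1, rfl⟩
      | @tail _ w _ hadj ih =>
        obtain ⟨j, hj, rfl⟩ := ih
        obtain ⟨j', hj', rfl⟩ := h.surj w
        have hmem : s(p j, p j') ∈ S := ((SimpleGraph.fromEdgeSet_adj _).1 hadj).1
        refine ⟨j', ?_, rfl⟩
        by_contra hlt
        rcases (h.adj j (by omega) j' hj').1 (hS _ hmem) with rfl | rfl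
        · obtain rfl : j = i := by omega
          exact hiS hmem
        · omega
    obtain ⟨j, hj, hjb⟩ := hcl _ hr
    have := h.inj j (by omega) b hb hjb
    omega
  · intro hall
    induction b, hab using Nat.le_induction with
    | base => exact SimpleGraph.Reachable.refl _
    | succ b hab ih =>
      refine (ih (by omega) fun i hi => hall i (by rw [mem_Ico] at hi ⊢; omega)).trans ?_
      refine SimpleGraph.Adj.reachable ((SimpleGraph.fromEdgeSet_adj _).2 ⟨?_, fun heq => ?_⟩)
      · exact hall b (mem_Ico.2 ⟨hab, by omega⟩)
      · have := h.inj _ (by omega) _ hb heq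
        omega

/-- The solution sequences are the orders of all edges of the path. -/
theorem IsPathEnum.isSolution_iff {I : Instance n} (h : IsPathEnum I.graph p) (hn : 0 < n)
    {S : List (Sym2 (Fin n))} : I.IsSolution S ↔
      S.Nodup ∧ (∀ e ∈ S, e ∈ I.graph.edgeSet) ∧ ∀ i, i + 1 < n → pathEdge p i ∈ S := by
  constructor
  · rintro ⟨hnd, hS, htree⟩
    refine ⟨hnd, hS, fun i hi => ?_⟩
    have hr := htree.1.preconnected (p 0) (p (n - 1))
    exact (h.reachable_iff hS (Nat.zero_le _) (by omega)).1 hr i (mem_Ico.2 ⟨by omega, by omega⟩)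
  · rintro ⟨hnd, hS, hall⟩
    refine ⟨hnd, hS, SimpleGraph.isTree_iff_connected_and_card.2 ⟨?_, ?_⟩⟩
    · have hr : ∀ v, (built S).Reachable (p 0) v := by
        intro v
        obtain ⟨i, hi, rfl⟩ := h.surj v
        refine (h.reachable_iff hS (Nat.zero_le _) hi).2 fun j hj => hall j ?_
        rw [mem_Ico] at hj
        omega
      have : Nonempty (Fin n) := ⟨⟨0, hn⟩⟩
      exact ⟨fun u v => (hr u).symm.trans (hr v)⟩
    · have hset : (built S).edgeSet = ((range (n - 1)).image (pathEdge p) : Finset _) := by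
        ext e
        rw [built, SimpleGraph.edgeSet_fromEdgeSet, coe_image]
        constructor
        · rintro ⟨he, _⟩
          obtain ⟨i, hi, rfl⟩ := h.exists_pathEdge (hS e he)
          exact ⟨i, by simp; omega, rfl⟩
        · rintro ⟨i, hi, rfl⟩
          have hi : i < n - 1 := by simpa using hi
          exact ⟨hall i (by omega),
            I.graph.not_isDiag_of_mem_edgeSet (h.pathEdge_mem (by omega))⟩
      rw [hset, Nat.card_coe_set_eq, Set.ncard_coe_finset, card_image_of_injOn, card_range,
        Nat.card_fin]
      · omega
      · intro i hi j hj hij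
        have hi : i < n - 1 := by simpa using hi
        have hj : j < n - 1 := by simpa using hj
        exact h.pathEdge_inj (by omega) (by omega) hij

/-- While an edge is under construction, a pair waits exactly if the earlier edges do not yet
connect it. -/
theorem IsPathEnum.connectionTime_eq {I : Instance n} (h : IsPathEnum I.graph p) (hn : 0 < n)
    {S : List (Sym2 (Fin n))} (hsol : I.IsSolution S) {a b : ℕ} (hab : a < b) (hb : b < n) :
    I.connectionTime S s(p a, p b) = ∑ i ∈ range (n - 1),
      if Ico a b ⊆ before (fun j => S.idxOf (pathEdge p j)) (range (n - 1)) i then 0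
      else I.len (pathEdge p i) := by
  obtain ⟨hnd, hS, hall⟩ := (h.isSolution_iff hn).1 hsol
  have hset : ∀ k, (∀ u ∈ s(p a, p b), ∀ v ∈ s(p a, p b), (built (S.take k)).Reachable u v) ↔
      ∀ i ∈ Ico a b, pathEdge p i ∈ S.take k := by
    intro k
    rw [← h.reachable_iff (fun e he => hS e (List.mem_of_mem_take he)) hab.le hb]
    simp only [Sym2.mem_iff, forall_eq_or_imp, forall_eq]
    exact ⟨fun h => h.1.2, fun h => ⟨⟨.refl _, h⟩, h.symm, .refl _⟩⟩
  have hmem : ∀ {i k}, i + 1 < n → (pathEdge p i ∈ S.take k ↔ S.idxOf (pathEdge p i) < k) :=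
    fun {i k} hi => List.mem_take_iff_idxOf_lt (hall i hi)
  set K := connectionIndex S s(p a, p b) with hK
  have hKall : ∀ i ∈ Ico a b, pathEdge p i ∈ S.take K := by
    have : K ∈ {k : ℕ | ∀ u ∈ s(p a, p b), ∀ v ∈ s(p a, p b),
        (built (S.take k)).Reachable u v} := by
      apply Nat.sInf_mem
      refine ⟨S.length, (hset _).2 fun i hi => ?_⟩
      rw [List.take_length]
      exact hall i (by rw [mem_Ico] at hi; omega)
    exact (hset K).1 this
  have hlt : ∀ k, k < K ↔ ¬ ∀ i ∈ Ico a b, pathEdge p i ∈ S.take k := by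
    intro k
    constructor
    · intro hk hk'
      exact Nat.notMem_of_lt_sInf hk ((hset k).2 hk')
    · intro hk
      by_contra hle
      refine hk fun i hi => ?_
      have hi' : i + 1 < n := by rw [mem_Ico] at hi; omega
      have := (hmem hi').1 (hKall i hi)
      exact (hmem hi').2 (by omega)
  have hto : (S.take K).toFinset =
      ((range (n - 1)).filter fun i => S.idxOf (pathEdge p i) < K).image (pathEdge p) := by
    ext e
    rw [List.mem_toFinset, mem_image]
    constructor
    · intro he
      obtain ⟨i, hi, rfl⟩ := h.exists_pathEdge (hS e (List.mem_of_mem_take he))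
      exact ⟨i, mem_filter.2 ⟨mem_range.2 (by omega), (hmem hi).1 he⟩, rfl⟩
    · rintro ⟨i, hi, rfl⟩
      rw [mem_filter, mem_range] at hi
      exact (hmem (by omega)).2 hi.2
  unfold Instance.connectionTime
  rw [← hK, ← List.sum_toFinset _ (hnd.sublist (List.take_sublist _ _)), hto, sum_image,
    sum_filter]
  · refine sum_congr rfl fun i hi => ?_
    have hiff : Ico a b ⊆ before (fun j => S.idxOf (pathEdge p j)) (range (n - 1)) i ↔
        ¬ S.idxOf (pathEdge p i) < K := by
      rw [hlt, not_not]
      refine forall₂_congr fun j hj => ?_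
      have hj' : j + 1 < n := by rw [mem_Ico] at hj; omega
      rw [hmem hj', before, mem_filter, mem_range]
      exact and_iff_right (by omega)
    by_cases hc : S.idxOf (pathEdge p i) < K
    · rw [if_pos hc, if_neg (fun h => hiff.1 h hc)]
    · rw [if_neg hc, if_pos (hiff.2 hc)]
  · intro i hi j hj hij
    have hi := mem_range.1 (mem_filter.1 hi).1
    have hj := mem_range.1 (mem_filter.1 hj).1
    exact h.pathEdge_inj (by omega) (by omega) hij

theorem IsPathEnum.sum_sym2 (h : IsPathEnum G p) {F : Sym2 (Fin n) → ℝ}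
    (hF : ∀ v, F s(v, v) = 0) :
    ∑ e, F e = ∑ v ∈ range n, ∑ u ∈ range v, F s(p u, p v) := by
  classical
  have h1 : ∑ e, F e = ∑ e with ¬ e.IsDiag, F e := by
    symm
    refine sum_filter_of_ne fun e _ he => ?_
    induction e using Sym2.ind with
    | _ u v =>
      intro hd
      rw [Sym2.mk_isDiag_iff] at hd
      subst hd
      exact he (hF u)
  rw [h1, sum_sigma']
  symm
  refine sum_bij (fun x _ => s(p x.2, p x.1)) ?_ ?_ ?_ fun _ _ => rfl
  · rintro ⟨v, u⟩ hx
    simp only [mem_sigma, mem_range] at hx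
    simp only [mem_filter, mem_univ, true_and, Sym2.mk_isDiag_iff]
    intro heq
    have := h.inj _ (by omega) _ (by omega) heq
    omega
  · rintro ⟨v, u⟩ hx ⟨v', u'⟩ hx' heq
    simp only [mem_sigma, mem_range] at hx hx'
    dsimp only at heq
    rcases Sym2.eq_iff.1 heq with ⟨e1, e2⟩ | ⟨e1, e2⟩
    · have e1 := h.inj _ (by omega) _ (by omega) e1
      have e2 := h.inj _ (by omega) _ (by omega) e2
      subst e1 e2; rfl
    · have e1 := h.inj _ (by omega) _ (by omega) e1
      have e2 := h.inj _ (by omega) _ (by omega) e2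
      omega
  · intro e he
    induction e using Sym2.ind with
    | _ x y =>
      obtain ⟨i, hi, rfl⟩ := h.surj x
      obtain ⟨j, hj, rfl⟩ := h.surj y
      simp only [mem_filter, mem_univ, true_and, Sym2.mk_isDiag_iff] at he
      rcases lt_trichotomy i j with hij | rfl | hij
      · exact ⟨⟨j, i⟩, by simp [hij, hj], rfl⟩
      · exact absurd rfl he
      · exact ⟨⟨i, j⟩, by simp [hij, hi], Sym2.eq_swap⟩

/-- The total weighted connection time is the cost of the order of the edges for the reward that
counts the connected pairs. -/
theorem IsPathEnum.cost_eq {I : Instance n} (h : IsPathEnum I.graph p) (hn : 0 < n)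
    {S : List (Sym2 (Fin n))} (hsol : I.IsSolution S) :
    I.cost S = orderCost (reward n fun u v => I.weight s(p u, p v))
      (fun i => I.len (pathEdge p i)) (Ico 0 (n - 1)) fun j => S.idxOf (pathEdge p j) := by
  rw [← range_eq_Ico]
  have h1 : I.cost S = ∑ e, I.weight e * I.connectionTime S e := by
    unfold Instance.cost Instance.relevantPairs
    refine sum_filter_of_ne fun e _ he => ?_
    refine lt_of_le_of_ne (I.weight_nonneg e) fun h0 => he ?_
    rw [← h0, zero_mul]
  rw [h1, h.sum_sym2 fun v => by rw [I.weight_diag, zero_mul]]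
  set pos := fun j => S.idxOf (pathEdge p j) with hpos
  have h2 : ∀ v ∈ range n, ∀ u ∈ range v,
      I.weight s(p u, p v) * I.connectionTime S s(p u, p v) = ∑ i ∈ range (n - 1),
        if Ico u v ⊆ before pos (range (n - 1)) i then 0
        else I.len (pathEdge p i) * I.weight s(p u, p v) := by
    intro v hv u hu
    rw [h.connectionTime_eq hn hsol (mem_range.1 hu) (mem_range.1 hv), mul_sum]
    refine sum_congr rfl fun i _ => ?_
    split_ifs
    · rw [mul_zero]
    · rw [mul_comm]
  rw [sum_congr rfl fun v hv => sum_congr rfl (h2 v hv)]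
  rw [sum_congr rfl fun v _ => sum_comm, sum_comm]
  unfold orderCost reward
  refine sum_congr rfl fun i _ => ?_
  rw [← sum_sub_distrib, mul_sum]
  refine sum_congr rfl fun v hv => ?_
  rw [← sum_sub_distrib, mul_sum]
  refine sum_congr rfl fun u hu => ?_
  have hsub : Ico u v ⊆ range (n - 1) := fun x hx => by
    rw [mem_range] at hu hv ⊢
    rw [mem_Ico] at hx
    omega
  rw [if_pos hsub]
  split_ifs <;> ring

theorem IsPathEnum.isOptimal {I : Instance n} (h : IsPathEnum I.graph p) (hn : 0 < n) {σ : List ℕ}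
    {κ : ℕ → ℝ} (hσ : IsSolved (reward n fun u v => I.weight s(p u, p v))
      (fun i => I.len (pathEdge p i)) (Ico 0 (n - 1)) σ κ) :
    I.IsOptimal (σ.map (pathEdge p)) := by
  have mσ : ∀ {i}, i ∈ σ ↔ i + 1 < n := fun {i} => by
    rw [← List.mem_toFinset, hσ.toFinset_eq, mem_Ico]; omega
  have hsol : I.IsSolution (σ.map (pathEdge p)) := by
    refine (h.isSolution_iff hn).2 ⟨?_, ?_, fun i hi => List.mem_map_of_mem (mσ.2 hi)⟩
    · exact hσ.nodup.map_on fun i hi j hj hij => h.pathEdge_inj (mσ.1 hi) (mσ.1 hj) hij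
    · intro e he
      obtain ⟨i, hi, rfl⟩ := List.mem_map.1 he
      exact h.pathEdge_mem (mσ.1 hi)
  have hidx : ∀ i ∈ σ, (σ.map (pathEdge p)).idxOf (pathEdge p i) = σ.idxOf i := by
    intro i hi
    have hlt := List.idxOf_lt_length_of_mem hi
    have := hsol.1.idxOf_getElem (σ.idxOf i) (by simpa using hlt)
    simpa using this
  refine ⟨hsol, fun S' hsol' => ?_⟩
  rw [h.cost_eq hn hsol, h.cost_eq hn hsol']
  have hcongr := orderCost_congr (f := reward n fun u v => I.weight s(p u, p v))
    (c := fun i => I.len (pathEdge p i)) (E := Ico 0 (n - 1))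
    (pos := fun j => (σ.map (pathEdge p)).idxOf (pathEdge p j)) (pos' := fun j => σ.idxOf j)
    fun x hx y hy => by
      rw [← hσ.toFinset_eq, List.mem_toFinset] at hx hy
      simp only [hidx x hx, hidx y hy]
  rw [hcongr]
  refine hσ.optimal.2 _ fun i hi j hj hij => ?_
  have hi : i + 1 < n := by have := mem_Ico.1 (mem_coe.1 hi); omega
  have hj : j + 1 < n := by have := mem_Ico.1 (mem_coe.1 hj); omega
  obtain ⟨_, _, hall⟩ := (h.isSolution_iff hn).1 hsol'
  exact h.pathEdge_inj hi hj ((List.idxOf_inj (hall i hi)).1 hij)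

theorem flatten_apply {α : Type} [Zero α] (M : Fin n → Fin n → α) {u v : ℕ} (hu : u < n)
    (hv : v < n) : flatten M (u * n + v) = M ⟨u, hu⟩ ⟨v, hv⟩ := by
  have h1 : (u * n + v) / n = u := by
    rw [mul_comm, Nat.mul_add_div (by omega), Nat.div_eq_of_lt hv, add_zero]
  have h2 : (u * n + v) % n = v := by
    rw [mul_comm, Nat.mul_add_mod, Nat.mod_eq_of_lt hv]
  unfold flatten
  rw [dif_pos ⟨by rwa [h1], by rwa [h2]⟩]
  simp only [h1, h2]

end NetworkConstruction

open RealRAM SupermodularScheduling PathProgram in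
theorem corollary1 :
    ∃ (P : RealRAM.Cmd) (C : ℕ),
      ∀ (n : ℕ) (I : NetworkConstruction.Instance n), I.IsPath →
        ∃ (t : ℕ) (s : RealRAM.State) (S : List (Sym2 (Fin n))),
          RealRAM.Exec P I.input t s ∧ t ≤ C * n ^ 4 ∧
            NetworkConstruction.IsOutput s S ∧ I.IsOptimal S := by
  classical
  refine ⟨pathCmd, 4000, fun n I ⟨iso⟩ => ?_⟩
  have hn : 0 < n := by
    obtain ⟨v⟩ := I.connected.nonempty
    exact v.pos
  set A : ℕ → ℕ → Prop := fun u v => ∃ (hu : u < n) (hv : v < n), I.graph.Adj ⟨u, hu⟩ ⟨v, hv⟩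
    with hA
  have hlabel : ∃ φ, IsPathLabel n A φ := by
    have hv : ∀ {i} (hi : i < n),
        (if h : i < n then (iso ⟨i, h⟩ : ℕ) else 0) = iso ⟨i, hi⟩ := fun hi => dif_pos hi
    refine ⟨fun i => if h : i < n then (iso ⟨i, h⟩ : ℕ) else 0, fun i hi => ?_,
      fun i hi j hj hij => ?_, fun v hv' => ?_, fun i hi j hj => ?_⟩
    · simp only [hv hi]; exact Fin.is_lt _
    · simp only [hv hi, hv hj] at hij
      simpa using iso.injective (Fin.ext hij)
    · refine ⟨iso.symm ⟨v, hv'⟩, Fin.is_lt _, ?_⟩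
      simp
    · simp only [hv hi, hv hj, hA, Fin.is_lt, exists_true_left, Fin.eta]
      rw [iso.map_adj_iff, SimpleGraph.pathGraph_adj]
  have hadj : ∀ u < n, ∀ v < n, I.input.iarr 0 (u * n + v) = if A u v then 1 else 0 := by
    intro u hu v hv
    have : A u v ↔ I.graph.Adj ⟨u, hu⟩ ⟨v, hv⟩ := ⟨fun ⟨_, _, h⟩ => h, fun h => ⟨hu, hv, h⟩⟩
    simp only [NetworkConstruction.Instance.input, if_pos,
      NetworkConstruction.flatten_apply _ hu hv, this]
  have hread := runs_readCmd hlabel hn (s := I.input)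
    (by simp [NetworkConstruction.Instance.input]) (by simp [NetworkConstruction.Instance.input])
    (by convert hadj)
  suffices hrun : Runs pathCmd I.input (500 * n ^ 2 + (2700 * n ^ 4 + 60 * n)) fun s =>
      ∃ S : List (Sym2 (Fin n)), NetworkConstruction.IsOutput s S ∧ I.IsOptimal S by
    obtain ⟨t, s, hex, ht, S, hout, hopt⟩ := hrun
    refine ⟨t, s, S, hex, ht.trans ?_, hout, hopt⟩
    have h1 : n ≤ n ^ 4 := Nat.le_self_pow (by decide) n
    have h2 : n ^ 2 ≤ n ^ 4 := Nat.pow_le_pow_right hn (by decide)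
    omega
  refine hread.seq fun s₁ F₁ ⟨φ, hφ, hrow, hord⟩ => ?_
  obtain ⟨p, hp⟩ : ∃ p : ℕ → Fin n, ∀ i < n, (p i : ℕ) = φ i :=
    ⟨fun i => if h : φ i < n then ⟨φ i, h⟩ else ⟨0, hn⟩, fun i hi => by simp [hφ.lt i hi]⟩
  have hpe : ∀ i, ∀ hi : i < n, (⟨φ i, hφ.lt i hi⟩ : Fin n) = p i := fun i hi =>
    Fin.ext (hp i hi).symm
  have henum : NetworkConstruction.IsPathEnum I.graph p := by
    refine ⟨fun i hi j hj hij => hφ.inj i hi j hj ?_, fun v => ?_, fun i hi j hj => ?_⟩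
    · rw [← hp i hi, ← hp j hj, hij]
    · obtain ⟨i, hi, hiv⟩ := hφ.surj v v.is_lt
      exact ⟨i, hi, Fin.ext ((hp i hi).trans hiv)⟩
    · rw [← hφ.adj i hi j hj, ← hpe i hi, ← hpe j hj]
      exact ⟨fun h => ⟨_, _, h⟩, fun ⟨_, _, h⟩ => h⟩
  -- the machine works with the positions `0, …, n - 1` along the path instead of its vertices
  have henv : IsEnv n (fun i => I.len (NetworkConstruction.pathEdge p i))
      (fun u v => I.weight s(p u, p v)) s₁ := by
    refine ⟨?_, hrow, fun e he => ?_, fun v hv u hu => ?_⟩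
    · rw [F₁.ivar 0 rfl]; simp [NetworkConstruction.Instance.input]
    · rw [hord e (by omega), hord (e + 1) he, hrow _ (hφ.lt e (by omega)), F₁.rarr 0 rfl]
      have hadj' := henum.pathEdge_mem he
      simp only [NetworkConstruction.Instance.input, if_pos]
      rw [NetworkConstruction.flatten_apply _ (hφ.lt e (by omega)) (hφ.lt (e + 1) he),
        hpe e (by omega), hpe (e + 1) he, if_pos (show I.graph.Adj _ _ from hadj'),
        NetworkConstruction.pathEdge]
    · rw [hord u (by omega), hord v hv, hrow _ (hφ.lt u (by omega)), F₁.rarr 1 rfl]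
      simp only [NetworkConstruction.Instance.input, one_ne_zero, if_false, if_true]
      rw [NetworkConstruction.flatten_apply _ (hφ.lt u (by omega)) (hφ.lt v hv),
        hpe u (by omega), hpe v hv]
  have hblank : IsBlank s₁ := by
    refine ⟨fun x => ?_, ?_, fun x => ?_⟩
    · rw [F₁.iarr 5 rfl]; simp [NetworkConstruction.Instance.input]
    · rw [F₁.rarr 5 rfl]; simp [NetworkConstruction.Instance.input]
    · rw [F₁.rarr 3 rfl]; simp [NetworkConstruction.Instance.input]
  refine (runs_intervalsCmd (fun v _ u _ => I.weight_nonneg _)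
    (fun e he => I.len_pos _ (henum.pathEdge_mem he)) hn henv hblank).seq
    fun s₂ F₂ ⟨σ, κ, hσ, hst, _⟩ => ?_
  rw [zero_mul, zero_add] at hst
  refine (runs_writeCmd hn ((F₂.ivar 0 rfl).trans henv.num) ?_).mono le_rfl
    fun s₃ F₃ ⟨hlen, hout⟩ => ?_
  · rw [F₂.iarr 3 rfl, hrow 0 hn, zero_mul]
  have hσlen : σ.length = n - 1 := by rw [hσ.length_eq, Nat.card_Ico, Nat.sub_zero]
  refine ⟨σ.map (NetworkConstruction.pathEdge p), ⟨?_, fun k hk => ?_⟩, henum.isOptimal hn hσ⟩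
  · rw [hlen, List.length_map, hσlen]
  · rw [List.length_map] at hk
    have hlt : σ[k] + 1 < n := by
      have : σ[k] ∈ Finset.Ico 0 (n - 1) := by
        rw [← hσ.toFinset_eq]; exact List.mem_toFinset.2 (List.getElem_mem hk)
      rw [Finset.mem_Ico] at this
      omega
    obtain ⟨o1, o2⟩ := hout k (by omega)
    rw [hst.edge k hk, F₂.iarr 4 rfl] at o1 o2
    refine ⟨p σ[k], p (σ[k] + 1), by simp [NetworkConstruction.pathEdge], ?_, ?_⟩
    · rw [o1, hord _ (by omega), hp _ (by omega)]
    · rw [o2, hord _ hlt, hp _ hlt]
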